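/- **Setting.** Let $\theta>\sigma>0$ and $\rho_\theta=\theta+\sigma^2/\theta$. For each $N\ge 1$ let $M_N=\frac1{\sqrt N}W_N+A_N$, where $A_N$ is the $N\times N$ matrix with all entries equal to $\theta/N$ and $W_N$ is an $N\times N$ random matrix of one of the following two kinds, with constants $\beta, C$ that do not depend on $N$. * *Complex case.* $W_N$ is Hermitian; the real random variables $W_{ii}$ ($i\le N$), $\Re W_{ij}$, $\Im W_{ij}$ ($i<j\le N$) are independent with symmetric laws; $\mathbb E[(\Re W_{ij})^2]=\mathbb E[(\Im W_{ij})^2]=\sigma^2/2$ for $i<j$; $\mathbb E[W_{ii}^2]\le C$; and for every $k\ge 2$ the $2k$-th moment of each of these variables is finite and at most $(\beta k)^k$. * *Real case.* $W_N$ is real symmetric; the $W_{ij}$ ($i\le j$) are independent with symmetric laws; $\mathbb E[W_{ij}^2]=\sigma^2$ for $i<j$; $\mathbb E[W_{ii}^2]\le C$; and for every $k\ge 2$, $\mathbb E[W_{ij}^{2k}]$ is finite and at most $(\beta k)^k$. **Paths.** A closed path of length $L$ is a sequence $\mathcal P=(i_0,i_1,\dots,i_L)$ in $\{1,\dots,N\}$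 with $i_L=i_0$ (loops $i_{j+1}=i_j$ are allowed). An instant $j\in\{1,\dots,L\}$ is *marked* if the unordered edge $\{i_{j-1},i_j\}$ occurs an odd number of times among the first $j$ steps. The origin $i_0$ is *marked* if $i_j=i_0$ for some marked instant $j\in\{1,\dots,L\}$, and *unmarked* otherwise. Let $\mathcal U_{N,L}$ be the set of closed paths of length $L$ whose origin is unmarked and in which at least one unordered edge is passed an odd number of times in total. **Theorem.** Let $(s_N)$ be any sequence of positive integers with $s_N\to\infty$ and $s_N/\sqrt N\to 0$ as $N\to\infty$, and let $L_N\in\{2s_N,\,2s_N+1\}$ for every $N$. Then, in both the complex and the real case, as $N\to\infty$, $$\sum_{(i_0,\dots,i_{L_N})\in\,\mathcal U_{N,L_N}}\mathbb E\Big[\prod_{j=0}^{L_N-1}(M_N)_{i_j i_{j+1}}\Big]=\rho_\theta^{L_N}\,\frac{\sigma^2}{\theta^2}\,(1+o(1)).$$ -/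

import Mathlib

open MeasureTheory ProbabilityTheory Filter Topology Asymptotics

noncomputable section

/-! Random matrices: Wigner matrices and their rank-one deformation. -/

/-- The `N ^ 2` real coordinates of an `N × N` Hermitian matrix, indexed by ordered pairs:
the pair `(i, j)` with `i ≤ j` gives `Re W i j` and the pair `(j, i)` with `i < j` gives
`Im W i j`. -/
def hermCoord {N : ℕ} (W : Matrix (Fin N) (Fin N) ℂ) (p : Fin N × Fin N) : ℝ :=
  if p.1 ≤ p.2 then (W p.1 p.2).re else (W p.2 p.1).im

/-- A complex (Hermitian) `N × N` Wigner matrix with variance parameter `σ ^ 2`, diagonal second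
moments at most `C`, and higher moments of sub-Gaussian growth with constant `β`. -/
structure IsComplexWigner {Ω : Type*} [MeasurableSpace Ω] (P : Measure Ω) (σ β C : ℝ) (N : ℕ)
    (W : Ω → Matrix (Fin N) (Fin N) ℂ) : Prop where
  measurable : ∀ i j, Measurable fun ω => W ω i j
  hermitian : ∀ ω, (W ω).IsHermitian
  indep : iIndepFun (fun (p : Fin N × Fin N) (ω : Ω) => hermCoord (W ω) p) P
  symmetric_law : ∀ p : Fin N × Fin N,
    IdentDistrib (fun ω => hermCoord (W ω) p) (fun ω => -hermCoord (W ω) p) P P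
  variance_re : ∀ i j, i < j → ∫ ω, (W ω i j).re ^ 2 ∂P = σ ^ 2 / 2
  variance_im : ∀ i j, i < j → ∫ ω, (W ω i j).im ^ 2 ∂P = σ ^ 2 / 2
  variance_diag : ∀ i, ∫ ω, (W ω i i).re ^ 2 ∂P ≤ C
  moments : ∀ (p : Fin N × Fin N) (k : ℕ), 2 ≤ k →
    Integrable (fun ω => hermCoord (W ω) p ^ (2 * k)) P ∧
      ∫ ω, hermCoord (W ω) p ^ (2 * k) ∂P ≤ (β * k) ^ k

/-- A real (symmetric) `N × N` Wigner matrix with variance parameter `σ ^ 2`, diagonal second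
moments at most `C`, and higher moments of sub-Gaussian growth with constant `β`. -/
structure IsRealWigner {Ω : Type*} [MeasurableSpace Ω] (P : Measure Ω) (σ β C : ℝ) (N : ℕ)
    (W : Ω → Matrix (Fin N) (Fin N) ℝ) : Prop where
  measurable : ∀ i j, Measurable fun ω => W ω i j
  symmetric : ∀ ω, (W ω).IsSymm
  indep : iIndepFun (fun (p : {p : Fin N × Fin N // p.1 ≤ p.2}) (ω : Ω) => W ω p.1.1 p.1.2) P
  symmetric_law : ∀ i j, IdentDistrib (fun ω => W ω i j) (fun ω => -W ω i j) P P
  variance : ∀ i j, i < j → ∫ ω, W ω i j ^ 2 ∂P = σ ^ 2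
  variance_diag : ∀ i, ∫ ω, W ω i i ^ 2 ∂P ≤ C
  moments : ∀ (i j : Fin N) (k : ℕ), 2 ≤ k →
    Integrable (fun ω => W ω i j ^ (2 * k)) P ∧
      ∫ ω, W ω i j ^ (2 * k) ∂P ≤ (β * k) ^ k

/-- The deformed matrix `M = W / √N + A`, where every entry of `A` is `θ / N`. -/
def deformed {𝕜 : Type*} [RCLike 𝕜] {N : ℕ} (θ : ℝ) (W : Matrix (Fin N) (Fin N) 𝕜) :
    Matrix (Fin N) (Fin N) 𝕜 :=
  Matrix.of fun i j => W i j / ((√(N : ℝ) : ℝ) : 𝕜) + ((θ / N : ℝ) : 𝕜)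

/-! Closed paths `i_0, i_1, …, i_L = i_0`. The step `j : Fin L` goes from `i_j` to `i_{j+1}`;
it is taken at the instant `j + 1`. -/

/-- Closed paths of length `L` on the vertices `Fin N`; loops are allowed. -/
abbrev ClosedPath (N L : ℕ) : Type := {p : Fin (L + 1) → Fin N // p 0 = p (Fin.last L)}

namespace ClosedPath

variable {N L : ℕ}

/-- The unordered edge passed at step `j`. -/
def edge (p : ClosedPath N L) (j : Fin L) : Sym2 (Fin N) := s(p.1 j.castSucc, p.1 j.succ)

/-- The instant at which step `j` is taken is marked: up to this instant (included), the
unordered edge passed at it has occurred an odd number of times. -/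
def IsMarked (p : ClosedPath N L) (j : Fin L) : Prop :=
  Odd (Finset.univ.filter fun k : Fin L => k ≤ j ∧ p.edge k = p.edge j).card

/-- The origin occurs at some marked instant. -/
def OriginMarked (p : ClosedPath N L) : Prop := ∃ j : Fin L, p.IsMarked j ∧ p.1 j.succ = p.1 0

/-- Some unordered edge is passed an odd number of times in total. -/
def HasOddEdge (p : ClosedPath N L) : Prop :=
  ∃ j : Fin L, Odd (Finset.univ.filter fun k : Fin L => p.edge k = p.edge j).card

/-- The term `M i_0 i_1 * M i_1 i_2 * ⋯ * M i_{L-1} i_0` of the expansion of `tr (M ^ L)`. -/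
def weight {𝕜 : Type*} [RCLike 𝕜] (M : Matrix (Fin N) (Fin N) 𝕜) (p : ClosedPath N L) : 𝕜 :=
  ∏ j : Fin L, M (p.1 j.castSucc) (p.1 j.succ)

end ClosedPath

open Classical in
/-- The contribution to `𝔼 tr (M ^ L)` of the closed paths with an unmarked origin and at least
one edge passed an odd number of times. -/
def unmarkedOriginContribution {𝕜 : Type*} [RCLike 𝕜] {Ω : Type*} [MeasurableSpace Ω]
    (P : Measure Ω) {N : ℕ} (M : Ω → Matrix (Fin N) (Fin N) 𝕜) (L : ℕ) : 𝕜 :=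
  ∑ p : ClosedPath N L with ¬ p.OriginMarked ∧ p.HasOddEdge, ∫ ω, p.weight (M ω) ∂P

/-- `ρ_θ = θ + σ ^ 2 / θ`. -/
def rho (θ σ : ℝ) : ℝ := θ + σ ^ 2 / θ

end

open MeasureTheory ProbabilityTheory Filter Topology Asymptotics

set_option linter.unusedSectionVars false

/-! Expand every entry of `deformed` into a random part and a deterministic part θ/N. A closed path
becomes a sum of decorated walks. Such a walk has a nonzero mean only if every edge is passed an
even number of times by random steps. A path with an odd edge therefore needs a deterministic step.
Rotate the walk to start at z, just after its last deterministic step: it first makes r random steps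
and then n = L - 1 - r arbitrary ones (`unmarkedSum_eq`). The N choices of z cancel the 1/N of the
removed step, which leaves a factor θ.

Typical walks have no defects: they open edges only towards new vertices and jump only from the base
of the exploration to new vertices. Their open edges form a stack (`Good.stackInv`). Up to a factor
1 - O(L²/N), their weight is that of a chain on the depth: up with weight 1, down with weight σ²,
staying at depth 0 with weight θ (`chainWeight_bounds`). A closed one, apart from those that jump
exactly once after the first r steps, has an unmarked origin and an odd edge exactly when its depth
after these r steps is positive (`Good.unmarked_iff`).

The chain is solvable. Conjugation by (σ²/θ)^d gives the growth rate ρ_θ and a positive recurrent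
birth and death chain with stationary mass 1 - σ²/θ² at 0. The first r steps have the smaller growth
rate 2σ, so their sum over r is a convergent resolvent, and the constant is σ²/θ²
(`tendsto_sum_chainWeight`).

Defects are controlled by giving each of them a penalty Γ ≥ 1. The penalized total is still at most
9 (2σ)^r ρ_θ^n, by a supersolution of the step recursion (`pot`, `sum_wA_add_sum_wW_mul_pot_le`), as
soon as L²/N is small depending on Γ. Walks with a defect thus carry at most a fraction of order
1/Γ, and Γ is arbitrary. In the potential, powers of q price open edges, and vertex factors price
the choice of the edge to close. The exponential absorbs the errors of relative size L/N per step.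
The power of τn prices pairs of odd vertices, which only later jumps can remove. The choice q = σ²/θ
makes both q + σ²/q and q + θ equal to ρ_θ.

Real and complex matrices enter only through `ArcWeights`: domination of all moments, and exact
variances on edges passed once in each direction. -/

/-! ### Exploration states of decorated walks -/

/-- The state of a decorated walk: the current position, how often each edge has been passed by
random steps, the visited vertices, and the number of openings onto visited vertices. -/
structure WalkState (V : Type*) where
  pos : V
  cnt : Sym2 V → ℕ
  vis : Finset V
  reo : ℕ

namespace WalkState

variable {V : Type*} [Fintype V] [DecidableEq V]

/-- The initial state of a walk started at `z`. -/
def init (z : V) : WalkState V := ⟨z, fun _ => 0, {z}, 0⟩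

/-- A random step to `z`. -/
def stepW (h : WalkState V) (z : V) : WalkState V where
  pos := z
  cnt := Function.update h.cnt s(h.pos, z) (h.cnt s(h.pos, z) + 1)
  vis := insert z h.vis
  reo := if z ∈ h.vis ∧ Even (h.cnt s(h.pos, z)) then h.reo + 1 else h.reo

/-- A deterministic step to `z`. -/
def stepA (h : WalkState V) (z : V) : WalkState V where
  pos := z
  cnt := h.cnt
  vis := insert z h.vis
  reo := h.reo

/-- The number of open edges, that is, of edges passed an odd number of times. -/
def opn (h : WalkState V) : ℕ := ∑ e, h.cnt e % 2

/-- The number of open edges at `v`, loops counted twice, plus one at the current position. -/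
def deg (h : WalkState V) (v : V) : ℕ :=
  (∑ w, h.cnt s(v, w) % 2) + h.cnt s(v, v) % 2 + if v = h.pos then 1 else 0

/-- The vertices of odd degree. -/
def oddV (h : WalkState V) : Finset V := Finset.univ.filter fun v => Odd (h.deg v)

/-- The separate term for the loop at `v` makes loops count twice, so an edge adds one for each of
its two ends even when they coincide. -/
lemma sum_ite_edge (v x z : V) :
    (∑ w, (if s(v, w) = s(x, z) then 1 else 0)) + (if s(v, v) = s(x, z) then 1 else 0)
      = (if v = x then 1 else 0) + (if v = z then 1 else 0 : ℕ) := by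
  have key : ∀ w, (if s(v, w) = s(x, z) then 1 else 0 : ℕ)
      + (if v = x ∧ v = z then (if w = v then 1 else 0) else 0)
      = (if v = x then (if w = z then 1 else 0) else 0)
        + (if v = z then (if w = x then 1 else 0) else 0) := by
    intro w
    simp only [Sym2.eq_iff]
    split_ifs <;> grind
  have := Finset.sum_congr (rfl : (Finset.univ : Finset V) = Finset.univ) fun w _ => key w
  rw [Finset.sum_add_distrib, Finset.sum_add_distrib] at this
  have h1 : ∀ (p : Prop) [Decidable p] (a : V),
      (∑ w, if p then (if w = a then 1 else 0) else 0 : ℕ) = if p then 1 else 0 := by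
    intro p _ a
    by_cases hp : p <;> simp [hp]
  rw [h1, h1, h1] at this
  have h2 : (if s(v, v) = s(x, z) then 1 else 0 : ℕ) = if v = x ∧ v = z then 1 else 0 := by
    simp only [Sym2.eq_iff]
    split_ifs <;> grind
  rw [h2]
  exact this

/-- An opening adds an edge end at both vertices while the extra one moves from the old position to
`z`, so the old position keeps its degree. For a closing the same bookkeeping leaves the target
unchanged. -/
lemma deg_stepW_of_even (h : WalkState V) {z : V} (he : Even (h.cnt s(h.pos, z))) (v : V) :
    (h.stepW z).deg v = h.deg v + if v = z then 2 else 0 := by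
  have key : ∀ e, (h.stepW z).cnt e % 2 = h.cnt e % 2 + if e = s(h.pos, z) then 1 else 0 := by
    intro e
    by_cases hee : e = s(h.pos, z)
    · subst hee
      simp only [stepW, Function.update_self, if_true]
      have := Nat.even_iff.1 he
      omega
    · simp [stepW, hee]
  have h2 := sum_ite_edge v h.pos z
  have h3 : (h.stepW z).pos = z := rfl
  simp only [deg, key, Finset.sum_add_distrib, h3]
  split_ifs at * <;> omega

lemma deg_stepW_of_odd (h : WalkState V) {z : V} (he : Odd (h.cnt s(h.pos, z))) (v : V) :
    (h.stepW z).deg v + (if v = h.pos then 2 else 0) = h.deg v := by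
  have key : ∀ e, h.cnt e % 2 = (h.stepW z).cnt e % 2 + if e = s(h.pos, z) then 1 else 0 := by
    intro e
    by_cases hee : e = s(h.pos, z)
    · subst hee
      simp only [stepW, Function.update_self, if_true]
      have := Nat.odd_iff.1 he
      omega
    · simp [stepW, hee]
  have h2 := sum_ite_edge v h.pos z
  have h3 : (h.stepW z).pos = z := rfl
  simp only [deg, key, Finset.sum_add_distrib, h3]
  split_ifs at * <;> omega

lemma deg_stepA (h : WalkState V) (z v : V) :
    (h.stepA z).deg v + (if v = h.pos then 1 else 0) = h.deg v + if v = z then 1 else 0 := by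
  have h3 : (h.stepA z).pos = z := rfl
  have h4 : (h.stepA z).cnt = h.cnt := rfl
  simp only [deg, h3, h4]
  omega

lemma opn_stepW_of_even (h : WalkState V) {z : V} (he : Even (h.cnt s(h.pos, z))) :
    (h.stepW z).opn = h.opn + 1 := by
  have key : ∀ e, (h.stepW z).cnt e % 2 = h.cnt e % 2 + if e = s(h.pos, z) then 1 else 0 := by
    intro e
    by_cases hee : e = s(h.pos, z)
    · subst hee
      simp only [stepW, Function.update_self, if_true]
      have := Nat.even_iff.1 he
      omega
    · simp [stepW, hee]
  simp [opn, key, Finset.sum_add_distrib]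

lemma opn_stepW_of_odd (h : WalkState V) {z : V} (he : Odd (h.cnt s(h.pos, z))) :
    (h.stepW z).opn + 1 = h.opn := by
  have key : ∀ e, h.cnt e % 2 = (h.stepW z).cnt e % 2 + if e = s(h.pos, z) then 1 else 0 := by
    intro e
    by_cases hee : e = s(h.pos, z)
    · subst hee
      simp only [stepW, Function.update_self, if_true]
      have := Nat.odd_iff.1 he
      omega
    · simp [stepW, hee]
  simp [opn, key, Finset.sum_add_distrib]

lemma deg_pos (h : WalkState V) : 1 ≤ h.deg h.pos := by simp [deg]

/-- This bounds the number of possible closings by the degree minus one. An open loop at the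
position counts once on the left and twice on the right. -/
lemma card_odd_add_one_le_deg (h : WalkState V) :
    (Finset.univ.filter fun z => Odd (h.cnt s(h.pos, z))).card + 1 ≤ h.deg h.pos := by
  have : (Finset.univ.filter fun z => Odd (h.cnt s(h.pos, z))).card
      = ∑ w, h.cnt s(h.pos, w) % 2 := by
    rw [Finset.card_filter]
    refine Finset.sum_congr rfl fun w _ => ?_
    rcases Nat.even_or_odd (h.cnt s(h.pos, w)) with h1 | h1
    · simp [Nat.not_odd_iff_even.2 h1, Nat.even_iff.1 h1]
    · simp [h1, Nat.odd_iff.1 h1]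
  simp only [deg, this, if_true]
  omega

/-- The invariants of a state reached after at most `t` steps. -/
structure Inv (h : WalkState V) (t : ℕ) : Prop where
  pos_mem : h.pos ∈ h.vis
  card_vis : h.vis.card ≤ t + 1
  opn_le : h.opn ≤ t
  mem_vis : ∀ e, h.cnt e ≠ 0 → ∀ v ∈ e, v ∈ h.vis
  cnt_le : ∀ e, h.cnt e ≤ 2 * h.reo + 2
  sum_deg : ∑ v, h.deg v = 2 * h.opn + 1

lemma inv_init (z : V) : (init z).Inv 0 where
  pos_mem := by simp [init]
  card_vis := by simp [init]
  opn_le := by simp [init, opn]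
  mem_vis := by simp [init]
  cnt_le := by simp [init]
  sum_deg := by
    have h1 : (init z).pos = z := rfl
    have h2 : ∀ e, (init z).cnt e = 0 := fun _ => rfl
    simp [opn, deg, h1, h2]

lemma Inv.stepW {h : WalkState V} {t : ℕ} (H : h.Inv t) (z : V) : (h.stepW z).Inv (t + 1) where
  pos_mem := by simp [WalkState.stepW]
  card_vis := (Finset.card_insert_le _ _).trans (by have := H.card_vis; omega)
  opn_le := by
    have := H.opn_le
    rcases Nat.even_or_odd (h.cnt s(h.pos, z)) with he | he
    · have := h.opn_stepW_of_even he; omega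
    · have := h.opn_stepW_of_odd he; omega
  mem_vis := by
    intro e he v hv
    by_cases hee : e = s(h.pos, z)
    · subst hee
      simp only [WalkState.stepW, Finset.mem_insert]
      rcases Sym2.mem_iff.1 hv with rfl | rfl
      · exact Or.inr H.pos_mem
      · exact Or.inl rfl
    · simp only [WalkState.stepW, Function.update_of_ne hee] at he
      exact Finset.mem_insert_of_mem (H.mem_vis e he v hv)
  -- Reopening an edge lands on a visited vertex, so it raises `reo` and the bound by two. A closing
  -- starts from an odd count, which lies strictly below the even bound.
  cnt_le := by
    intro e
    by_cases hee : e = s(h.pos, z)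
    · subst hee
      have h1 := H.cnt_le s(h.pos, z)
      simp only [WalkState.stepW, Function.update_self]
      by_cases hz : z ∈ h.vis
      · rcases Nat.even_or_odd (h.cnt s(h.pos, z)) with he | he
        · simp only [hz, he, and_self, if_true]; omega
        · simp only [Nat.not_even_iff_odd.2 he, and_false, if_false]
          obtain ⟨k, hk⟩ := he
          omega
      · have : h.cnt s(h.pos, z) = 0 := by
          by_contra h0
          exact hz (H.mem_vis _ h0 z (by simp))
        simp [this]
    · have h1 := H.cnt_le e
      simp only [WalkState.stepW, Function.update_of_ne hee]
      split_ifs <;> omega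
  sum_deg := by
    rcases Nat.even_or_odd (h.cnt s(h.pos, z)) with he | he
    · rw [h.opn_stepW_of_even he]
      simp only [h.deg_stepW_of_even he, Finset.sum_add_distrib, H.sum_deg]
      simp
      omega
    · have h1 := h.opn_stepW_of_odd he
      have h2 := Finset.sum_congr (rfl : (Finset.univ : Finset V) = Finset.univ)
        fun v _ => h.deg_stepW_of_odd he v
      rw [Finset.sum_add_distrib, H.sum_deg] at h2
      simp at h2
      omega

lemma Inv.stepA {h : WalkState V} {t : ℕ} (H : h.Inv t) (z : V) : (h.stepA z).Inv (t + 1) where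
  pos_mem := by simp [WalkState.stepA]
  card_vis := (Finset.card_insert_le _ _).trans (by have := H.card_vis; omega)
  opn_le := H.opn_le.trans (by omega)
  mem_vis := fun e he v hv => Finset.mem_insert_of_mem (H.mem_vis e he v hv)
  cnt_le := H.cnt_le
  sum_deg := by
    have h2 := Finset.sum_congr (rfl : (Finset.univ : Finset V) = Finset.univ)
      fun v _ => h.deg_stepA z v
    rw [Finset.sum_add_distrib, Finset.sum_add_distrib, H.sum_deg] at h2
    have h1 : (h.stepA z).opn = h.opn := rfl
    simp at h2
    omega

lemma Inv.odd_card_oddV {h : WalkState V} {t : ℕ} (H : h.Inv t) : Odd h.oddV.card := by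
  rw [oddV, ← Finset.odd_sum_iff_odd_card_odd, H.sum_deg]
  exact odd_two_mul_add_one _

lemma Inv.deg_eq_zero {h : WalkState V} {t : ℕ} (H : h.Inv t) {z : V} (hz : z ∉ h.vis) :
    h.deg z = 0 := by
  have h0 : ∀ w, h.cnt s(z, w) = 0 := fun w => by
    by_contra h0
    exact hz (H.mem_vis _ h0 z (by simp))
  have h1 : z ≠ h.pos := fun h1 => hz (h1 ▸ H.pos_mem)
  simp [deg, h0, h1]

lemma Inv.cnt_eq_zero {h : WalkState V} {t : ℕ} (H : h.Inv t) {z : V} (hz : z ∉ h.vis) :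
    h.cnt s(h.pos, z) = 0 := by
  by_contra h0
  exact hz (H.mem_vis _ h0 z (by simp))

/-- Random steps change degrees by two, so only deterministic steps create or remove odd vertices.
-/
lemma oddV_stepW (h : WalkState V) (z : V) : (h.stepW z).oddV = h.oddV := by
  ext v
  simp only [oddV, Finset.mem_filter, Finset.mem_univ, true_and]
  rcases Nat.even_or_odd (h.cnt s(h.pos, z)) with he | he
  · rw [h.deg_stepW_of_even he]
    split_ifs <;> simp [parity_simps]
  · rw [← h.deg_stepW_of_odd he]
    split_ifs <;> simp [parity_simps]

end WalkState

/-! ### The vertex factor of the potential -/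

/-- The weight `(2⌈k/2⌉ - 1)!!`. -/
def vertexFactor : ℕ → ℝ
  | 0 => 1
  | n + 1 => if Even n then (n + 1) * vertexFactor n else vertexFactor n

lemma vertexFactor_succ_of_even {n : ℕ} (h : Even n) :
    vertexFactor (n + 1) = (n + 1) * vertexFactor n := by simp [vertexFactor, h]

lemma vertexFactor_succ_of_odd {n : ℕ} (h : Odd n) : vertexFactor (n + 1) = vertexFactor n := by
  simp [vertexFactor, Nat.not_even_iff_odd.2 h]

lemma vertexFactor_add_two_of_even {n : ℕ} (h : Even n) :
    vertexFactor (n + 2) = (n + 1) * vertexFactor n := by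
  rw [vertexFactor_succ_of_odd h.add_one, vertexFactor_succ_of_even h]

lemma vertexFactor_add_two_of_odd {n : ℕ} (h : Odd n) :
    vertexFactor (n + 2) = (n + 2) * vertexFactor n := by
  rw [vertexFactor_succ_of_even h.add_one, vertexFactor_succ_of_odd h]
  push_cast
  ring

lemma vertexFactor_pos : ∀ n, 0 < vertexFactor n
  | 0 => by simp [vertexFactor]
  | n + 1 => by
    have := vertexFactor_pos n
    rw [vertexFactor]
    split_ifs <;> positivity

lemma one_le_vertexFactor : ∀ n, 1 ≤ vertexFactor n
  | 0 => by simp [vertexFactor]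
  | n + 1 => by
    have := one_le_vertexFactor n
    rw [vertexFactor]
    split_ifs
    · have : (0 : ℝ) ≤ n := by positivity
      nlinarith
    · exact this

lemma vertexFactor_add_two_le (n : ℕ) : vertexFactor (n + 2) ≤ (n + 2) * vertexFactor n := by
  have := vertexFactor_pos n
  rcases Nat.even_or_odd n with h | h
  · rw [vertexFactor_add_two_of_even h]; nlinarith
  · rw [vertexFactor_add_two_of_odd h]

namespace WalkState

variable {V : Type*} [Fintype V] [DecidableEq V]

/-! ### Step weights -/

/-- The factor of an opening of the edge `e` already passed `k` times. -/
noncomputable def edgeFactor (K : ℝ) (e : Sym2 V) (k : ℕ) : ℝ :=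
  if e.IsDiag ∨ k ≠ 0 then K * (k + 2) else 1

/-- The weight of a random step to `z`, with penalty `Γ` for openings onto visited vertices. -/
noncomputable def wW (σ K Γ : ℝ) (h : WalkState V) (z : V) : ℝ :=
  if Odd (h.cnt s(h.pos, z)) then σ ^ 2
  else edgeFactor K s(h.pos, z) (h.cnt s(h.pos, z)) / Fintype.card V *
    if z ∈ h.vis then Γ else 1

/-- The weight of a deterministic step to `z`, with penalty `Γ` for steps that land on a visited
vertex or leave a vertex of even degree. -/
noncomputable def wA (θ Γ : ℝ) (h : WalkState V) (z : V) : ℝ :=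
  θ / Fintype.card V * if z ∈ h.vis ∨ Even (h.deg h.pos) then Γ else 1

/-! ### The potential -/

/-- The product of the vertex factors. -/
noncomputable def vprod (h : WalkState V) : ℝ := ∏ v, vertexFactor (h.deg v)

/-- The potential of a state with `n` steps to go. -/
noncomputable def pot (q η τ : ℝ) (n : ℕ) (h : WalkState V) : ℝ :=
  q ^ h.opn * Real.exp (η * n * (h.reo + 2)) * h.vprod * (τ * n) ^ (h.oddV.card / 2)

lemma vprod_pos (h : WalkState V) : 0 < h.vprod := Finset.prod_pos fun _ _ => vertexFactor_pos _

lemma one_le_vprod (h : WalkState V) : 1 ≤ h.vprod := by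
  unfold vprod
  have : ∏ _v : V, (1 : ℝ) ≤ ∏ v, vertexFactor (h.deg v) :=
    Finset.prod_le_prod (fun _ _ => zero_le_one) fun _ _ => one_le_vertexFactor _
  simpa using this

lemma pot_nonneg {q η τ : ℝ} (hq : 0 ≤ q) (hτ : 0 ≤ τ) (n : ℕ) (h : WalkState V) :
    0 ≤ pot q η τ n h := by
  have := h.vprod_pos
  unfold pot
  positivity

lemma vprod_eq_of_eq_off {h h' : WalkState V} {a : V} (H : ∀ v, v ≠ a → h'.deg v = h.deg v) :
    h'.vprod * vertexFactor (h.deg a) = h.vprod * vertexFactor (h'.deg a) := by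
  unfold vprod
  rw [← Finset.mul_prod_erase _ _ (Finset.mem_univ a),
    ← Finset.mul_prod_erase (Finset.univ : Finset V) (fun v => vertexFactor (h.deg v))
      (Finset.mem_univ a)]
  rw [Finset.prod_congr rfl fun v hv => by rw [H v (Finset.ne_of_mem_erase hv)]]
  ring

lemma vprod_stepW_of_odd (h : WalkState V) {z : V} (he : Odd (h.cnt s(h.pos, z))) :
    (h.stepW z).vprod * vertexFactor (h.deg h.pos)
      = h.vprod * vertexFactor (h.deg h.pos - 2) := by
  have h1 : (h.stepW z).deg h.pos = h.deg h.pos - 2 := by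
    have := h.deg_stepW_of_odd he h.pos
    simp only [if_true] at this
    omega
  rw [← h1]
  refine vprod_eq_of_eq_off fun v hv => ?_
  have := h.deg_stepW_of_odd he v
  simpa [hv] using this

lemma vprod_stepW_of_even (h : WalkState V) {z : V} (he : Even (h.cnt s(h.pos, z))) :
    (h.stepW z).vprod * vertexFactor (h.deg z) = h.vprod * vertexFactor (h.deg z + 2) := by
  have h1 : (h.stepW z).deg z = h.deg z + 2 := by
    have := h.deg_stepW_of_even he z
    simpa using this
  rw [← h1]
  refine vprod_eq_of_eq_off fun v hv => ?_
  have := h.deg_stepW_of_even he v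
  simpa [hv] using this

lemma deg_stepA_self (h : WalkState V) (v : V) : (h.stepA h.pos).deg v = h.deg v := by
  have := h.deg_stepA h.pos v
  omega

lemma deg_stepA_pos (h : WalkState V) {z : V} (hz : z ≠ h.pos) :
    (h.stepA z).deg h.pos = h.deg h.pos - 1 := by
  have := h.deg_stepA z h.pos
  simp only [if_true, hz.symm, if_false] at this
  omega

lemma deg_stepA_target (h : WalkState V) {z : V} (hz : z ≠ h.pos) :
    (h.stepA z).deg z = h.deg z + 1 := by
  have := h.deg_stepA z z
  simp only [if_true, hz, if_false] at this
  omega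

lemma deg_stepA_other (h : WalkState V) {z v : V} (hv : v ≠ h.pos) (hz : v ≠ z) :
    (h.stepA z).deg v = h.deg v := by
  have := h.deg_stepA z v
  simpa [hv, hz] using this

lemma vprod_stepA_self (h : WalkState V) : (h.stepA h.pos).vprod = h.vprod := by
  simp [vprod, deg_stepA_self]

lemma vprod_stepA (h : WalkState V) {z : V} (hz : z ≠ h.pos) :
    (h.stepA z).vprod * (vertexFactor (h.deg h.pos) * vertexFactor (h.deg z))
      = h.vprod * (vertexFactor (h.deg h.pos - 1) * vertexFactor (h.deg z + 1)) := by
  unfold vprod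
  have key : ∀ f : V → ℝ, ∏ v, f v = f h.pos * (f z * ∏ v ∈ (Finset.univ.erase h.pos).erase z, f v) := by
    intro f
    rw [Finset.mul_prod_erase _ _ (Finset.mem_erase.2 ⟨hz, Finset.mem_univ _⟩),
      Finset.mul_prod_erase _ _ (Finset.mem_univ _)]
  rw [key, key fun v => vertexFactor (h.deg v), deg_stepA_pos h hz, deg_stepA_target h hz]
  rw [Finset.prod_congr rfl fun v hv => by
    rw [deg_stepA_other h (Finset.ne_of_mem_erase (Finset.mem_of_mem_erase hv))
      (Finset.ne_of_mem_erase hv)]]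
  ring

lemma mem_oddV {h : WalkState V} {v : V} : v ∈ h.oddV ↔ Odd (h.deg v) := by simp [oddV]

lemma oddV_stepA_self (h : WalkState V) : (h.stepA h.pos).oddV = h.oddV := by
  ext v; simp [mem_oddV, deg_stepA_self]

lemma mem_oddV_stepA (h : WalkState V) {z : V} (hz : z ≠ h.pos) (v : V) :
    v ∈ (h.stepA z).oddV ↔ if v = h.pos ∨ v = z then v ∉ h.oddV else v ∈ h.oddV := by
  rw [mem_oddV, mem_oddV]
  by_cases h1 : v = h.pos
  · subst h1
    rw [deg_stepA_pos h hz]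
    have := h.deg_pos
    simp only [true_or, if_true]
    rw [Nat.odd_sub this]
    simp [Nat.not_odd_iff_even]
  · by_cases h2 : v = z
    · subst h2
      rw [deg_stepA_target h hz]
      simp [Nat.odd_add_one]
    · rw [deg_stepA_other h h1 h2]
      simp [h1, h2]

lemma card_oddV_stepA_odd_even (h : WalkState V) {z : V} (hz : z ≠ h.pos) (hx : h.pos ∈ h.oddV)
    (hzU : z ∉ h.oddV) : (h.stepA z).oddV.card = h.oddV.card := by
  have : (h.stepA z).oddV = insert z (h.oddV.erase h.pos) := by
    ext v
    rw [mem_oddV_stepA h hz]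
    simp only [Finset.mem_insert, Finset.mem_erase]
    split_ifs <;> grind
  rw [this, Finset.card_insert_of_notMem (by simp [hzU]), Finset.card_erase_add_one hx]

lemma card_oddV_stepA_odd_odd (h : WalkState V) {z : V} (hz : z ≠ h.pos) (hx : h.pos ∈ h.oddV)
    (hzU : z ∈ h.oddV) : (h.stepA z).oddV.card + 2 = h.oddV.card := by
  have : (h.stepA z).oddV = (h.oddV.erase h.pos).erase z := by
    ext v
    rw [mem_oddV_stepA h hz]
    simp only [Finset.mem_erase]
    split_ifs <;> grind
  rw [this]
  have h1 := Finset.card_erase_add_one hx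
  have h2 := Finset.card_erase_add_one (Finset.mem_erase.2 ⟨hz, hzU⟩)
  omega

lemma card_oddV_stepA_even_even (h : WalkState V) {z : V} (hz : z ≠ h.pos) (hx : h.pos ∉ h.oddV)
    (hzU : z ∉ h.oddV) : (h.stepA z).oddV.card = h.oddV.card + 2 := by
  have : (h.stepA z).oddV = insert z (insert h.pos h.oddV) := by
    ext v
    rw [mem_oddV_stepA h hz]
    simp only [Finset.mem_insert]
    split_ifs <;> grind
  rw [this, Finset.card_insert_of_notMem (by simp [hzU, hz]), Finset.card_insert_of_notMem hx]

lemma card_oddV_stepA_even_odd (h : WalkState V) {z : V} (hz : z ≠ h.pos) (hx : h.pos ∉ h.oddV)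
    (hzU : z ∈ h.oddV) : (h.stepA z).oddV.card = h.oddV.card := by
  have : (h.stepA z).oddV = (insert h.pos h.oddV).erase z := by
    ext v
    rw [mem_oddV_stepA h hz]
    simp only [Finset.mem_insert, Finset.mem_erase]
    split_ifs <;> grind
  rw [this, Finset.card_erase_of_mem (by simp [hzU]), Finset.card_insert_of_notMem hx]
  rfl

/-! ### Random steps -/

section Random

variable {σ K Γ q η τ : ℝ} {n t : ℕ} {h : WalkState V}

/-- A closing removes one power of `q` and changes only the vertex factor at the vertex that is
left. -/
lemma wW_mul_pot_of_odd (hq : 0 < q) {z : V} (he : Odd (h.cnt s(h.pos, z))) :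
    wW σ K Γ h z * pot q η τ n (h.stepW z)
      = σ ^ 2 / q * (vertexFactor (h.deg h.pos - 2) / vertexFactor (h.deg h.pos)) *
        pot q η τ n h := by
  have h1 : (h.stepW z).reo = h.reo := by
    simp [stepW, Nat.not_even_iff_odd.2 he]
  have h2 := h.vprod_stepW_of_odd he
  have h3 := vertexFactor_pos (h.deg h.pos)
  have h4 : (h.stepW z).vprod
      = h.vprod * vertexFactor (h.deg h.pos - 2) / vertexFactor (h.deg h.pos) := by
    rw [eq_div_iff h3.ne', h2]
  have h5 := h.opn_stepW_of_odd he
  rw [wW, if_pos he, pot, pot, h1, h4, oddV_stepW, ← h5, pow_succ]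
  field_simp
  ring

/-- The degree of a new vertex goes from 0 to 2, and both values have vertex factor 1. Only the new
open edge is paid for. -/
lemma wW_mul_pot_of_new (H : h.Inv t) {z : V} (hz : z ∉ h.vis) :
    wW σ K Γ h z * pot q η τ n (h.stepW z) = q / Fintype.card V * pot q η τ n h := by
  have h0 := H.cnt_eq_zero hz
  have he : Even (h.cnt s(h.pos, z)) := by simp [h0]
  have h1 : (h.stepW z).reo = h.reo := by simp [stepW, hz]
  have h2 := h.vprod_stepW_of_even he
  rw [H.deg_eq_zero hz] at h2
  have h3 : (h.stepW z).vprod = h.vprod := by simpa [vertexFactor] using h2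
  have h4 : h.pos ≠ z := fun h4 => hz (h4 ▸ H.pos_mem)
  rw [wW, if_neg (Nat.not_odd_iff_even.2 he), if_neg hz, pot, pot, h1, h3, oddV_stepW,
    h.opn_stepW_of_even he, pow_succ, edgeFactor, if_neg (by simp [h0, h4])]
  ring

/-- The 6 is a factor 2 from the bound on the passages of the edge times a factor 3 from the growth
of the exponential when `reo` rises by one. -/
lemma wW_mul_pot_of_old (H : h.Inv t) (hq : 0 < q) (hτ : 0 ≤ τ) (hK : 1 ≤ K) (hΓ : 1 ≤ Γ)
    (hη : Real.exp (η * n) ≤ 3) {z : V} (hz : z ∈ h.vis) (he : Even (h.cnt s(h.pos, z))) :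
    wW σ K Γ h z * pot q η τ n (h.stepW z)
      ≤ 6 * Γ * K * (h.reo + 2) * q / Fintype.card V * (h.deg z + 2) * pot q η τ n h := by
  have h1 : (h.stepW z).reo = h.reo + 1 := by simp [stepW, hz, he]
  have h3 := vertexFactor_pos (h.deg z)
  have h4 : (h.stepW z).vprod ≤ (h.deg z + 2) * h.vprod := by
    have h2 := h.vprod_stepW_of_even he
    have h5 := vertexFactor_add_two_le (h.deg z)
    have h6 := h.vprod_pos
    refine le_of_mul_le_mul_right ?_ h3
    rw [h2]
    nlinarith
  have h5 : edgeFactor K s(h.pos, z) (h.cnt s(h.pos, z)) ≤ K * (2 * (h.reo + 2)) := by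
    have h6 : (h.cnt s(h.pos, z) : ℝ) ≤ 2 * h.reo + 2 := by exact_mod_cast H.cnt_le s(h.pos, z)
    have h7 : (0 : ℝ) ≤ h.reo := by positivity
    unfold edgeFactor
    split_ifs
    · nlinarith
    · nlinarith
  have h6 : 0 ≤ edgeFactor K s(h.pos, z) (h.cnt s(h.pos, z)) := by
    unfold edgeFactor
    split_ifs <;> positivity
  have h7 := h.vprod_pos
  have h8 := (h.stepW z).vprod_pos
  rw [wW, if_neg (Nat.not_odd_iff_even.2 he), if_pos hz, pot, pot, h1, oddV_stepW,
    h.opn_stepW_of_even he, pow_succ]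
  have h9 : Real.exp (η * n * ((h.reo + 1 : ℕ) + 2))
      = Real.exp (η * n * (h.reo + 2)) * Real.exp (η * n) := by
    rw [← Real.exp_add]; push_cast; ring_nf
  rw [h9]
  have hE := Real.exp_pos (η * n * (h.reo + 2))
  set E := Real.exp (η * n * (h.reo + 2))
  set f := (τ * n) ^ (h.oddV.card / 2)
  have hf : 0 ≤ f := by positivity
  calc _ ≤ K * (2 * (h.reo + 2)) / Fintype.card V * Γ *
        (q ^ h.opn * q * (E * 3) * ((h.deg z + 2) * h.vprod) * f) := by
        gcongr
    _ = _ := by ring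

/-- The fraction of the closings in the potential balance. -/
noncomputable def closeFrac (k : ℕ) : ℝ :=
  (k - 1) * (vertexFactor (k - 2) / vertexFactor k)

/-- The vertex factors are double factorials for this reason: their ratio 1/(k - 1) exactly offsets
the k - 1 edges that may be closed. -/
lemma closeFrac_of_even {k : ℕ} (hk : Even k) (h2 : 2 ≤ k) : closeFrac k = 1 := by
  obtain ⟨m, rfl⟩ := Nat.exists_eq_add_of_le' h2
  have hm : Even m := by simpa [parity_simps] using hk
  have := vertexFactor_pos m
  rw [closeFrac, vertexFactor_add_two_of_even hm, Nat.add_sub_cancel]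
  have : (0 : ℝ) ≤ m := by positivity
  push_cast
  field_simp
  ring

/-- At odd degree the closings use the share (k - 1)/k. The remaining 1/k is reserved for
deterministic steps, which turn the vertex even. -/
lemma closeFrac_of_odd {k : ℕ} (hk : Odd k) : closeFrac k = (k - 1) / k := by
  rcases Nat.lt_or_ge k 2 with h2 | h2
  · have : k = 1 := by obtain ⟨m, hm⟩ := hk; omega
    subst this
    simp [closeFrac]
  obtain ⟨m, rfl⟩ := Nat.exists_eq_add_of_le' h2
  have hm : Odd m := by simpa [parity_simps] using hk
  have := vertexFactor_pos m
  rw [closeFrac, vertexFactor_add_two_of_odd hm, Nat.add_sub_cancel]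
  have : (0 : ℝ) ≤ m := by positivity
  push_cast
  field_simp

lemma sum_deg_add_two_le (H : h.Inv t) :
    ∑ z ∈ h.vis, ((h.deg z : ℝ) + 2) ≤ 4 * t + 3 := by
  rw [Finset.sum_add_distrib]
  have h1 : ∑ z ∈ h.vis, (h.deg z : ℝ) ≤ 2 * t + 1 := by
    have : ∑ z ∈ h.vis, h.deg z ≤ 2 * t + 1 :=
      (Finset.sum_le_univ_sum_of_nonneg fun _ => Nat.zero_le _).trans
        (by rw [H.sum_deg]; have := H.opn_le; omega)
    exact_mod_cast this
  have h2 : (h.vis.card : ℝ) ≤ t + 1 := by exact_mod_cast H.card_vis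
  simp only [Finset.sum_const, nsmul_eq_mul]
  linarith

/-- Every target is a closing, a new vertex or a reopening. Granting the term of a new vertex to all
targets gives exactly q. The reopenings are summed over the visited vertices, whose total degree is
O(t). -/
lemma sum_wW_mul_pot_le (H : h.Inv t) (hq : 0 < q) (hτ : 0 ≤ τ) (hK : 1 ≤ K) (hΓ : 1 ≤ Γ)
    (hη : Real.exp (η * n) ≤ 3) :
    ∑ z, wW σ K Γ h z * pot q η τ n (h.stepW z)
      ≤ (q + closeFrac (h.deg h.pos) * (σ ^ 2 / q)
        + 6 * Γ * K * (h.reo + 2) * q / Fintype.card V * (4 * t + 3)) * pot q η τ n h := by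
  have hX := pot_nonneg (η := η) hq.le hτ n h
  set X := pot q η τ n h with hXdef
  set c := σ ^ 2 / q * (vertexFactor (h.deg h.pos - 2) / vertexFactor (h.deg h.pos)) * X with hc
  have hg2 := vertexFactor_pos (h.deg h.pos - 2)
  have hg := vertexFactor_pos (h.deg h.pos)
  have hc0 : 0 ≤ c := by positivity
  set c' := 6 * Γ * K * (h.reo + 2) * q / Fintype.card V * X with hc'
  have hc'0 : 0 ≤ c' := by positivity
  have hN : (0 : ℝ) < Fintype.card V := by
    have : 0 < Fintype.card V := Fintype.card_pos_iff.2 ⟨h.pos⟩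
    exact_mod_cast this
  have hterm : ∀ z, wW σ K Γ h z * pot q η τ n (h.stepW z)
      ≤ (if Odd (h.cnt s(h.pos, z)) then c else 0) + q / Fintype.card V * X
        + (if z ∈ h.vis then c' * (h.deg z + 2) else 0) := by
    intro z
    have h1 : 0 ≤ q / Fintype.card V * X := by positivity
    have h2 : 0 ≤ if z ∈ h.vis then c' * (h.deg z + 2) else 0 := by split_ifs <;> positivity
    rcases Nat.even_or_odd (h.cnt s(h.pos, z)) with he | he
    · rw [if_neg (Nat.not_odd_iff_even.2 he)]
      by_cases hz : z ∈ h.vis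
      · have := wW_mul_pot_of_old (σ := σ) H hq hτ hK hΓ hη hz he
        rw [if_pos hz]
        have h3 : c' * (h.deg z + 2)
          = 6 * Γ * K * (h.reo + 2) * q / Fintype.card V * (h.deg z + 2) * X := by
          rw [hc']; ring
        linarith
      · rw [wW_mul_pot_of_new H hz]
        linarith
    · rw [wW_mul_pot_of_odd hq he, if_pos he]
      linarith
  refine (Finset.sum_le_sum fun z _ => hterm z).trans ?_
  rw [Finset.sum_add_distrib, Finset.sum_add_distrib, Finset.sum_ite, Finset.sum_const_zero,
    add_zero, Finset.sum_const, Finset.sum_const, ← Finset.sum_filter, Finset.filter_mem_eq_inter,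
    Finset.univ_inter, ← Finset.mul_sum, Finset.card_univ, nsmul_eq_mul, nsmul_eq_mul]
  have h1 : ((Finset.univ.filter fun z => Odd (h.cnt s(h.pos, z))).card : ℝ) * c
      ≤ (h.deg h.pos - 1) * c := by
    have : ((Finset.univ.filter fun z => Odd (h.cnt s(h.pos, z))).card : ℝ) + 1 ≤ h.deg h.pos := by
      exact_mod_cast h.card_odd_add_one_le_deg
    gcongr
    linarith
  have h2 : c' * ∑ z ∈ h.vis, ((h.deg z : ℝ) + 2) ≤ c' * (4 * t + 3) := by
    gcongr
    exact sum_deg_add_two_le H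
  have h3 : (Fintype.card V : ℝ) * (q / Fintype.card V * X) = q * X := by field_simp
  rw [h3]
  refine (add_le_add (add_le_add_left h1 _) h2).trans (le_of_eq ?_)
  rw [hc, hc', closeFrac]
  ring

end Random

end WalkState

namespace WalkState

variable {V : Type*} [Fintype V] [DecidableEq V]

/-! ### ### Deterministic steps -/

section Deterministic

variable {θ Γ q η τ : ℝ} {n t : ℕ} {h : WalkState V}

lemma Inv.mem_vis_of_deg (H : h.Inv t) {z : V} (hz : h.deg z ≠ 0) : z ∈ h.vis := by
  by_contra h0
  exact hz (H.deg_eq_zero h0)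

lemma sum_deg_add_one_le (H : h.Inv t) :
    ∑ z ∈ h.vis, ((h.deg z : ℝ) + 1) ≤ 4 * t + 3 := by
  refine le_trans (Finset.sum_le_sum fun z _ => ?_) (sum_deg_add_two_le H)
  linarith

lemma sum_univ_deg_add_one_le (H : h.Inv t) :
    ∑ z, ((h.deg z : ℝ) + 1) ≤ 2 * t + 1 + Fintype.card V := by
  rw [Finset.sum_add_distrib]
  have : ∑ z, (h.deg z : ℝ) ≤ 2 * t + 1 := by
    have : ∑ z, h.deg z ≤ 2 * t + 1 := by rw [H.sum_deg]; have := H.opn_le; omega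
    exact_mod_cast this
  simp
  linarith

lemma wA_le (hθ : 0 ≤ θ) (hΓ : 1 ≤ Γ) (z : V) : wA θ Γ h z ≤ θ * Γ / Fintype.card V := by
  unfold wA
  rw [mul_comm θ Γ, mul_div_assoc, mul_comm Γ]
  gcongr
  split_ifs <;> linarith

lemma wA_nonneg (hθ : 0 ≤ θ) (hΓ : 0 ≤ Γ) (z : V) : 0 ≤ wA θ Γ h z := by
  unfold wA
  split_ifs <;> positivity

/-- Leaving an odd vertex gains the inverse of its degree. New targets then give the main term, and
visited even targets, as well as the position itself, an error. The other odd vertices, an even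
number because the total is odd, reduce the number of pairs by one. This last term is not small
against the potential with the same n. It is paid for by the increment of (τn)^k in n. -/
lemma sum_wA_mul_pot_le_of_odd (H : h.Inv t) (hθ : 0 ≤ θ) (hq : 0 < q) (hτ : 0 ≤ τ) (hΓ : 1 ≤ Γ)
    (hx : Odd (h.deg h.pos)) :
    ∑ z, wA θ Γ h z * pot q η τ n (h.stepA z)
      ≤ θ * (1 / h.deg h.pos + Γ / Fintype.card V * (4 * t + 3)) * pot q η τ n h
        + θ * Γ / Fintype.card V * (2 * (h.oddV.card / 2 : ℕ)) *
          (q ^ h.opn * Real.exp (η * n * (h.reo + 2)) * h.vprod *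
            (τ * n) ^ (h.oddV.card / 2 - 1)) := by
  have hX := pot_nonneg (η := η) hq.le hτ n h
  set X := pot q η τ n h with hXdef
  have hP := h.vprod_pos
  set Y := q ^ h.opn * Real.exp (η * n * (h.reo + 2)) * h.vprod *
            (τ * n) ^ (h.oddV.card / 2 - 1) with hY
  have hY0 : 0 ≤ Y := by positivity
  have hN : (0 : ℝ) < Fintype.card V := by
    have : 0 < Fintype.card V := Fintype.card_pos_iff.2 ⟨h.pos⟩
    exact_mod_cast this
  have hM : (1 : ℝ) ≤ h.deg h.pos := by exact_mod_cast h.deg_pos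
  have hxU : h.pos ∈ h.oddV := mem_oddV.2 hx
  have hpot : ∀ z, pot q η τ n (h.stepA z) = q ^ h.opn * Real.exp (η * n * (h.reo + 2)) *
      (h.stepA z).vprod * (τ * n) ^ ((h.stepA z).oddV.card / 2) := fun z => rfl
  have hM' : vertexFactor (h.deg h.pos) = h.deg h.pos * vertexFactor (h.deg h.pos - 1) := by
    obtain ⟨m, hm⟩ := hx
    rw [hm, Nat.add_sub_cancel, vertexFactor_succ_of_even (even_two_mul m)]
    push_cast
    ring
  have hgM := vertexFactor_pos (h.deg h.pos - 1)
  have hvp : ∀ z, z ≠ h.pos → (h.stepA z).vprod * (h.deg h.pos * vertexFactor (h.deg z))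
      = h.vprod * vertexFactor (h.deg z + 1) := by
    intro z hz
    have := vprod_stepA h hz
    rw [hM'] at this
    have h2 : vertexFactor (h.deg h.pos - 1) ≠ 0 := hgM.ne'
    apply mul_right_cancel₀ h2
    linear_combination this
  have hterm : ∀ z, wA θ Γ h z * pot q η τ n (h.stepA z)
      ≤ θ / Fintype.card V * (X / h.deg h.pos)
        + (if z ∈ h.vis then θ * Γ / Fintype.card V * X * (h.deg z + 1) else 0)
        + (if z ∈ h.oddV.erase h.pos then θ * Γ / Fintype.card V * Y else 0) := by
    intro z
    have h1 : 0 ≤ θ / Fintype.card V * (X / h.deg h.pos) := by positivity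
    have h2 : 0 ≤ if z ∈ h.vis then θ * Γ / Fintype.card V * X * (h.deg z + 1) else 0 := by
      split_ifs <;> positivity
    have h3 : 0 ≤ if z ∈ h.oddV.erase h.pos then θ * Γ / Fintype.card V * Y else 0 := by
      split_ifs <;> positivity
    have hw := wA_le (h := h) hθ hΓ z
    by_cases hz : z = h.pos
    · subst hz
      rw [if_pos H.pos_mem] at h2 ⊢
      have h4 : pot q η τ n (h.stepA h.pos) = X := by
        rw [hpot, vprod_stepA_self, oddV_stepA_self]; rfl
      rw [h4]
      have h5 : wA θ Γ h h.pos * X ≤ θ * Γ / Fintype.card V * X * (h.deg h.pos + 1) := by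
        have h6 : 0 ≤ θ * Γ / Fintype.card V * X := by positivity
        nlinarith
      linarith
    · have hv := hvp z hz
      have hgz := vertexFactor_pos (h.deg z)
      have hvz := (h.stepA z).vprod_pos
      by_cases hzU : z ∈ h.oddV
      · rw [if_pos (Finset.mem_erase.2 ⟨hz, hzU⟩)] at h3 ⊢
        have hc := card_oddV_stepA_odd_odd h hz hxU hzU
        have h4 : (h.stepA z).oddV.card / 2 = h.oddV.card / 2 - 1 := by omega
        rw [vertexFactor_succ_of_odd (mem_oddV.1 hzU), ← mul_assoc] at hv
        have h5 : (h.stepA z).vprod ≤ h.vprod := by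
          have := mul_right_cancel₀ hgz.ne' hv
          nlinarith
        have h6 : wA θ Γ h z * pot q η τ n (h.stepA z) ≤ θ * Γ / Fintype.card V * Y := by
          rw [hpot, h4, hY]
          gcongr
        linarith
      · have hc := card_oddV_stepA_odd_even h hz hxU hzU
        have hze : Even (h.deg z) := Nat.not_odd_iff_even.1 fun h0 => hzU (mem_oddV.2 h0)
        rw [vertexFactor_succ_of_even hze] at hv
        have hv' : (h.stepA z).vprod * h.deg h.pos = h.vprod * (h.deg z + 1) := by
          apply mul_right_cancel₀ hgz.ne'
          linear_combination hv
        have h5 : pot q η τ n (h.stepA z) = X / h.deg h.pos * (h.deg z + 1) := by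
          rw [hpot, hc, hXdef, pot, div_mul_eq_mul_div, eq_div_iff (by positivity)]
          linear_combination q ^ h.opn * Real.exp (η * n * (h.reo + 2)) *
            (τ * n) ^ (h.oddV.card / 2) * hv'
        by_cases hzv : z ∈ h.vis
        · rw [if_pos hzv] at h2 ⊢
          have h6 : pot q η τ n (h.stepA z) ≤ X * (h.deg z + 1) := by
            rw [h5]
            gcongr
            exact div_le_self hX hM
          have h7 : wA θ Γ h z * pot q η τ n (h.stepA z)
              ≤ θ * Γ / Fintype.card V * (X * (h.deg z + 1)) := by
            have h8 := pot_nonneg (η := η) hq.le hτ n (h.stepA z)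
            gcongr
          linarith
        · have h6 : wA θ Γ h z = θ / Fintype.card V := by
            simp [wA, hzv, hx]
          have h7 : X / h.deg h.pos * ((h.deg z : ℝ) + 1) = X / h.deg h.pos := by
            rw [H.deg_eq_zero hzv]; simp
          rw [h6, h5, h7]
          linarith
  refine (Finset.sum_le_sum fun z _ => hterm z).trans ?_
  rw [Finset.sum_add_distrib, Finset.sum_add_distrib, Finset.sum_const,
    ← Finset.sum_filter, Finset.filter_mem_eq_inter,
    Finset.univ_inter, ← Finset.mul_sum, ← Finset.sum_filter, Finset.filter_mem_eq_inter,
    Finset.univ_inter, Finset.sum_const, Finset.card_univ, nsmul_eq_mul, nsmul_eq_mul,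
    Finset.card_erase_of_mem hxU]
  have hodd := H.odd_card_oddV
  have h1 : h.oddV.card - 1 = 2 * (h.oddV.card / 2) := by obtain ⟨m, hm⟩ := hodd; omega
  have h2 : θ * Γ / Fintype.card V * X * ∑ z ∈ h.vis, ((h.deg z : ℝ) + 1)
      ≤ θ * Γ / Fintype.card V * X * (4 * t + 3) := by
    gcongr
    exact sum_deg_add_one_le H
  have h3 : (Fintype.card V : ℝ) * (θ / Fintype.card V * (X / h.deg h.pos))
      = θ * (1 / h.deg h.pos) * X := by field_simp
  rw [h3, h1]
  push_cast
  refine (add_le_add_left (add_le_add_right h2 _) _).trans (le_of_eq ?_)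
  ring

/-- There is no gain from leaving an even vertex, but an even target other than the position creates
a new pair of odd vertices and so a small factor τn. All remaining targets are visited, hence few.
-/
lemma sum_wA_mul_pot_le_of_even (H : h.Inv t) (hθ : 0 ≤ θ) (hq : 0 < q) (hτ : 0 ≤ τ) (hΓ : 1 ≤ Γ)
    (hx : Even (h.deg h.pos)) :
    ∑ z, wA θ Γ h z * pot q η τ n (h.stepA z)
      ≤ θ * Γ / Fintype.card V * (4 * t + 3 + τ * n * (2 * t + 1 + Fintype.card V)) *
        pot q η τ n h := by
  have hX := pot_nonneg (η := η) hq.le hτ n h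
  set X := pot q η τ n h with hXdef
  have hxU : h.pos ∉ h.oddV := fun h0 => Nat.not_even_iff_odd.2 (mem_oddV.1 h0) hx
  have hpot : ∀ z, pot q η τ n (h.stepA z) = q ^ h.opn * Real.exp (η * n * (h.reo + 2)) *
      (h.stepA z).vprod * (τ * n) ^ ((h.stepA z).oddV.card / 2) := fun z => rfl
  have hM' : vertexFactor (h.deg h.pos) = vertexFactor (h.deg h.pos - 1) := by
    have := h.deg_pos
    obtain ⟨m, hm⟩ := Nat.exists_eq_add_of_le' this
    rw [hm] at hx ⊢
    rw [Nat.add_sub_cancel]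
    exact vertexFactor_succ_of_odd (by simpa [parity_simps] using hx)
  have hgM := vertexFactor_pos (h.deg h.pos - 1)
  have hvp : ∀ z, z ≠ h.pos → (h.stepA z).vprod * vertexFactor (h.deg z)
      = h.vprod * vertexFactor (h.deg z + 1) := by
    intro z hz
    have := vprod_stepA h hz
    rw [hM'] at this
    apply mul_right_cancel₀ hgM.ne'
    linear_combination this
  have hterm : ∀ z, wA θ Γ h z * pot q η τ n (h.stepA z)
      ≤ (if z ∈ h.vis then θ * Γ / Fintype.card V * X * (h.deg z + 1) else 0)
        + θ * Γ / Fintype.card V * X * (τ * n) * (h.deg z + 1) := by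
    intro z
    have h1 : 0 ≤ θ * Γ / Fintype.card V * X * (τ * n) * (h.deg z + 1) := by positivity
    have h2 : 0 ≤ if z ∈ h.vis then θ * Γ / Fintype.card V * X * (h.deg z + 1) else 0 := by
      split_ifs <;> positivity
    have hw := wA_le (h := h) hθ hΓ z
    have h8 := pot_nonneg (η := η) hq.le hτ n (h.stepA z)
    have hsame : z ∈ h.vis → pot q η τ n (h.stepA z) = X →
        wA θ Γ h z * pot q η τ n (h.stepA z)
          ≤ θ * Γ / Fintype.card V * X * (h.deg z + 1) := by
      intro _ h4
      rw [h4]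
      have h6 : 0 ≤ θ * Γ / Fintype.card V * X := by positivity
      have h7 : (0 : ℝ) ≤ h.deg z := by positivity
      nlinarith
    by_cases hz : z = h.pos
    · subst hz
      rw [if_pos H.pos_mem] at h2 ⊢
      have := hsame H.pos_mem (by rw [hpot, vprod_stepA_self, oddV_stepA_self]; rfl)
      linarith
    · have hv := hvp z hz
      have hgz := vertexFactor_pos (h.deg z)
      by_cases hzU : z ∈ h.oddV
      · have hzv : z ∈ h.vis :=
          H.mem_vis_of_deg (by obtain ⟨m, hm⟩ := mem_oddV.1 hzU; omega)
        rw [if_pos hzv] at h2 ⊢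
        rw [vertexFactor_succ_of_odd (mem_oddV.1 hzU)] at hv
        have := hsame hzv (by
          rw [hpot, card_oddV_stepA_even_odd h hz hxU hzU, mul_right_cancel₀ hgz.ne' hv]; rfl)
        linarith
      · have hc := card_oddV_stepA_even_even h hz hxU hzU
        have hze : Even (h.deg z) := Nat.not_odd_iff_even.1 fun h0 => hzU (mem_oddV.2 h0)
        rw [vertexFactor_succ_of_even hze] at hv
        have hv' : (h.stepA z).vprod = h.vprod * (h.deg z + 1) := by
          apply mul_right_cancel₀ hgz.ne'
          linear_combination hv
        have h4 : (h.oddV.card + 2) / 2 = h.oddV.card / 2 + 1 := by omega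
        have h5 : pot q η τ n (h.stepA z) = X * (τ * n) * (h.deg z + 1) := by
          rw [hpot, hc, h4, hv', pow_succ, hXdef, pot]
          ring
        have h6 : wA θ Γ h z * pot q η τ n (h.stepA z)
            ≤ θ * Γ / Fintype.card V * (X * (τ * n) * (h.deg z + 1)) := by
          rw [h5] at h8 ⊢
          gcongr
        linarith
  refine (Finset.sum_le_sum fun z _ => hterm z).trans ?_
  rw [Finset.sum_add_distrib, ← Finset.sum_filter, Finset.filter_mem_eq_inter,
    Finset.univ_inter, ← Finset.mul_sum, ← Finset.mul_sum]
  have h2 : θ * Γ / Fintype.card V * X * ∑ z ∈ h.vis, ((h.deg z : ℝ) + 1)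
      ≤ θ * Γ / Fintype.card V * X * (4 * t + 3) := by
    gcongr
    exact sum_deg_add_one_le H
  have h3 : θ * Γ / Fintype.card V * X * (τ * n) * ∑ z, ((h.deg z : ℝ) + 1)
      ≤ θ * Γ / Fintype.card V * X * (τ * n) * (2 * t + 1 + Fintype.card V) := by
    gcongr
    exact sum_univ_deg_add_one_le H
  refine (add_le_add h2 h3).trans (le_of_eq ?_)
  ring

end Deterministic

/-! ### ### Balance of the potential -/

lemma pow_add_mul_le_add_pow {τ : ℝ} (hτ : 0 ≤ τ) (n : ℕ) {k : ℕ} (hk : 0 < k) :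
    (τ * n) ^ k + k * τ * (τ * n) ^ (k - 1) ≤ (τ * (n + 1 : ℕ)) ^ k := by
  obtain ⟨m, rfl⟩ := Nat.exists_eq_add_of_le' hk
  have key : ∀ m : ℕ, (n : ℝ) ^ (m + 1) + (m + 1 : ℕ) * (n : ℝ) ^ m ≤ (n + 1 : ℝ) ^ (m + 1) := by
    intro m
    induction m with
    | zero => simp
    | succ m ih =>
      have h1 : (0 : ℝ) ≤ (m + 1 : ℕ) * (n : ℝ) ^ m := by positivity
      calc (n : ℝ) ^ (m + 1 + 1) + (m + 1 + 1 : ℕ) * (n : ℝ) ^ (m + 1)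
          ≤ ((n : ℝ) ^ (m + 1) + (m + 1 : ℕ) * (n : ℝ) ^ m) * (n + 1) := by
            push_cast at h1 ⊢
            ring_nf at h1 ⊢
            nlinarith
        _ ≤ (n + 1 : ℝ) ^ (m + 1) * (n + 1) := by gcongr
        _ = _ := by ring
  rw [Nat.add_sub_cancel, mul_pow, mul_pow, mul_pow]
  have h2 := mul_le_mul_of_nonneg_left (key m) (pow_nonneg hτ (m + 1))
  push_cast at h2 ⊢
  refine le_trans (le_of_eq ?_) h2
  ring

/-- The 10 is 4 from the visited targets, where 4t + 3 ≤ 4L, plus 6 from the new pairs, where τ =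
2Γ/N and the sum over all targets is at most 3N. -/
lemma balance_of_even {θ Γ K L N lam J t n τ : ℝ} (hN : 0 < N) (hθ : 0 ≤ θ) (hθl : θ ≤ lam)
    (hΓ : 1 ≤ Γ) (hK : 1 ≤ K) (hJ : 0 ≤ J) (ht : 0 ≤ t) (hn : 0 ≤ n) (htL : t + 1 ≤ L)
    (hnL : n ≤ L) (hLN : L ≤ N) (hτ : τ = 2 * Γ / N) :
    θ * Γ / N * (4 * t + 3 + τ * n * (2 * t + 1 + N))
      ≤ lam * (10 * Γ ^ 2 * K * L / N * (J + 2)) := by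
  have hτ0 : 0 ≤ τ := by rw [hτ]; positivity
  have hL0 : 0 ≤ L := by linarith
  have b1 : τ * n * (2 * t + 1 + N) ≤ 6 * Γ * L := by
    have : τ * n * (2 * t + 1 + N) ≤ τ * L * (3 * N) := by
      gcongr
      linarith
    refine this.trans (le_of_eq ?_)
    rw [hτ]
    field_simp
    ring
  have b2 : 4 * t + 3 + τ * n * (2 * t + 1 + N) ≤ 10 * Γ * L := by nlinarith
  have hl : 0 ≤ lam := hθ.trans hθl
  calc θ * Γ / N * (4 * t + 3 + τ * n * (2 * t + 1 + N))
      ≤ lam * Γ / N * (10 * Γ * L) := by gcongr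
    _ = lam * (10 * Γ ^ 2 * 1 * L / N * 1) := by ring
    _ ≤ _ := by
        gcongr
        linarith

lemma balance_of_odd {θ Γ K L N lam J t : ℝ} (hN : 0 < N) (hθ : 0 ≤ θ) (hθl : θ ≤ lam)
    (hΓ : 1 ≤ Γ) (hK : 1 ≤ K) (hJ : 0 ≤ J) (ht : 0 ≤ t) (htL : t + 1 ≤ L) :
    θ * (Γ / N * (4 * t + 3)) ≤ lam * (10 * Γ ^ 2 * K * L / N * (J + 2)) := by
  have hl : 0 ≤ lam := hθ.trans hθl
  have hL0 : 0 ≤ L := by linarith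
  calc θ * (Γ / N * (4 * t + 3)) ≤ lam * (Γ ^ 2 / N * (10 * L)) := by
        gcongr
        · nlinarith
        · linarith
    _ = lam * (10 * Γ ^ 2 * 1 * L / N * 1) := by ring
    _ ≤ _ := by
        gcongr
        linarith

lemma balance_random {Γ K L N lam J t q : ℝ} (hN : 0 < N) (hq : 0 ≤ q) (hql : q ≤ lam)
    (hΓ : 1 ≤ Γ) (hK : 1 ≤ K) (hJ : 0 ≤ J) (ht : 0 ≤ t) (htL : t + 1 ≤ L) :
    6 * Γ * K * (J + 2) * q / N * (4 * t + 3) ≤ lam * (24 * Γ ^ 2 * K * L / N * (J + 2)) := by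
  have hl : 0 ≤ lam := hq.trans hql
  have hL0 : 0 ≤ L := by linarith
  have e1 : 6 * Γ * K * (J + 2) * q / N * (4 * t + 3)
      = 6 * (K * (J + 2) / N) * (Γ * q * (4 * t + 3)) := by ring
  have e2 : lam * (24 * Γ ^ 2 * K * L / N * (J + 2))
      = 6 * (K * (J + 2) / N) * (Γ ^ 2 * lam * (4 * L)) := by ring
  rw [e1, e2]
  gcongr
  · nlinarith
  · linarith

/-- The left side is the average of q + σ²/q and q + θ with weights 1 - 1/M and 1/M. -/
lemma balance_main {M q σ θ lam : ℝ} (hM : 1 ≤ M) (h1 : q + σ ^ 2 / q ≤ lam)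
    (h2 : q + θ ≤ lam) : q + (M - 1) / M * (σ ^ 2 / q) + θ * (1 / M) ≤ lam := by
  have e1 : (M - 1) / M = 1 - 1 / M := by field_simp
  rw [e1]
  have e2 : 0 ≤ 1 / M := by positivity
  have e3 : 1 / M ≤ 1 := by rw [div_le_one (by linarith)]; exact hM
  nlinarith

/-- The potential is a supersolution of the weighted step recursion. -/
lemma sum_wA_add_sum_wW_mul_pot_le {θ σ K Γ q lam η τ : ℝ} {n t L : ℕ} {h : WalkState V}
    (H : h.Inv t) (htn : t + n + 1 ≤ L) (hLN : L ≤ Fintype.card V)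
    (hθ : 0 ≤ θ) (hq : 0 < q) (hK : 1 ≤ K) (hΓ : 1 ≤ Γ)
    (h1 : q + σ ^ 2 / q ≤ lam) (h2 : q + θ ≤ lam)
    (hη : η = 34 * Γ ^ 2 * K * L / Fintype.card V) (hηL : η * L ≤ 1)
    (hτ : τ = 2 * Γ / Fintype.card V) :
    ∑ z, wA θ Γ h z * pot q η τ n (h.stepA z) + ∑ z, wW σ K Γ h z * pot q η τ n (h.stepW z)
      ≤ lam * pot q η τ (n + 1) h := by
  have hN : (0 : ℝ) < Fintype.card V := by
    have : 0 < Fintype.card V := Fintype.card_pos_iff.2 ⟨h.pos⟩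
    exact_mod_cast this
  have hLN' : (L : ℝ) ≤ Fintype.card V := by exact_mod_cast hLN
  have hnL : (n : ℝ) ≤ L := by exact_mod_cast (by omega : n ≤ L)
  have htL : (t : ℝ) + 1 ≤ L := by exact_mod_cast (by omega : t + 1 ≤ L)
  have hη0 : 0 ≤ η := by rw [hη]; positivity
  have hτ0 : 0 ≤ τ := by rw [hτ]; positivity
  have hexp : Real.exp (η * n) ≤ 3 := by
    refine (Real.exp_le_exp.2 (?_ : η * n ≤ 1)).trans
      (by have := Real.exp_one_lt_d9; linarith)
    exact (mul_le_mul_of_nonneg_left hnL hη0).trans hηL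
  have hP := h.vprod_pos
  have hJ : (0 : ℝ) ≤ h.reo := by positivity
  have hX := pot_nonneg (η := η) hq.le hτ0 n h
  have hlam : 0 < lam := by linarith
  have hql : q ≤ lam := by linarith
  have hθl : θ ≤ lam := by linarith
  have hW := sum_wW_mul_pot_le (σ := σ) H hq hτ0 hK hΓ hexp
  have hWerr := balance_random hN hq.le hql hΓ hK hJ (Nat.cast_nonneg t) htL
  have c2 := mul_le_mul_of_nonneg_right hWerr hX
  -- The constant 34 splits into 24 for random and 10 for deterministic errors.
  have hη' : η * (h.reo + 2) = 24 * Γ ^ 2 * K * L / Fintype.card V * (h.reo + 2)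
      + 10 * Γ ^ 2 * K * L / Fintype.card V * (h.reo + 2) := by rw [hη]; ring
  have c4 : lam * (1 + η * (h.reo + 2)) * pot q η τ n h = lam * pot q η τ n h
      + lam * (24 * Γ ^ 2 * K * L / Fintype.card V * (h.reo + 2)) * pot q η τ n h
      + lam * (10 * Γ ^ 2 * K * L / Fintype.card V * (h.reo + 2)) * pot q η τ n h := by
    rw [hη']; ring
  set Y := q ^ h.opn * Real.exp (η * n * (h.reo + 2)) * h.vprod with hY
  have hY0 : 0 ≤ Y := by positivity
  have hXY : pot q η τ n h = Y * (τ * n) ^ (h.oddV.card / 2) := rfl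
  have hY1 : 0 ≤ lam * ((h.oddV.card / 2 : ℕ) * τ *
      (Y * (τ * n) ^ (h.oddV.card / 2 - 1))) := by positivity
  have hgoal : ∑ z, wA θ Γ h z * pot q η τ n (h.stepA z)
      + ∑ z, wW σ K Γ h z * pot q η τ n (h.stepW z)
      ≤ lam * (1 + η * (h.reo + 2)) * pot q η τ n h
        + lam * ((h.oddV.card / 2 : ℕ) * τ * (Y * (τ * n) ^ (h.oddV.card / 2 - 1))) := by
    rcases Nat.even_or_odd (h.deg h.pos) with hx | hx
    · have hA := sum_wA_mul_pot_le_of_even (n := n) (η := η) H hθ hq hτ0 hΓ hx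
      have h2' : 2 ≤ h.deg h.pos := by
        have := h.deg_pos
        obtain ⟨m, hm⟩ := hx
        omega
      rw [closeFrac_of_even hx h2', one_mul] at hW
      have hAerr := balance_of_even hN hθ hθl hΓ hK hJ (Nat.cast_nonneg t) (Nat.cast_nonneg n)
        htL hnL hLN' hτ
      have c1 := mul_le_mul_of_nonneg_right hAerr hX
      have c3 := mul_le_mul_of_nonneg_right h1 hX
      rw [add_mul] at hW
      linarith
    · have hA := sum_wA_mul_pot_le_of_odd (n := n) (η := η) H hθ hq hτ0 hΓ hx
      rw [← hY] at hA
      rw [closeFrac_of_odd hx] at hW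
      have hM : (1 : ℝ) ≤ h.deg h.pos := by exact_mod_cast h.deg_pos
      have hAerr := balance_of_odd hN hθ hθl hΓ hK hJ (Nat.cast_nonneg t) htL
      have hmain := balance_main hM h1 h2
      -- With τ = 2Γ/N, the 2k odd targets of weight at most θΓ/N weigh θkτ in total.
      have hk' : θ * Γ / Fintype.card V * (2 * (h.oddV.card / 2 : ℕ)) *
          (Y * (τ * n) ^ (h.oddV.card / 2 - 1))
          ≤ lam * ((h.oddV.card / 2 : ℕ) * τ * (Y * (τ * n) ^ (h.oddV.card / 2 - 1))) := by
        have e1 : θ * Γ / Fintype.card V * (2 * (h.oddV.card / 2 : ℕ)) *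
            (Y * (τ * n) ^ (h.oddV.card / 2 - 1))
          = θ * ((h.oddV.card / 2 : ℕ) * τ * (Y * (τ * n) ^ (h.oddV.card / 2 - 1))) := by
          rw [hτ]; ring
        rw [e1]
        gcongr
      have c1 := mul_le_mul_of_nonneg_right hAerr hX
      have c3 := mul_le_mul_of_nonneg_right hmain hX
      rw [add_mul, add_mul] at c3
      rw [mul_add θ, add_mul] at hA
      rw [add_mul, add_mul] at hW
      linarith
  -- One more step to go multiplies the exponential by at least 1 + η(reo + 2) and raises (τn)^k by
  -- at least kτ(τn)^(k-1). Together these pay for both terms of `hgoal`.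
  refine hgoal.trans ?_
  have hE : Real.exp (η * (n + 1 : ℕ) * (h.reo + 2))
      = Real.exp (η * n * (h.reo + 2)) * Real.exp (η * (h.reo + 2)) := by
    rw [← Real.exp_add]; push_cast; ring_nf
  have hE1 : 1 + η * (h.reo + 2) ≤ Real.exp (η * (h.reo + 2)) := by
    rw [add_comm]; exact Real.add_one_le_exp _
  have hpow : (τ * n) ^ (h.oddV.card / 2) + (h.oddV.card / 2 : ℕ) * τ *
      (τ * n) ^ (h.oddV.card / 2 - 1) ≤ (τ * (n + 1 : ℕ)) ^ (h.oddV.card / 2) := by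
    rcases Nat.eq_zero_or_pos (h.oddV.card / 2) with h0 | h0
    · simp [h0]
    · exact pow_add_mul_le_add_pow hτ0 n h0
  have hR : pot q η τ (n + 1) h
      = Y * Real.exp (η * (h.reo + 2)) * (τ * (n + 1 : ℕ)) ^ (h.oddV.card / 2) := by
    rw [pot, hE, hY]; ring
  rw [hR, hXY]
  have hηJ : 0 ≤ η * (h.reo + 2) := by positivity
  generalize h.oddV.card / 2 = k at *
  calc lam * (1 + η * (h.reo + 2)) * (Y * (τ * n) ^ k)
        + lam * (k * τ * (Y * (τ * n) ^ (k - 1)))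
      ≤ lam * (1 + η * (h.reo + 2)) * (Y * (τ * n) ^ k)
        + lam * (1 + η * (h.reo + 2)) * (k * τ * (Y * (τ * n) ^ (k - 1))) := by
        gcongr
        nlinarith
    _ = lam * (Y * (1 + η * (h.reo + 2)) * ((τ * n) ^ k + k * τ * (τ * n) ^ (k - 1))) := by ring
    _ ≤ lam * (Y * Real.exp (η * (h.reo + 2)) * (τ * (n + 1 : ℕ)) ^ k) := by gcongr

end WalkState

/-! ### ### Sums over lists -/

/-- The sum of `F` over all lists of length `n`. -/
def listSum {S R : Type*} [Fintype S] [AddCommMonoid R] : ℕ → (List S → R) → R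
  | 0, F => F []
  | n + 1, F => ∑ s, listSum n fun l => F (s :: l)

section ListSum

variable {S R : Type*} [Fintype S]

lemma listSum_congr [AddCommMonoid R] {n : ℕ} {F G : List S → R}
    (h : ∀ l, l.length = n → F l = G l) : listSum n F = listSum n G := by
  induction n generalizing F G with
  | zero => exact h [] rfl
  | succ n ih => exact Finset.sum_congr rfl fun s _ => ih fun l hl => h _ (by simp [hl])

lemma listSum_add [AddCommMonoid R] (n : ℕ) (F G : List S → R) :
    listSum n (fun l => F l + G l) = listSum n F + listSum n G := by
  induction n generalizing F G with
  | zero => rfl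
  | succ n ih => simp only [listSum, ih, Finset.sum_add_distrib]

lemma listSum_zero [AddCommMonoid R] (n : ℕ) : listSum n (fun _ : List S => (0 : R)) = 0 := by
  induction n with
  | zero => rfl
  | succ n ih => simp [listSum, ih]

lemma listSum_mul_left [NonUnitalNonAssocSemiring R] (n : ℕ) (c : R) (F : List S → R) :
    listSum n (fun l => c * F l) = c * listSum n F := by
  induction n generalizing F with
  | zero => rfl
  | succ n ih => simp only [listSum, ih, Finset.mul_sum]

lemma listSum_sum [AddCommMonoid R] {T : Type*} [Fintype T] (n : ℕ) (F : T → List S → R) :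
    listSum n (fun l => ∑ t, F t l) = ∑ t, listSum n (F t) := by
  induction n generalizing F with
  | zero => rfl
  | succ n ih =>
    simp only [listSum, ih]
    exact Finset.sum_comm

lemma listSum_comm [AddCommMonoid R] {T : Type*} [Fintype T] (m n : ℕ)
    (F : List T → List S → R) :
    listSum m (fun k => listSum n fun l => F k l) = listSum n fun l => listSum m fun k => F k l := by
  induction m generalizing F with
  | zero => rfl
  | succ m ih => simp only [listSum, ih, listSum_sum]

lemma listSum_ofFn [AddCommMonoid R] (n : ℕ) (F : List S → R) :
    listSum n F = ∑ f : Fin n → S, F (List.ofFn f) := by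
  induction n generalizing F with
  | zero => simp [listSum]
  | succ n ih =>
    rw [← (Fin.consEquiv fun _ : Fin (n + 1) => S).sum_comp, Fintype.sum_prod_type]
    simp only [listSum, ih]
    refine Finset.sum_congr rfl fun s _ => Finset.sum_congr rfl fun f _ => ?_
    simp [List.ofFn_succ, Fin.consEquiv]

end ListSum

namespace WalkState

variable {V : Type*} [Fintype V] [DecidableEq V]

/-! ### Runs along lists of steps

A step is a pair of a Boolean, `true` for deterministic steps, and a target. -/

/-- The state after a step. -/
def next (h : WalkState V) (s : Bool × V) : WalkState V := if s.1 then h.stepA s.2 else h.stepW s.2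

/-- The state after a list of steps. -/
def run (h : WalkState V) (l : List (Bool × V)) : WalkState V := l.foldl next h

/-- The weight of a step. -/
noncomputable def wt (θ σ K Γ : ℝ) (h : WalkState V) (s : Bool × V) : ℝ :=
  if s.1 then wA θ Γ h s.2 else wW σ K Γ h s.2

/-- The product of the weights of a list of steps. -/
noncomputable def wprod (θ σ K Γ : ℝ) : WalkState V → List (Bool × V) → ℝ
  | _, [] => 1
  | h, s :: l => wt θ σ K Γ h s * wprod θ σ K Γ (h.next s) l

/-- The indicator of the states without open edges. -/
noncomputable def closed (h : WalkState V) : ℝ := if h.opn = 0 then 1 else 0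

/-- One random step, averaged against the weights. -/
noncomputable def opW (σ K Γ : ℝ) (F : WalkState V → ℝ) (h : WalkState V) : ℝ :=
  ∑ z, wW σ K Γ h z * F (h.stepW z)

/-- One step, averaged against the weights. -/
noncomputable def opM (θ σ K Γ : ℝ) (F : WalkState V → ℝ) (h : WalkState V) : ℝ :=
  ∑ z, wA θ Γ h z * F (h.stepA z) + ∑ z, wW σ K Γ h z * F (h.stepW z)

lemma opM_zero (σ K Γ : ℝ) : opM (V := V) 0 σ K Γ = opW σ K Γ := by
  ext F h
  simp [opM, opW, wA]

@[simp] lemma run_nil (h : WalkState V) : h.run [] = h := rfl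

@[simp] lemma run_cons (h : WalkState V) (s : Bool × V) (l : List (Bool × V)) :
    h.run (s :: l) = (h.next s).run l := rfl

lemma run_append (h : WalkState V) (l l' : List (Bool × V)) :
    h.run (l ++ l') = (h.run l).run l' := List.foldl_append

lemma wprod_append (θ σ K Γ : ℝ) (h : WalkState V) (l l' : List (Bool × V)) :
    wprod θ σ K Γ h (l ++ l') = wprod θ σ K Γ h l * wprod θ σ K Γ (h.run l) l' := by
  induction l generalizing h with
  | nil => simp [wprod]
  | cons s l ih => simp [wprod, ih, mul_assoc]

lemma listSum_wprod (θ σ K Γ : ℝ) (F : WalkState V → ℝ) (n : ℕ) (h : WalkState V) :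
    listSum n (fun l => wprod θ σ K Γ h l * F (h.run l)) = (opM θ σ K Γ)^[n] F h := by
  induction n generalizing h with
  | zero => simp [listSum, wprod]
  | succ n ih =>
    rw [Function.iterate_succ_apply']
    simp only [listSum, wprod, run_cons, mul_assoc, listSum_mul_left, ih]
    rw [Fintype.sum_prod_type, Fintype.sum_bool]
    rfl

lemma listSum_wprod_random (θ σ K Γ : ℝ) (F : WalkState V → ℝ) (n : ℕ) (h : WalkState V) :
    listSum n (fun l : List V => wprod θ σ K Γ h (l.map (Prod.mk false)) *
      F (h.run (l.map (Prod.mk false)))) = (opW σ K Γ)^[n] F h := by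
  induction n generalizing h with
  | zero => simp [listSum, wprod]
  | succ n ih =>
    rw [Function.iterate_succ_apply']
    simp only [listSum, wprod, List.map_cons, run_cons, mul_assoc, listSum_mul_left, ih]
    rfl

lemma listSum_listSum_wprod (θ σ K Γ : ℝ) (F : WalkState V → ℝ) (r n : ℕ) (h : WalkState V) :
    listSum r (fun k : List V => listSum n fun l =>
      wprod θ σ K Γ h (k.map (Prod.mk false) ++ l) * F (h.run (k.map (Prod.mk false) ++ l)))
      = (opW σ K Γ)^[r] ((opM θ σ K Γ)^[n] F) h := by
  rw [← listSum_wprod_random θ]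
  refine listSum_congr fun k _ => ?_
  simp only [wprod_append, run_append, mul_assoc, listSum_mul_left, listSum_wprod]

/-! ### The bound by the potential -/

lemma wW_nonneg {σ K Γ : ℝ} (hK : 0 ≤ K) (hΓ : 0 ≤ Γ) (h : WalkState V) (z : V) :
    0 ≤ wW σ K Γ h z := by
  unfold wW edgeFactor
  split_ifs <;> positivity

lemma wt_nonneg {θ σ K Γ : ℝ} (hθ : 0 ≤ θ) (hK : 0 ≤ K) (hΓ : 0 ≤ Γ) (h : WalkState V)
    (s : Bool × V) : 0 ≤ wt θ σ K Γ h s := by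
  unfold wt
  split_ifs
  · exact wA_nonneg hθ hΓ _
  · exact wW_nonneg hK hΓ _ _

lemma wprod_nonneg {θ σ K Γ : ℝ} (hθ : 0 ≤ θ) (hK : 0 ≤ K) (hΓ : 0 ≤ Γ) (h : WalkState V)
    (l : List (Bool × V)) : 0 ≤ wprod θ σ K Γ h l := by
  induction l generalizing h with
  | nil => exact zero_le_one
  | cons s l ih => exact mul_nonneg (wt_nonneg hθ hK hΓ h s) (ih _)

/-- The supersolution is iterated backwards in time. The offset `m` allows the terminal function to
come from a later phase of the walk with its own `q` and `lam`. -/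
lemma iterate_opM_le {θ σ K Γ q lam η τ : ℝ} {L : ℕ} (hLN : L ≤ Fintype.card V)
    (hθ : 0 ≤ θ) (hq : 0 < q) (hK : 1 ≤ K) (hΓ : 1 ≤ Γ)
    (h1 : q + σ ^ 2 / q ≤ lam) (h2 : q + θ ≤ lam)
    (hη : η = 34 * Γ ^ 2 * K * L / Fintype.card V) (hηL : η * L ≤ 1)
    (hτ : τ = 2 * Γ / Fintype.card V) {m : ℕ} {c : ℝ} (hc : 0 ≤ c) {F : WalkState V → ℝ}
    (hF : ∀ (h : WalkState V) (t : ℕ), h.Inv t → t + m ≤ L → F h ≤ c * pot q η τ m h)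
    (n : ℕ) (h : WalkState V) (t : ℕ) (H : h.Inv t) (ht : t + n + m ≤ L) :
    (opM θ σ K Γ)^[n] F h ≤ c * lam ^ n * pot q η τ (m + n) h := by
  induction n generalizing h t with
  | zero => simpa using hF h t H (by omega)
  | succ n ih =>
    rw [Function.iterate_succ_apply']
    have hlam : 0 ≤ lam := by linarith
    have key := sum_wA_add_sum_wW_mul_pot_le H (n := m + n) (by omega) hLN hθ hq hK hΓ h1 h2 hη
      hηL hτ
    calc opM θ σ K Γ ((opM θ σ K Γ)^[n] F) h
        ≤ ∑ z, wA θ Γ h z * (c * lam ^ n * pot q η τ (m + n) (h.stepA z))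
          + ∑ z, wW σ K Γ h z * (c * lam ^ n * pot q η τ (m + n) (h.stepW z)) := by
          refine add_le_add (Finset.sum_le_sum fun z _ => ?_) (Finset.sum_le_sum fun z _ => ?_)
          · exact mul_le_mul_of_nonneg_left (ih _ _ (H.stepA z) (by omega))
              (wA_nonneg hθ (by linarith) _)
          · exact mul_le_mul_of_nonneg_left (ih _ _ (H.stepW z) (by omega))
              (wW_nonneg (by linarith) (by linarith) _ _)
      _ = c * lam ^ n * (∑ z, wA θ Γ h z * pot q η τ (m + n) (h.stepA z)
          + ∑ z, wW σ K Γ h z * pot q η τ (m + n) (h.stepW z)) := by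
          rw [mul_add, Finset.mul_sum, Finset.mul_sum]
          congr 1 <;> exact Finset.sum_congr rfl fun z _ => by ring
      _ ≤ c * lam ^ n * (lam * pot q η τ (m + n + 1) h) := by gcongr
      _ = _ := by rw [pow_succ, ← add_assoc]; ring

/-- Without open edges the degrees sum to 1, so no pair of odd vertices is left and the power of τ ·
0 has exponent 0. -/
lemma closed_le_pot {q η τ : ℝ} (hq : 0 ≤ q) (hτ : 0 ≤ τ) {h : WalkState V} {t : ℕ}
    (H : h.Inv t) :
    h.closed ≤ pot q η τ 0 h := by
  have hP := h.one_le_vprod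
  have hcard : h.oddV.card ≤ 2 * h.opn + 1 := by
    rw [← H.sum_deg, Finset.card_eq_sum_ones, ← Finset.sum_filter_add_sum_filter_not
      Finset.univ (fun v => v ∈ h.oddV)]
    refine le_trans ?_ (Nat.le_add_right _ _)
    rw [Finset.filter_mem_eq_inter, Finset.univ_inter]
    refine Finset.sum_le_sum fun v hv => ?_
    obtain ⟨m, hm⟩ := mem_oddV.1 hv
    omega
  unfold closed
  split_ifs with h0
  · have : h.oddV.card / 2 = 0 := by omega
    simp only [pot, h0, this, pow_zero, Nat.cast_zero, mul_zero, zero_mul, Real.exp_zero]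
    linarith
  · exact pot_nonneg hq hτ 0 h

lemma pot_init (q η τ : ℝ) (n : ℕ) (z : V) : pot q η τ n (init z) = Real.exp (η * n * 2) := by
  have hdeg : ∀ v, (init z).deg v = if v = z then 1 else 0 := by
    intro v
    have h1 : (init z).pos = z := rfl
    have h2 : ∀ e, (init z).cnt e = 0 := fun _ => rfl
    simp [deg, h1, h2]
  have h1 : (init z).vprod = 1 := by
    unfold vprod
    refine Finset.prod_eq_one fun v _ => ?_
    rw [hdeg]
    split_ifs <;> simp [vertexFactor]
  have h2 : (init z).oddV = {z} := by
    ext v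
    rw [mem_oddV, hdeg]
    split_ifs with h <;> simp [h]
  have h3 : (init z).opn = 0 := by simp [opn, init]
  have h4 : (init z).reo = 0 := rfl
  simp [pot, h1, h2, h3, h4]

lemma pot_mono {q q' η τ : ℝ} (hq : 0 ≤ q) (hqq : q ≤ q') (hτ : 0 ≤ τ) (n : ℕ)
    (h : WalkState V) : pot q η τ n h ≤ pot q' η τ n h := by
  have := h.vprod_pos
  unfold pot
  gcongr

/-- The total weight of the closed runs that start with `r` random steps. -/
lemma iterate_opW_iterate_opM_le {θ σ K Γ q lam : ℝ} {L r n : ℕ} (hLN : L ≤ Fintype.card V)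
    (hrn : r + n ≤ L) (hσ : 0 < σ) (hθ : 0 ≤ θ) (hq : 0 < q) (hqσ : q ≤ σ) (hK : 1 ≤ K)
    (hΓ : 1 ≤ Γ) (h1 : q + σ ^ 2 / q ≤ lam) (h2 : q + θ ≤ lam)
    (hηL : 34 * Γ ^ 2 * K * L / Fintype.card V * L ≤ 1) (z : V) :
    (opW σ K Γ)^[r] ((opM θ σ K Γ)^[n] closed) (init z) ≤ 9 * ((2 * σ) ^ r * lam ^ n) := by
  set η := 34 * Γ ^ 2 * K * L / (Fintype.card V : ℝ) with hη
  set τ := 2 * Γ / (Fintype.card V : ℝ) with hτ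
  have hη0 : 0 ≤ η := by rw [hη]; positivity
  have hτ0 : 0 ≤ τ := by rw [hτ]; positivity
  have hlam : 0 ≤ lam := by linarith
  -- The last `n` steps are bounded with `q`. The result is then weakened to the value σ needed for
  -- the first phase.
  have hF : ∀ (h : WalkState V) (t : ℕ), h.Inv t → t + n ≤ L →
      (opM θ σ K Γ)^[n] closed h ≤ lam ^ n * pot σ η τ n h := by
    intro h t H ht
    have := iterate_opM_le (F := closed) (m := 0) hLN hθ hq hK hΓ h1 h2 hη hηL hτ zero_le_one
      (fun h t H _ => by rw [one_mul]; exact closed_le_pot hq.le hτ0 H) n h t H ht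
    rw [one_mul, zero_add] at this
    refine this.trans ?_
    have := pot_mono (η := η) hq.le hqσ hτ0 n h
    gcongr
  have h3 : σ + σ ^ 2 / σ ≤ 2 * σ := by
    rw [pow_two, mul_div_assoc, div_self hσ.ne']; linarith
  -- Purely random steps are the case θ = 0, where q = σ minimizes q + σ²/q and gives the rate 2σ.
  have := iterate_opM_le (θ := 0) hLN le_rfl hσ hK hΓ h3 (by linarith) hη hηL hτ
    (pow_nonneg hlam n) hF r (init z) 0 (inv_init z) (by omega)
  rw [opM_zero, pot_init] at this
  refine this.trans ?_
  -- The initial state has `reo` = 0, so its exponential is at most exp(2ηL) ≤ e² < 9.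
  have h4 : Real.exp (η * (n + r : ℕ) * 2) ≤ 9 := by
    have h5 : η * (n + r : ℕ) * 2 ≤ 1 + 1 := by
      have : η * (n + r : ℕ) ≤ η * L := by
        gcongr
        omega
      linarith
    refine (Real.exp_le_exp.2 h5).trans ?_
    rw [Real.exp_add]
    have h6 := Real.exp_one_lt_d9
    have h7 := Real.exp_pos 1
    nlinarith
  calc lam ^ n * (2 * σ) ^ r * Real.exp (η * (n + r : ℕ) * 2)
      ≤ lam ^ n * (2 * σ) ^ r * 9 := by gcongr
    _ = _ := by ring

/-! ### Defects -/

/-- The defects: openings onto visited vertices, and deterministic steps that land on a visited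
vertex or leave a vertex of even degree. -/
def Defect (h : WalkState V) (s : Bool × V) : Prop :=
  if s.1 then s.2 ∈ h.vis ∨ Even (h.deg h.pos)
  else Even (h.cnt s(h.pos, s.2)) ∧ s.2 ∈ h.vis

/-- The lists of steps without defects. -/
def Good : WalkState V → List (Bool × V) → Prop
  | _, [] => True
  | h, s :: l => ¬ h.Defect s ∧ Good (h.next s) l

lemma wt_eq_of_not_defect {θ σ K Γ Γ' : ℝ} {h : WalkState V} {s : Bool × V}
    (hs : ¬ h.Defect s) : wt θ σ K Γ h s = wt θ σ K Γ' h s := by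
  rcases s with ⟨_ | _, z⟩
  · simp only [Defect, Bool.false_eq_true, if_false, not_and] at hs
    simp only [wt, wW, Bool.false_eq_true, if_false]
    split_ifs with h1 h2
    · rfl
    · exact absurd h2 (hs (Nat.not_odd_iff_even.1 h1))
    · rfl
  · simp only [Defect, if_true] at hs
    simp only [wt, wA, if_true, if_neg hs]

lemma wt_of_defect {θ σ K Γ : ℝ} {h : WalkState V} {s : Bool × V}
    (hs : h.Defect s) : wt θ σ K Γ h s = Γ * wt θ σ K 1 h s := by
  rcases s with ⟨_ | _, z⟩
  · simp only [Defect, Bool.false_eq_true, if_false] at hs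
    simp only [wt, wW, Bool.false_eq_true, if_false, if_neg (Nat.not_odd_iff_even.2 hs.1),
      if_pos hs.2]
    ring
  · simp only [Defect, if_true] at hs
    simp only [wt, wA, if_true, if_pos hs]
    ring

lemma Good.wprod_eq {θ σ K Γ Γ' : ℝ} {h : WalkState V} {l : List (Bool × V)} (hl : h.Good l) :
    wprod θ σ K Γ h l = wprod θ σ K Γ' h l := by
  induction l generalizing h with
  | nil => rfl
  | cons s l ih => rw [wprod, wprod, wt_eq_of_not_defect hl.1, ih hl.2]

lemma wprod_zero_of_not_good {θ σ K : ℝ} {h : WalkState V} {l : List (Bool × V)}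
    (hl : ¬ h.Good l) : wprod θ σ K 0 h l = 0 := by
  induction l generalizing h with
  | nil => exact absurd trivial hl
  | cons s l ih =>
    by_cases hs : h.Defect s
    · rw [wprod, wt_of_defect hs]; ring
    · rw [wprod, ih fun h' => hl ⟨hs, h'⟩, mul_zero]

lemma wprod_one_le {θ σ K Γ : ℝ} (hθ : 0 ≤ θ) (hK : 0 ≤ K) (hΓ : 1 ≤ Γ) (h : WalkState V)
    (l : List (Bool × V)) : wprod θ σ K 1 h l ≤ wprod θ σ K Γ h l := by
  induction l generalizing h with
  | nil => exact le_rfl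
  | cons s l ih =>
    have h1 := wt_nonneg (σ := σ) hθ hK (zero_le_one : (0 : ℝ) ≤ 1) h s
    have h2 := wprod_nonneg (σ := σ) hθ hK (zero_le_one : (0 : ℝ) ≤ 1) (h.next s) l
    refine mul_le_mul ?_ (ih _) h2 (wt_nonneg hθ hK (by linarith) h s)
    by_cases hs : h.Defect s
    · rw [wt_of_defect (Γ := Γ) hs]; nlinarith
    · rw [wt_eq_of_not_defect hs]

/-- One defect already contributes the full penalty, so bounding the penalized total shows that
lists with a defect carry a fraction of order 1/Γ. -/
lemma mul_wprod_one_le_of_not_good {θ σ K Γ : ℝ} (hθ : 0 ≤ θ) (hK : 0 ≤ K) (hΓ : 1 ≤ Γ)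
    {h : WalkState V} {l : List (Bool × V)} (hl : ¬ h.Good l) :
    Γ * wprod θ σ K 1 h l ≤ wprod θ σ K Γ h l := by
  induction l generalizing h with
  | nil => exact absurd trivial hl
  | cons s l ih =>
    have h1 := wt_nonneg (σ := σ) hθ hK (zero_le_one : (0 : ℝ) ≤ 1) h s
    have h0 := wt_nonneg (σ := σ) (Γ := Γ) hθ hK (by linarith) h s
    have h2 := wprod_nonneg (σ := σ) hθ hK (zero_le_one : (0 : ℝ) ≤ 1) (h.next s) l
    rw [wprod, wprod]
    by_cases hs : h.Defect s
    · rw [wt_of_defect (Γ := Γ) hs, ← mul_assoc]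
      exact mul_le_mul_of_nonneg_left (wprod_one_le hθ hK hΓ _ _)
        (mul_nonneg (by linarith) h1)
    · rw [wt_eq_of_not_defect (Γ' := 1) hs (Γ := Γ)]
      have := mul_le_mul_of_nonneg_left (ih fun h' => hl ⟨hs, h'⟩) h1
      linarith

/-! ### The weight as a product over edges -/

/-- The weight of an edge passed `k` times by random steps. -/
noncomputable def edgeWeight (σ K : ℝ) (e : Sym2 V) : ℕ → ℝ
  | 0 => 1
  | k + 1 => (if Odd k then σ ^ 2 else edgeFactor K e k / Fintype.card V) * edgeWeight σ K e k

/-- At penalty 1 the factor of a random step depends only on its edge and on the passages so far, so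
the product along the walk regroups by edges. -/
lemma wprod_mul_edgeWeight (θ σ K : ℝ) (h : WalkState V) (l : List (Bool × V)) :
    wprod θ σ K 1 h l * ∏ e, edgeWeight σ K e (h.cnt e)
      = (θ / Fintype.card V) ^ (l.countP fun s => s.1) *
        ∏ e, edgeWeight σ K e ((h.run l).cnt e) := by
  induction l generalizing h with
  | nil => simp [wprod]
  | cons s l ih =>
    rcases s with ⟨_ | _, z⟩
    · have h1 : ∏ e, edgeWeight σ K e ((h.stepW z).cnt e)
          = wW σ K 1 h z * ∏ e, edgeWeight σ K e (h.cnt e) := by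
        rw [← Finset.mul_prod_erase _ _ (Finset.mem_univ s(h.pos, z)),
          ← Finset.mul_prod_erase Finset.univ (fun e => edgeWeight σ K e (h.cnt e))
            (Finset.mem_univ s(h.pos, z)), ← mul_assoc]
        congr 1
        · simp [stepW, wW, edgeWeight]
        · refine Finset.prod_congr rfl fun e he => ?_
          simp [stepW, Function.update_of_ne (Finset.ne_of_mem_erase he)]
      have h2 := ih (h.stepW z)
      have h3 : h.next (false, z) = h.stepW z := rfl
      rw [run_cons, h3, List.countP_cons_of_neg (by simp), ← h2, h1, wprod, h3]
      simp only [wt, Bool.false_eq_true, if_false]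
      ring
    · have h2 := ih (h.stepA z)
      have h3 : h.next (true, z) = h.stepA z := rfl
      have h4 : wA θ 1 h z = θ / Fintype.card V := by simp [wA]
      have h5 : (h.stepA z).cnt = h.cnt := rfl
      rw [run_cons, h3, List.countP_cons_of_pos (by simp), pow_succ, wprod, h3]
      rw [h5] at h2
      simp only [wt, if_true, h4]
      linear_combination (θ / Fintype.card V) * h2

end WalkState

/-! ### Runs without defects keep a stack of vertices -/

/-- The edges between consecutive entries. -/
def stackEdges {V : Type*} : List V → List (Sym2 V)
  | x :: y :: st => s(x, y) :: stackEdges (y :: st)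
  | _ => []

/-- The effect of a step on the stack of vertices from the current position down to the base. -/
def stackStep {V : Type*} [DecidableEq V] (st : List V) (s : Bool × V) : List V :=
  if s.1 then [s.2] else if st.tail.head? = some s.2 then st.tail else s.2 :: st

/-- The stack after a list of steps from `z`. -/
def stack {V : Type*} [DecidableEq V] (z : V) (l : List (Bool × V)) : List V :=
  l.foldl stackStep [z]

lemma mem_of_mem_stackEdges {V : Type*} : ∀ {st : List V} {e : Sym2 V} {v : V},
    e ∈ stackEdges st → v ∈ e → v ∈ st
  | [], e, v, he, _ => by simp [stackEdges] at he
  | [x], e, v, he, _ => by simp [stackEdges] at he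
  | x :: y :: st, e, v, he, hv => by
    simp only [stackEdges, List.mem_cons] at he
    rcases he with rfl | he
    · rcases Sym2.mem_iff.1 hv with rfl | rfl <;> simp
    · exact List.mem_cons_of_mem _ (mem_of_mem_stackEdges he hv)

lemma mem_stackEdges_head {V : Type*} {x y w : V} {st : List V} (hx : x ∉ y :: st) :
    s(x, w) ∈ stackEdges (x :: y :: st) ↔ w = y := by
  simp only [stackEdges, List.mem_cons]
  constructor
  · rintro (h | h)
    · rcases Sym2.eq_iff.1 h with h | h
      · exact h.2
      · exact absurd (by simp [h.1]) hx
    · exact absurd (mem_of_mem_stackEdges h (by simp)) hx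
  · rintro rfl; exact Or.inl rfl

namespace WalkState

variable {V : Type*} [Fintype V] [DecidableEq V]

lemma good_append {h : WalkState V} {l l' : List (Bool × V)} :
    h.Good (l ++ l') ↔ h.Good l ∧ (h.run l).Good l' := by
  induction l generalizing h with
  | nil => simp [Good]
  | cons s l ih => simp [Good, ih, and_assoc]

lemma run_snoc (h : WalkState V) (l : List (Bool × V)) (s : Bool × V) :
    h.run (l ++ [s]) = (h.run l).next s := by rw [run_append]; rfl

lemma stack_snoc (z : V) (l : List (Bool × V)) (s : Bool × V) :
    stack z (l ++ [s]) = stackStep (stack z l) s := by simp [stack, List.foldl_append]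

lemma inv_run (z : V) (l : List (Bool × V)) : ((init z).run l).Inv l.length := by
  induction l using List.reverseRecOn with
  | nil => exact inv_init z
  | append_singleton l s ih =>
    rw [run_snoc, List.length_append]
    rcases s with ⟨_ | _, y⟩
    · exact ih.stepW y
    · exact ih.stepA y

/-- The description of a state by a stack. -/
structure StackInv (h : WalkState V) (st : List V) : Prop where
  head : ∃ st', st = h.pos :: st'
  nodup : st.Nodup
  sub : ∀ v ∈ st, v ∈ h.vis
  odd_iff : ∀ e, Odd (h.cnt e) ↔ e ∈ stackEdges st
  cnt_le : ∀ e, h.cnt e ≤ 2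

lemma StackInv.deg_pos_of_singleton {h : WalkState V} {x : V} (S : h.StackInv [x]) :
    h.deg h.pos = 1 := by
  have h0 : ∀ e, h.cnt e % 2 = 0 := fun e => by
    have := S.odd_iff e
    simp only [stackEdges, List.not_mem_nil, iff_false, Nat.not_odd_iff] at this
    exact this
  simp [deg, h0]

/-- Above the base the only open edge at the position leads down the stack. The degree is then even,
which makes every deterministic step from there a defect. -/
lemma StackInv.deg_pos_of_cons {h : WalkState V} {x y : V} {st : List V}
    (S : h.StackInv (x :: y :: st)) : h.deg h.pos = 2 := by
  obtain ⟨st', hst'⟩ := S.head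
  obtain ⟨hx, -⟩ := List.cons.inj hst'
  subst hx
  have hnd := (List.nodup_cons.1 S.nodup).1
  have h0 : ∀ w, h.cnt s(h.pos, w) % 2 = if w = y then 1 else 0 := fun w => by
    have h1 := (S.odd_iff s(h.pos, w)).trans (mem_stackEdges_head hnd)
    split_ifs with hw
    · exact Nat.odd_iff.1 (h1.2 hw)
    · exact Nat.not_odd_iff.1 fun h2 => hw (h1.1 h2)
  have h1 : h.pos ≠ y := fun h1 => hnd (by simp [h1])
  simp [deg, h0, h1]

/-- The steps without defects: push a new vertex, pop, or jump from a base to a new vertex. -/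
lemma StackInv.cases {h : WalkState V} {st : List V} (S : h.StackInv st)
    {s : Bool × V} (hs : ¬ h.Defect s) :
    (s.1 = false ∧ s.2 ∉ h.vis ∧ stackStep st s = s.2 :: st) ∨
    (∃ st', s.1 = false ∧ st = h.pos :: s.2 :: st' ∧ stackStep st s = s.2 :: st') ∨
    (s.1 = true ∧ s.2 ∉ h.vis ∧ st = [h.pos] ∧ stackStep st s = [s.2]) := by
  obtain ⟨st', hst'⟩ := S.head
  subst hst'
  rcases s with ⟨_ | _, y⟩
  · simp only [Defect, Bool.false_eq_true, if_false, not_and] at hs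
    rcases Nat.even_or_odd (h.cnt s(h.pos, y)) with he | he
    · have hy := hs he
      refine Or.inl ⟨rfl, hy, ?_⟩
      rw [stackStep, if_neg (by simp), if_neg]
      intro h0
      have h1 : y ∈ st' := by
        cases st' with
        | nil => simp at h0
        | cons a st' => simp at h0; simp [h0]
      exact hy (S.sub y (List.mem_cons_of_mem _ h1))
    · have h1 := (S.odd_iff _).1 he
      cases st' with
      | nil => simp [stackEdges] at h1
      | cons a st' =>
        have h2 := (mem_stackEdges_head (List.nodup_cons.1 S.nodup).1).1 h1
        subst h2
        exact Or.inr (Or.inl ⟨st', rfl, rfl, by simp [stackStep]⟩)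
  · simp only [Defect, if_true, not_or] at hs
    cases st' with
    | nil => exact Or.inr (Or.inr ⟨rfl, hs.1, rfl, by simp [stackStep]⟩)
    | cons a st' =>
      exact absurd (by rw [S.deg_pos_of_cons]; decide) hs.2

/-- A push uses an edge never passed before, and a pop passes an edge of odd count at most 2 for the
second time, so counts never exceed 2. A jump starts from a one-vertex stack and leaves no open edge
behind. -/
lemma StackInv.next {h : WalkState V} {st : List V} {t : ℕ} (S : h.StackInv st) (H : h.Inv t)
    {s : Bool × V} (hs : ¬ h.Defect s) : (h.next s).StackInv (stackStep st s) := by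
  obtain ⟨b, y⟩ := s
  rcases S.cases hs with ⟨hb, hy, hst⟩ | ⟨st', hb, hst', hst⟩ | ⟨hb, hy, hst', hst⟩ <;>
    simp only at hb <;> subst hb <;> rw [hst] <;> simp only at *
  · have hnx : h.next (false, y) = h.stepW y := rfl
    rw [hnx]
    obtain ⟨st', hst'⟩ := S.head
    have h0 := H.cnt_eq_zero hy
    refine ⟨⟨st, rfl⟩, ?_, ?_, ?_, ?_⟩
    · exact List.nodup_cons.2 ⟨fun h1 => hy (S.sub y h1), S.nodup⟩
    · intro v hv
      simp only [stepW, Finset.mem_insert]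
      rcases List.mem_cons.1 hv with rfl | hv
      · exact Or.inl rfl
      · exact Or.inr (S.sub v hv)
    · intro e
      rw [hst', stackEdges, List.mem_cons, ← hst']
      by_cases he : e = s(h.pos, y)
      · subst he
        have hsw : s(y, h.pos) = s(h.pos, y) := Sym2.eq_swap
        rw [hsw]
        simp [stepW, h0]
      · have he' : e ≠ s(y, h.pos) := by rwa [Sym2.eq_swap]
        simp only [stepW, Function.update_of_ne he, he', false_or]
        exact S.odd_iff e
    · intro e
      by_cases he : e = s(h.pos, y)
      · subst he
        simp [stepW, h0]
      · simpa only [stepW, Function.update_of_ne he] using S.cnt_le e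
  · have hnx : h.next (false, y) = h.stepW y := rfl
    rw [hnx]
    subst hst'
    have hnd := List.nodup_cons.1 S.nodup
    have ho : Odd (h.cnt s(h.pos, y)) := (S.odd_iff _).2 ((mem_stackEdges_head hnd.1).2 rfl)
    refine ⟨⟨st', rfl⟩, hnd.2, ?_, ?_, ?_⟩
    · intro v hv
      exact Finset.mem_insert_of_mem (S.sub v (List.mem_cons_of_mem _ hv))
    · intro e
      by_cases he : e = s(h.pos, y)
      · subst he
        simp only [stepW, Function.update_self]
        constructor
        · intro h1
          exact absurd ho (by simpa [parity_simps] using h1)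
        · intro h1
          exact absurd (mem_of_mem_stackEdges h1 (by simp)) hnd.1
      · simp only [stepW, Function.update_of_ne he]
        rw [S.odd_iff e, stackEdges, List.mem_cons]
        simp [he]
    · intro e
      by_cases he : e = s(h.pos, y)
      · subst he
        have := S.cnt_le s(h.pos, y)
        simp only [stepW, Function.update_self]
        obtain ⟨k, hk⟩ := ho
        omega
      · simpa only [stepW, Function.update_of_ne he] using S.cnt_le e
  · have hnx : h.next (true, y) = h.stepA y := rfl
    rw [hnx]
    refine ⟨⟨[], rfl⟩, by simp, by simp [stepA], ?_, S.cnt_le⟩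
    intro e
    have h1 := S.odd_iff e
    rw [hst'] at h1
    exact h1.trans (by simp [stackEdges])

lemma Good.snoc {h : WalkState V} {l : List (Bool × V)} {s : Bool × V} (hl : h.Good (l ++ [s])) :
    h.Good l ∧ ¬ (h.run l).Defect s := by
  have := good_append.1 hl
  exact ⟨this.1, this.2.1⟩

lemma Good.stackInv {z : V} {l : List (Bool × V)} (hl : (init z).Good l) :
    ((init z).run l).StackInv (stack z l) := by
  induction l using List.reverseRecOn with
  | nil => exact ⟨⟨[], rfl⟩, by simp [stack], by simp [stack, init], by simp [stack, stackEdges, init],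
      by simp [init]⟩
  | append_singleton l s ih =>
    rw [run_snoc, stack_snoc]
    exact (ih hl.snoc.1).next (inv_run z l) hl.snoc.2

lemma StackInv.opn_eq_zero_iff {h : WalkState V} {st : List V} (S : h.StackInv st) :
    h.opn = 0 ↔ st.length = 1 := by
  obtain ⟨st', hst'⟩ := S.head
  subst hst'
  have h1 : h.opn = 0 ↔ ∀ e, ¬ Odd (h.cnt e) := by
    simp [opn, Finset.sum_eq_zero_iff, Nat.even_iff]
  rw [h1]
  cases st' with
  | nil => simp only [S.odd_iff]; simp [stackEdges]
  | cons a st' =>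
    simp only [S.odd_iff]
    simp only [List.length_cons]
    constructor
    · intro h2
      exact absurd ((mem_stackEdges_head (List.nodup_cons.1 S.nodup).1).2 rfl) (h2 s(h.pos, a))
    · intro h2; omega

/-! ### Comparison of runs without defects with a chain on the depths -/

/-- One step of the chain of depths, with weight `θ` for staying at `0`. -/
def chain (θ σ : ℝ) (f : ℕ → ℝ) (d : ℕ) : ℝ :=
  f (d + 1) + if d = 0 then θ * f 0 else σ ^ 2 * f (d - 1)

lemma chain_nonneg {θ σ : ℝ} (hθ : 0 ≤ θ) {f : ℕ → ℝ} (hf : ∀ d, 0 ≤ f d) (d : ℕ) :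
    0 ≤ chain θ σ f d := by
  unfold chain
  have := hf (d + 1)
  have := hf 0
  have := hf (d - 1)
  split_ifs <;> positivity

/-- The function `F` of states without defects is comparable to the function `f` of the depth. -/
def Comparable (z : V) (L n : ℕ) (a : ℝ) (F : WalkState V → ℝ) (f : ℕ → ℝ) : Prop :=
  ∀ l, (init z).Good l → l.length + n ≤ L → ∀ d, (stack z l).length = d + 1 →
    a * f d ≤ F ((init z).run l) ∧ F ((init z).run l) ≤ f d

/-- Penalty 0 removes the defects, which leaves the pushes with weight 1/N each and the single pop.
-/
lemma sum_wW_zero {σ K : ℝ} {h : WalkState V} {st : List V} {t : ℕ} (S : h.StackInv st)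
    (H : h.Inv t) (F : WalkState V → ℝ) :
    opW σ K 0 F h = ∑ y ∈ Finset.univ \ h.vis, 1 / (Fintype.card V : ℝ) * F (h.stepW y)
      + st.tail.head?.elim 0 fun y => σ ^ 2 * F (h.stepW y) := by
  have h1 : ∑ z ∈ Finset.univ \ h.vis, wW σ K 0 h z * F (h.stepW z)
      = ∑ y ∈ Finset.univ \ h.vis, 1 / (Fintype.card V : ℝ) * F (h.stepW y) := by
    refine Finset.sum_congr rfl fun y hy => ?_
    have hy' : y ∉ h.vis := by simpa using hy
    have h0 := H.cnt_eq_zero hy'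
    have h4 : h.pos ≠ y := fun h4 => hy' (h4 ▸ H.pos_mem)
    simp [wW, edgeFactor, h0, hy', h4]
  have h2 : ∀ z ∈ h.vis, wW σ K 0 h z * F (h.stepW z)
      = if Odd (h.cnt s(h.pos, z)) then σ ^ 2 * F (h.stepW z) else 0 := by
    intro z hz
    by_cases ho : Odd (h.cnt s(h.pos, z))
    · simp [wW, ho]
    · simp [wW, ho, hz]
  rw [opW, ← Finset.sum_sdiff (Finset.subset_univ h.vis), h1, Finset.sum_congr rfl h2]
  congr 1
  obtain ⟨st', hst'⟩ := S.head
  subst hst'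
  cases st' with
  | nil =>
    simp [S.odd_iff, stackEdges]
  | cons a st' =>
    simp only [S.odd_iff, mem_stackEdges_head (List.nodup_cons.1 S.nodup).1]
    rw [Finset.sum_ite_eq' h.vis a, if_pos (S.sub a (by simp))]
    rfl

lemma sum_wA_zero {θ : ℝ} {h : WalkState V} {st : List V} (S : h.StackInv st)
    (F : WalkState V → ℝ) :
    ∑ z, wA θ 0 h z * F (h.stepA z) = if st.length = 1 then
      ∑ y ∈ Finset.univ \ h.vis, θ / (Fintype.card V : ℝ) * F (h.stepA y) else 0 := by
  obtain ⟨st', hst'⟩ := S.head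
  subst hst'
  cases st' with
  | nil =>
    rw [if_pos (by simp : [h.pos].length = 1), ← Finset.sum_sdiff (Finset.subset_univ h.vis)]
    rw [Finset.sum_eq_zero (s := h.vis), add_zero]
    · refine Finset.sum_congr rfl fun y hy => ?_
      have hy' : y ∉ h.vis := by simpa using hy
      have : ¬ Even (h.deg h.pos) := by rw [S.deg_pos_of_singleton]; decide
      simp [wA, hy', this]
    · intro y hy
      simp [wA, hy]
  | cons a st' =>
    rw [if_neg (by simp)]
    refine Finset.sum_eq_zero fun y _ => ?_
    have : Even (h.deg h.pos) := by rw [S.deg_pos_of_cons]; decide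
    simp [wA, this]

/-- At most L of the N targets are excluded, which costs the factor 1 - L/N in the lower bound and
nothing in the upper bound. -/
lemma sum_new_bounds {c a b : ℝ} {L : ℕ} {s : Finset V} {F : V → ℝ} (hV : 0 < Fintype.card V)
    (hs : s.card ≤ L) (hb : 0 ≤ b) (ha : 0 ≤ a) (hc : 0 ≤ c)
    (hF : ∀ y ∉ s, a * b ≤ F y ∧ F y ≤ b) :
    a * (1 - L / Fintype.card V) * (c * b)
        ≤ ∑ y ∈ Finset.univ \ s, c / (Fintype.card V : ℝ) * F y ∧
      ∑ y ∈ Finset.univ \ s, c / (Fintype.card V : ℝ) * F y ≤ c * b := by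
  have hN : (0 : ℝ) < Fintype.card V := by exact_mod_cast hV
  have hcard : ((Finset.univ \ s).card : ℝ) = Fintype.card V - s.card := by
    rw [Finset.card_sdiff_of_subset (Finset.subset_univ _), Finset.card_univ,
      Nat.cast_sub (Finset.card_le_univ _)]
  have hs' : (s.card : ℝ) ≤ L := by exact_mod_cast hs
  constructor
  · have h1 : ∑ y ∈ Finset.univ \ s, c / (Fintype.card V : ℝ) * (a * b)
        ≤ ∑ y ∈ Finset.univ \ s, c / (Fintype.card V : ℝ) * F y :=
      Finset.sum_le_sum fun y hy =>
        mul_le_mul_of_nonneg_left (hF y (by simpa using hy)).1 (by positivity)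
    rw [Finset.sum_const, nsmul_eq_mul, hcard] at h1
    refine le_trans ?_ h1
    have h2 : a * (1 - L / Fintype.card V) * (c * b)
        = (Fintype.card V - L) * (c / Fintype.card V * (a * b)) := by field_simp
    rw [h2]
    gcongr
  · have h1 : ∑ y ∈ Finset.univ \ s, c / (Fintype.card V : ℝ) * F y
        ≤ ∑ y ∈ Finset.univ \ s, c / (Fintype.card V : ℝ) * b :=
      Finset.sum_le_sum fun y hy =>
        mul_le_mul_of_nonneg_left (hF y (by simpa using hy)).2 (by positivity)
    rw [Finset.sum_const, nsmul_eq_mul, hcard] at h1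
    refine h1.trans ?_
    have h2 : c * b = Fintype.card V * (c / Fintype.card V * b) := by field_simp
    rw [h2]
    gcongr
    have : (0 : ℝ) ≤ s.card := by positivity
    linarith

/-- Pushes and jumps have about N targets of weight 1/N and θ/N, and a pop has one target of weight
σ². Only the first two lose the factor 1 - L/N. -/
lemma Comparable.opM {z : V} {L n : ℕ} {a θ σ K : ℝ} {F : WalkState V → ℝ} {f : ℕ → ℝ}
    (hF : Comparable z L n a F f) (hf : ∀ d, 0 ≤ f d) (ha : 0 ≤ a) (hθ : 0 ≤ θ)
    (hLN : L ≤ Fintype.card V) :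
    Comparable z L (n + 1) (a * (1 - L / Fintype.card V)) (opM θ σ K 0 F) (chain θ σ f) := by
  intro l hl hlen d hd
  have S := hl.stackInv
  have H := inv_run z l
  have hV : 0 < Fintype.card V := Fintype.card_pos_iff.2 ⟨z⟩
  have hN : (0 : ℝ) < Fintype.card V := by exact_mod_cast hV
  have hε : (0 : ℝ) ≤ L / Fintype.card V := by positivity
  have hε1 : (L : ℝ) / Fintype.card V ≤ 1 := by
    rw [div_le_one hN]; exact_mod_cast hLN
  have hvis : ((init z).run l).vis.card ≤ L := H.card_vis.trans (by omega)
  set h := (init z).run l with hh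
  have key : ∀ s, ¬ h.Defect s → ∀ d', (stackStep (stack z l) s).length = d' + 1 →
      a * f d' ≤ F (h.next s) ∧ F (h.next s) ≤ f d' := by
    intro s hs d' hd'
    have := hF (l ++ [s]) (good_append.2 ⟨hl, hs, trivial⟩) (by simp; omega) d'
      (by rw [stack_snoc, hd'])
    rwa [run_snoc] at this
  have hpush : ∀ y ∉ h.vis, a * f (d + 1) ≤ F (h.stepW y) ∧ F (h.stepW y) ≤ f (d + 1) := by
    intro y hy
    have hs : ¬ h.Defect (false, y) := by simp [Defect, hy]
    refine key (false, y) hs (d + 1) ?_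
    rcases S.cases hs with ⟨-, -, h3⟩ | ⟨st', -, h3, -⟩ | ⟨h3, -⟩
    · rw [h3]; simp [hd]
    · exact absurd (S.sub y (by rw [h3]; simp)) hy
    · simp at h3
  rw [WalkState.opM, sum_wA_zero S]
  have hW := sum_wW_zero (σ := σ) (K := K) S H F
  rw [opW] at hW
  rw [hW]
  have b1 := sum_new_bounds hV hvis (hf (d + 1)) ha zero_le_one hpush
  rw [one_mul] at b1
  unfold chain
  cases d with
  | zero =>
    obtain ⟨x, hx⟩ := List.length_eq_one_iff.1 hd
    have hjump : ∀ y ∉ h.vis, a * f 0 ≤ F (h.stepA y) ∧ F (h.stepA y) ≤ f 0 := by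
      intro y hy
      have hdeg : Odd (h.deg h.pos) := by
        rw [hx] at S
        rw [S.deg_pos_of_singleton]; decide
      have hs : ¬ h.Defect (true, y) := by simp [Defect, hy, hdeg]
      exact key (true, y) hs 0 (by simp [stackStep])
    have b2 := sum_new_bounds hV hvis (hf 0) ha hθ hjump
    rw [if_pos hd, if_pos rfl, hx]
    simp only [add_zero, List.tail_cons, List.head?_nil, Option.elim_none]
    constructor
    · rw [mul_add]; linarith [b1.1, b2.1]
    · linarith [b1.2, b2.2]
  | succ d =>
    rw [if_neg (by omega), if_neg (by omega), Nat.add_sub_cancel]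
    obtain ⟨st', hst'⟩ := S.head
    rw [hst'] at hd
    obtain ⟨y, st'', hy⟩ : ∃ y st'', st' = y :: st'' := by
      cases st' with
      | nil => simp at hd
      | cons y st'' => exact ⟨y, st'', rfl⟩
    subst hy
    have hs : ¬ h.Defect (false, y) := by
      have h2 : Odd (h.cnt s(h.pos, y)) := by
        rw [S.odd_iff, hst']
        rw [hst'] at S
        exact (mem_stackEdges_head (List.nodup_cons.1 S.nodup).1).2 rfl
      simp [Defect, h2]
    have b2 := key (false, y) hs d (by rw [hst', stackStep]; simp at hd ⊢; omega)
    have hnx : h.next (false, y) = h.stepW y := rfl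
    rw [hnx] at b2
    rw [hst']
    simp only [zero_add, List.tail_cons, List.head?_cons, Option.elim_some]
    have hσ := sq_nonneg σ
    constructor
    · rw [mul_add]
      refine add_le_add b1.1 ?_
      calc a * (1 - L / Fintype.card V) * (σ ^ 2 * f d)
          = (σ ^ 2 * (a * f d)) * (1 - L / Fintype.card V) := by ring
        _ ≤ (σ ^ 2 * (a * f d)) * 1 := by
            have := hf d
            gcongr
            linarith
        _ ≤ σ ^ 2 * F (h.stepW y) := by
            rw [mul_one]
            exact mul_le_mul_of_nonneg_left b2.1 hσ
    · exact add_le_add b1.2 (mul_le_mul_of_nonneg_left b2.2 hσ)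

lemma iterate_chain_nonneg {θ σ : ℝ} (hθ : 0 ≤ θ) {f : ℕ → ℝ} (hf : ∀ d, 0 ≤ f d) (n d : ℕ) :
    0 ≤ (chain θ σ)^[n] f d := by
  induction n generalizing d with
  | zero => exact hf d
  | succ n ih => rw [Function.iterate_succ_apply']; exact chain_nonneg hθ ih d

lemma Comparable.iterate_opM {z : V} {L m : ℕ} {a θ σ K : ℝ} {F : WalkState V → ℝ} {f : ℕ → ℝ}
    (hF : Comparable z L m a F f) (hf : ∀ d, 0 ≤ f d) (ha : 0 ≤ a) (hθ : 0 ≤ θ)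
    (hLN : L ≤ Fintype.card V) (n : ℕ) :
    Comparable z L (m + n) (a * (1 - L / Fintype.card V) ^ n) ((WalkState.opM θ σ K 0)^[n] F)
      ((chain θ σ)^[n] f) := by
  have hε : (0 : ℝ) ≤ 1 - L / Fintype.card V := by
    have hV : 0 < Fintype.card V := Fintype.card_pos_iff.2 ⟨z⟩
    have hN : (0 : ℝ) < Fintype.card V := by exact_mod_cast hV
    rw [sub_nonneg, div_le_one hN]
    exact_mod_cast hLN
  induction n with
  | zero => simpa using hF
  | succ n ih =>
    rw [Function.iterate_succ_apply', Function.iterate_succ_apply', pow_succ, ← mul_assoc]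
    exact ih.opM (iterate_chain_nonneg hθ hf n) (by positivity) hθ hLN

/-- The total chain weight of `r` steps without staying, up to a positive depth, followed by `n`
steps to depth zero. -/
noncomputable def chainWeight (θ σ : ℝ) (r n : ℕ) : ℝ :=
  (chain 0 σ)^[r] (fun d => if d = 0 then 0 else
    (chain θ σ)^[n] (fun d => if d = 0 then 1 else 0) d) 0

/-- For runs without defects, "no open edge" means depth 0, so the constraint between the two phases
and the final one are both functions of the depth. The first phase is the chain with θ = 0. -/
lemma chainWeight_bounds {θ σ K : ℝ} {L r n : ℕ} (hθ : 0 ≤ θ) (hLN : L ≤ Fintype.card V)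
    (hrn : r + n ≤ L) (z : V) :
    (1 - L / Fintype.card V) ^ (r + n) * chainWeight θ σ r n
        ≤ (opW σ K 0)^[r] (fun h => if h.opn = 0 then 0 else (WalkState.opM θ σ K 0)^[n] closed h) (init z) ∧
      (opW σ K 0)^[r] (fun h => if h.opn = 0 then 0 else (WalkState.opM θ σ K 0)^[n] closed h) (init z)
        ≤ chainWeight θ σ r n := by
  have hε : (0 : ℝ) ≤ 1 - L / Fintype.card V := by
    have hV : 0 < Fintype.card V := Fintype.card_pos_iff.2 ⟨z⟩
    have hN : (0 : ℝ) < Fintype.card V := by exact_mod_cast hV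
    rw [sub_nonneg, div_le_one hN]
    exact_mod_cast hLN
  have f0 : ∀ d : ℕ, (0 : ℝ) ≤ if d = 0 then 1 else 0 := fun d => by split_ifs <;> simp
  have c0 : Comparable z L 0 1 closed (fun d => if d = 0 then 1 else 0) := by
    intro l hl _ d hd
    have := hl.stackInv.opn_eq_zero_iff
    simp only [closed, this, hd, Nat.add_eq_right, one_mul, le_refl, and_self]
  have c1 := c0.iterate_opM (σ := σ) (K := K) f0 zero_le_one hθ hLN n
  rw [one_mul, zero_add] at c1
  have c2 : Comparable z L n ((1 - L / Fintype.card V) ^ n)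
      (fun h => if h.opn = 0 then 0 else (WalkState.opM θ σ K 0)^[n] closed h)
      (fun d => if d = 0 then 0 else (chain θ σ)^[n] (fun d => if d = 0 then 1 else 0) d) := by
    intro l hl hlen d hd
    have h1 := hl.stackInv.opn_eq_zero_iff
    have h2 := c1 l hl hlen d hd
    simp only [h1, hd, Nat.add_eq_right]
    split_ifs
    · simp
    · exact h2
  have f1 : ∀ d : ℕ, (0 : ℝ) ≤ if d = 0 then 0 else
      (chain θ σ)^[n] (fun d => if d = 0 then 1 else 0) d := by
    intro d
    split_ifs
    · exact le_rfl
    · exact iterate_chain_nonneg hθ f0 n d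
  have c3 := c2.iterate_opM (θ := 0) (σ := σ) (K := K) f1 (by positivity) le_rfl hLN r
  rw [← pow_add, opM_zero] at c3
  have := c3 [] trivial (by simp; omega) 0 rfl
  rw [add_comm n r] at this
  exact this

end WalkState

namespace WalkState

/-! ### Asymptotics of the chain of depths -/

section ChainAsymptotics

variable {θ σ : ℝ}

/-- The normalized chain: a birth and death chain, lazy at `0`. -/
noncomputable def birthDeath (u v : ℝ) (f : ℕ → ℝ) (d : ℕ) : ℝ := u * f (d + 1) + v * f (d - 1)

/-- The indicator of `0`. -/
def deltaZero (d : ℕ) : ℝ := if d = 0 then 1 else 0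

lemma rho_pos (hσ : 0 < σ) (hθ : σ < θ) : 0 < rho θ σ := by
  unfold rho
  have : 0 < θ := hσ.trans hθ
  positivity

lemma two_mul_lt_rho (hσ : 0 < σ) (hθ : σ < θ) : 2 * σ < rho θ σ := by
  unfold rho
  have h0 : 0 < θ := hσ.trans hθ
  have : 0 < (θ - σ) ^ 2 / θ := by
    have : 0 < θ - σ := by linarith
    positivity
  have h2 : (θ - σ) ^ 2 / θ = θ + σ ^ 2 / θ - 2 * σ := by field_simp; ring
  linarith

/-- The function (σ²/θ)^d is an eigenfunction of the chain for the eigenvalue ρ_θ, so this is a Doob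
transform. The truncated subtraction 0 - 1 = 0 in `birthDeath` encodes the staying at 0. -/
lemma iterate_chain_eq (hσ : 0 < σ) (hθ : σ < θ) (n d : ℕ) :
    (chain θ σ)^[n] deltaZero d = rho θ σ ^ n * (σ ^ 2 / θ) ^ d *
      (birthDeath (σ ^ 2 / θ / rho θ σ) (θ / rho θ σ))^[n] deltaZero d := by
  have h0 : 0 < θ := hσ.trans hθ
  have hρ := rho_pos hσ hθ
  induction n generalizing d with
  | zero => by_cases h : d = 0 <;> simp [deltaZero, h]
  | succ n ih =>
    rw [Function.iterate_succ_apply', Function.iterate_succ_apply', chain, birthDeath]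
    generalize (birthDeath (σ ^ 2 / θ / rho θ σ) (θ / rho θ σ))^[n] deltaZero = B at *
    cases d with
    | zero =>
      simp only [if_true, ih, pow_succ, pow_zero, Nat.zero_sub]
      field_simp
    | succ d =>
      simp only [Nat.add_eq_zero_iff, one_ne_zero, and_false, if_false, ih, Nat.add_sub_cancel,
        pow_succ]
      field_simp

/-! ### #### Convergence of the birth and death chain -/

section BirthDeath

variable {u v s : ℝ}

/-- The differences in d evolve by the same chain, killed instead of staying at 0. Away from 0 the
function s^d has eigenvalue us + v/s, and it dominates the initial difference. -/
lemma birthDeath_diff (hu : 0 ≤ u) (hv : 0 ≤ v) (hs : 0 < s) (n d : ℕ) :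
    0 ≤ (birthDeath u v)^[n] deltaZero d - (birthDeath u v)^[n] deltaZero (d + 1) ∧
      (birthDeath u v)^[n] deltaZero d - (birthDeath u v)^[n] deltaZero (d + 1)
        ≤ (u * s + v / s) ^ n * s ^ d := by
  induction n generalizing d with
  | zero =>
    by_cases h : d = 0
    · simp [deltaZero, h]
    · simp only [Function.iterate_zero, id_eq, deltaZero, h, if_false, Nat.add_eq_zero_iff,
        one_ne_zero, and_false, sub_zero, le_refl, true_and, pow_zero, one_mul]
      positivity
  | succ n ih =>
    rw [Function.iterate_succ_apply', birthDeath, birthDeath]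
    set p := (birthDeath u v)^[n] deltaZero with hp
    cases d with
    | zero =>
      have h1 := ih 1
      simp only [zero_add, Nat.zero_sub, Nat.sub_self, pow_one, pow_zero, mul_one] at h1 ⊢
      have h2 : u * p 1 + v * p 0 - (u * p (1 + 1) + v * p 0) = u * (p 1 - p (1 + 1)) := by ring
      rw [h2]
      refine ⟨mul_nonneg hu h1.1, (mul_le_mul_of_nonneg_left h1.2 hu).trans ?_⟩
      rw [pow_succ]
      have h3 : 0 ≤ (u * s + v / s) ^ n := by positivity
      have h4 : 0 ≤ v / s := by positivity
      nlinarith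
    | succ d =>
      have h1 := ih (d + 2)
      have h2 := ih d
      simp only [Nat.add_sub_cancel] at h1 h2 ⊢
      have h3 : u * p (d + 1 + 1) + v * p d - (u * p (d + 1 + 1 + 1) + v * p (d + 1))
        = u * (p (d + 2) - p (d + 2 + 1)) + v * (p d - p (d + 1)) := by ring_nf
      rw [h3]
      refine ⟨add_nonneg (mul_nonneg hu h1.1) (mul_nonneg hv h2.1),
        (add_le_add (mul_le_mul_of_nonneg_left h1.2 hu)
          (mul_le_mul_of_nonneg_left h2.2 hv)).trans (le_of_eq ?_)⟩
      rw [pow_succ (u * s + v / s) n]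
      generalize (u * s + v / s) ^ n = A
      have e : v / s * s = v := div_mul_cancel₀ v hs.ne'
      calc _ = A * s ^ d * (u * s ^ 2 + v) := by ring
        _ = A * s ^ d * (u * s ^ 2 + v / s * s) := by rw [e]
        _ = _ := by ring

lemma birthDeath_zero_sub (hu : 0 ≤ u) (hv : 0 ≤ v) (hs : 1 ≤ s) (n d : ℕ) :
    0 ≤ (birthDeath u v)^[n] deltaZero 0 - (birthDeath u v)^[n] deltaZero d ∧
      (birthDeath u v)^[n] deltaZero 0 - (birthDeath u v)^[n] deltaZero d
        ≤ d * s ^ d * (u * s + v / s) ^ n := by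
  induction d with
  | zero => simp
  | succ d ih =>
    have h1 := birthDeath_diff hu hv (by linarith : 0 < s) n d
    have h2 : 0 ≤ (u * s + v / s) ^ n := by positivity
    have h3 : s ^ d ≤ s ^ (d + 1) := pow_le_pow_right₀ hs (Nat.le_succ d)
    refine ⟨by linarith [ih.1], ?_⟩
    push_cast
    have h4 : (d : ℝ) * s ^ d * (u * s + v / s) ^ n ≤ d * s ^ (d + 1) * (u * s + v / s) ^ n := by
      gcongr
    have h5 : (u * s + v / s) ^ n * s ^ d ≤ (u * s + v / s) ^ n * s ^ (d + 1) := by gcongr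
    have : ((d : ℝ) + 1) * s ^ (d + 1) * (u * s + v / s) ^ n
      = d * s ^ (d + 1) * (u * s + v / s) ^ n + (u * s + v / s) ^ n * s ^ (d + 1) := by ring
    linarith [ih.2]

/-- The measure x^d is invariant, so the integral of the indicator of 0 against it is preserved by
the chain. -/
lemma birthDeath_hasSum {x : ℝ} (hx : u = x * v) (huv : u + v = 1) (n : ℕ) :
    HasSum (fun d => x ^ d * (birthDeath u v)^[n] deltaZero d) 1 := by
  induction n with
  | zero =>
    have : (fun d => x ^ d * (birthDeath u v)^[0] deltaZero d) = fun d => if d = 0 then 1 else 0 := by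
      ext d
      by_cases h : d = 0 <;> simp [deltaZero, h]
    rw [this]
    exact hasSum_ite_eq 0 1
  | succ n ih =>
    simp only [Function.iterate_succ_apply']
    set p := (birthDeath u v)^[n] deltaZero with hp
    have h1 : HasSum (fun d => x ^ (d + 1) * p (d + 1)) (1 - p 0) := by
      have := (hasSum_nat_add_iff' 1).2 ih
      simpa using this
    have h2 : HasSum (fun d => x ^ d * (v * p (d - 1))) (u * 1 + v * p 0) := by
      have h3 : HasSum (fun d => x ^ (d + 1) * (v * p (d + 1 - 1))) (u * 1) := by
        have := ih.mul_left u
        have e : (fun d => x ^ (d + 1) * (v * p (d + 1 - 1))) = fun d => u * (x ^ d * p d) :=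
          funext fun d => by rw [Nat.add_sub_cancel, hx, pow_succ]; ring
        rwa [e]
      have := (hasSum_nat_add_iff (f := fun d => x ^ d * (v * p (d - 1))) 1).1 h3
      simpa using this
    have h4 := (h1.mul_left v).add h2
    have h5 : v * (1 - p 0) + (u * 1 + v * p 0) = 1 := by linarith
    rw [h5] at h4
    have e : (fun d => x ^ d * birthDeath u v p d)
        = fun d => v * (x ^ (d + 1) * p (d + 1)) + x ^ d * (v * p (d - 1)) :=
      funext fun d => by rw [birthDeath, hx, pow_succ]; ring
    rwa [e]

/-- The invariant average of the iterate is 1 - x, and the iterate varies in d only by the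
exponentially small differences. The condition xs < 1 makes these summable against x^d. -/
lemma birthDeath_sub_le {x : ℝ} (hx : u = x * v) (huv : u + v = 1) (hu : 0 ≤ u) (hv : 0 ≤ v)
    (hs : 1 ≤ s) (hx0 : 0 ≤ x) (hxs : x * s < 1) : ∃ C : ℝ, 0 ≤ C ∧ ∀ n d : ℕ,
      |(birthDeath u v)^[n] deltaZero d - (1 - x)| ≤ C * ((d + 1) * s ^ d * (u * s + v / s) ^ n) := by
  have hxs0 : 0 ≤ x * s := by positivity
  have hx1 : x < 1 := by nlinarith
  have hsum : Summable fun d : ℕ => (d : ℝ) * (x * s) ^ d := by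
    have := summable_pow_mul_geometric_of_norm_lt_one 1 (r := x * s)
      (by rwa [Real.norm_of_nonneg hxs0])
    simpa using this
  set c := ∑' d : ℕ, (d : ℝ) * (x * s) ^ d with hc
  have hc0 : 0 ≤ c := tsum_nonneg fun d => by positivity
  refine ⟨c + 1, by linarith, fun n d => ?_⟩
  have hlam : 0 ≤ (u * s + v / s) ^ n := by
    have : 0 < s := by linarith
    positivity
  have h1 : HasSum (fun d => x ^ d * ((birthDeath u v)^[n] deltaZero 0
      - (birthDeath u v)^[n] deltaZero d))
      ((1 - x)⁻¹ * (birthDeath u v)^[n] deltaZero 0 - 1) := by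
    have := ((hasSum_geometric_of_lt_one hx0 hx1).mul_right
      ((birthDeath u v)^[n] deltaZero 0)).sub (birthDeath_hasSum hx huv n)
    have e : (fun d => x ^ d * ((birthDeath u v)^[n] deltaZero 0
        - (birthDeath u v)^[n] deltaZero d)) = fun d => x ^ d * (birthDeath u v)^[n] deltaZero 0
        - x ^ d * (birthDeath u v)^[n] deltaZero d := funext fun d => by ring
    rwa [e]
  have h2 : (1 - x)⁻¹ * (birthDeath u v)^[n] deltaZero 0 - 1 ≤ c * (u * s + v / s) ^ n := by
    refine hasSum_le (fun d => ?_) h1 (hsum.hasSum.mul_right _)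
    refine (mul_le_mul_of_nonneg_left (birthDeath_zero_sub hu hv hs n d).2
      (pow_nonneg hx0 d)).trans (le_of_eq ?_)
    rw [mul_pow]; ring
  have h3 : 0 ≤ (1 - x)⁻¹ * (birthDeath u v)^[n] deltaZero 0 - 1 :=
    h1.nonneg fun d => mul_nonneg (pow_nonneg hx0 d) (birthDeath_zero_sub hu hv hs n d).1
  have h4 : (birthDeath u v)^[n] deltaZero 0 - (1 - x)
      = (1 - x) * ((1 - x)⁻¹ * (birthDeath u v)^[n] deltaZero 0 - 1) := by
    have : 1 - x ≠ 0 := by linarith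
    field_simp
  have h5 := birthDeath_zero_sub hu hv hs n d
  have h6 : |(birthDeath u v)^[n] deltaZero 0 - (1 - x)| ≤ c * (u * s + v / s) ^ n := by
    rw [h4, abs_of_nonneg (mul_nonneg (by linarith) h3)]
    nlinarith
  have hsd : 1 ≤ s ^ d := one_le_pow₀ hs
  calc |(birthDeath u v)^[n] deltaZero d - (1 - x)|
      = |((birthDeath u v)^[n] deltaZero 0 - (1 - x)) -
          ((birthDeath u v)^[n] deltaZero 0 - (birthDeath u v)^[n] deltaZero d)| := by
        congr 1; ring
    _ ≤ c * (u * s + v / s) ^ n + d * s ^ d * (u * s + v / s) ^ n := by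
        refine (abs_sub _ _).trans (add_le_add h6 ?_)
        rw [abs_of_nonneg h5.1]
        exact h5.2
    _ = (c + d * s ^ d) * (u * s + v / s) ^ n := by ring
    _ ≤ ((c + 1) * ((d + 1) * s ^ d)) * (u * s + v / s) ^ n := by
        refine mul_le_mul_of_nonneg_right ?_ hlam
        have hd : (0 : ℝ) ≤ d := by positivity
        have e1 : 0 ≤ c * (d * s ^ d) := by positivity
        have e2 : c * 1 ≤ c * s ^ d := mul_le_mul_of_nonneg_left hsd hc0
        nlinarith
    _ = _ := by ring

end BirthDeath

/-- The chain without staying, as a linear map. -/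
def killedChain (σ : ℝ) : (ℕ → ℝ) →ₗ[ℝ] (ℕ → ℝ) where
  toFun := chain 0 σ
  map_add' f g := by
    ext d
    simp only [chain, Pi.add_apply]
    split_ifs <;> ring
  map_smul' c f := by
    ext d
    simp only [chain, Pi.smul_apply, smul_eq_mul, RingHom.id_apply]
    split_ifs <;> ring

/-- The function (d + 1)σ^d is an eigenfunction of the killed chain with eigenvalue 2σ. -/
lemma abs_killedChain_pow_le {c : ℝ} {f : ℕ → ℝ}
    (hf : ∀ d : ℕ, |f d| ≤ c * ((d + 1) * σ ^ d)) (r d : ℕ) :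
    |(killedChain σ ^ r) f d| ≤ c * (2 * σ) ^ r * ((d + 1) * σ ^ d) := by
  have hc : 0 ≤ c := by
    have := (abs_nonneg _).trans (hf 0)
    simpa using this
  induction r generalizing d with
  | zero => simpa using hf d
  | succ r ih =>
    rw [pow_succ', Module.End.mul_apply]
    set g := (killedChain σ ^ r) f
    have h1 : killedChain σ g d = g (d + 1) + if d = 0 then 0 else σ ^ 2 * g (d - 1) := by
      change chain 0 σ g d = _
      simp [chain]
    rw [h1]
    have h2 := ih (d + 1)
    cases d with
    | zero =>
      simp only [if_true, add_zero]
      refine h2.trans (le_of_eq ?_)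
      push_cast
      ring
    | succ d =>
      have h3 := ih d
      simp only [Nat.add_eq_zero_iff, one_ne_zero, and_false, if_false, Nat.add_sub_cancel]
      refine (abs_add_le _ _).trans ?_
      rw [abs_mul, abs_of_nonneg (sq_nonneg σ)]
      refine (add_le_add h2 (mul_le_mul_of_nonneg_left h3 (sq_nonneg σ))).trans (le_of_eq ?_)
      push_cast
      ring

/-- The profile `q ^ d` on positive depths. -/
noncomputable def posProfile (θ σ : ℝ) (d : ℕ) : ℝ := if d = 0 then 0 else (σ ^ 2 / θ) ^ d

/-- The solution of the resolvent equation for `posProfile`. -/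
noncomputable def resolventProfile (θ σ : ℝ) (d : ℕ) : ℝ :=
  (σ ^ 2 / θ) ^ d * (rho θ σ * σ ^ 2 / (θ * (θ ^ 2 - σ ^ 2))
    + rho θ σ * θ / (θ ^ 2 - σ ^ 2) * d)

/-- At depths d ≥ 1, (σ²/θ)^d already solves the homogeneous equation with eigenvalue ρ_θ. This
resonance forces the term linear in d, and the equation at d = 0 fixes the constant. -/
lemma posProfile_eq (hσ : 0 < σ) (hθ : σ < θ) :
    posProfile θ σ = resolventProfile θ σ
      - (rho θ σ)⁻¹ • killedChain σ (resolventProfile θ σ) := by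
  have h0 : 0 < θ := hσ.trans hθ
  have hρ := rho_pos hσ hθ
  have hD : θ ^ 2 - σ ^ 2 ≠ 0 := by nlinarith
  ext d
  change _ = resolventProfile θ σ d - (rho θ σ)⁻¹ * chain 0 σ (resolventProfile θ σ) d
  cases d with
  | zero =>
    simp only [posProfile, chain, resolventProfile, if_true]
    push_cast
    field_simp
    unfold rho
    field_simp
    ring
  | succ d =>
    simp only [posProfile, chain, resolventProfile, Nat.add_eq_zero_iff, one_ne_zero, and_false,
      if_false, Nat.add_sub_cancel, pow_succ]
    push_cast
    field_simp
    unfold rho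
    field_simp
    ring

lemma sum_killedChain_posProfile (hσ : 0 < σ) (hθ : σ < θ) (L : ℕ) :
    ∑ r ∈ Finset.range L, (rho θ σ)⁻¹ ^ r * (killedChain σ ^ r) (posProfile θ σ) 0
      = resolventProfile θ σ 0 - (rho θ σ)⁻¹ ^ L * (killedChain σ ^ L) (resolventProfile θ σ) 0 := by
  have h : ∀ r, (rho θ σ)⁻¹ ^ r * (killedChain σ ^ r) (posProfile θ σ) 0
      = (rho θ σ)⁻¹ ^ r * (killedChain σ ^ r) (resolventProfile θ σ) 0
        - (rho θ σ)⁻¹ ^ (r + 1) * (killedChain σ ^ (r + 1)) (resolventProfile θ σ) 0 := by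
    intro r
    rw [posProfile_eq hσ hθ, map_sub, map_smul, pow_succ (killedChain σ), Module.End.mul_apply]
    simp only [Pi.sub_apply, Pi.smul_apply, smul_eq_mul]
    ring
  rw [Finset.sum_congr rfl fun r _ => h r, Finset.sum_range_sub']
  simp

/-- With s = θ/σ the chain converges at rate 2σ/ρ_θ, and the factors (σ²/θ)^d s^d combine to σ^d.
The error after n steps is thus at most a constant times (2σ)^n (d + 1)σ^d, which the killed chain
multiplies by 2σ at each step. -/
lemma exists_chainWeight_sub_le (hσ : 0 < σ) (hθ : σ < θ) : ∃ C : ℝ, 0 ≤ C ∧ ∀ r n : ℕ,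
    |chainWeight θ σ r n - (1 - σ ^ 2 / θ ^ 2) * rho θ σ ^ n *
      (killedChain σ ^ r) (posProfile θ σ) 0| ≤ C * (2 * σ) ^ (r + n) := by
  have h0 : 0 < θ := hσ.trans hθ
  have hρ := rho_pos hσ hθ
  obtain ⟨C, hC, hCb⟩ := birthDeath_sub_le (u := σ ^ 2 / θ / rho θ σ) (v := θ / rho θ σ)
    (s := θ / σ) (x := σ ^ 2 / θ ^ 2) (by field_simp)
    (by rw [← add_div, div_eq_one_iff_eq hρ.ne']; unfold rho; ring)
    (by positivity) (by positivity) (by rw [one_le_div hσ]; exact hθ.le) (by positivity)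
    (by
      have : σ ^ 2 / θ ^ 2 * (θ / σ) = σ / θ := by field_simp
      rw [this, div_lt_one h0]; exact hθ)
  refine ⟨C, hC, fun r n => ?_⟩
  have hlam : σ ^ 2 / θ / rho θ σ * (θ / σ) + θ / rho θ σ / (θ / σ) = 2 * σ / rho θ σ := by
    field_simp
    ring
  rw [hlam] at hCb
  set F : ℕ → ℝ := fun d => if d = 0 then 0 else (chain θ σ)^[n] deltaZero d with hF
  have h1 : chainWeight θ σ r n = (killedChain σ ^ r) F 0 := by
    rw [Module.End.pow_apply]; rfl
  set E : ℕ → ℝ := F - ((1 - σ ^ 2 / θ ^ 2) * rho θ σ ^ n) • posProfile θ σ with hE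
  have hEb : ∀ d : ℕ, |E d| ≤ C * (2 * σ) ^ n * ((d + 1) * σ ^ d) := by
    intro d
    simp only [hE, hF, Pi.sub_apply, Pi.smul_apply, smul_eq_mul, posProfile]
    split_ifs with hd
    · simp only [mul_zero, sub_zero, abs_zero]
      positivity
    · rw [iterate_chain_eq hσ hθ]
      have e1 : ∀ p : ℝ, rho θ σ ^ n * (σ ^ 2 / θ) ^ d * p - (1 - σ ^ 2 / θ ^ 2) * rho θ σ ^ n *
          (σ ^ 2 / θ) ^ d = rho θ σ ^ n * (σ ^ 2 / θ) ^ d * (p - (1 - σ ^ 2 / θ ^ 2)) := by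
        intro p; ring
      rw [e1, abs_mul, abs_of_nonneg (by positivity)]
      refine (mul_le_mul_of_nonneg_left (hCb n d) (by positivity)).trans (le_of_eq ?_)
      have e2 : σ ^ d = (σ ^ 2 / θ) ^ d * (θ / σ) ^ d := by
        rw [← mul_pow]; congr 1; field_simp
      rw [e2, div_pow (2 * σ)]
      field_simp
  have h2 : chainWeight θ σ r n - (1 - σ ^ 2 / θ ^ 2) * rho θ σ ^ n *
      (killedChain σ ^ r) (posProfile θ σ) 0 = (killedChain σ ^ r) E 0 := by
    rw [h1, hE, map_sub, map_smul]
    rfl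
  rw [h2]
  have := abs_killedChain_pow_le hEb r 0
  refine this.trans (le_of_eq ?_)
  rw [pow_add]
  simp
  ring

/-- The total weight of the chains that stay at least once and start at positive depth. -/
lemma tendsto_sum_chainWeight (hσ : 0 < σ) (hθ : σ < θ) :
    Tendsto (fun L : ℕ => θ * (∑ r ∈ Finset.range L, chainWeight θ σ r (L - 1 - r)) /
      rho θ σ ^ L) atTop (𝓝 (σ ^ 2 / θ ^ 2)) := by
  have h0 : 0 < θ := hσ.trans hθ
  have hρ := rho_pos hσ hθ
  have h2σ := two_mul_lt_rho hσ hθ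
  have hD : 0 < θ ^ 2 - σ ^ 2 := by nlinarith
  obtain ⟨C, hC, hCb⟩ := exists_chainWeight_sub_le hσ hθ
  set lam := 2 * σ / rho θ σ with hlam
  have hlam0 : 0 ≤ lam := by positivity
  have hlam1 : lam < 1 := by rw [hlam, div_lt_one hρ]; exact h2σ
  -- the main part
  have hmain : Tendsto (fun L : ℕ => ∑ r ∈ Finset.range L, (rho θ σ)⁻¹ ^ r *
      (killedChain σ ^ r) (posProfile θ σ) 0) atTop (𝓝 (resolventProfile θ σ 0)) := by
    simp only [sum_killedChain_posProfile hσ hθ]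
    have hbd : ∀ d : ℕ, |resolventProfile θ σ d|
        ≤ (rho θ σ * σ ^ 2 / (θ * (θ ^ 2 - σ ^ 2)) + rho θ σ * θ / (θ ^ 2 - σ ^ 2)) *
          ((d + 1) * σ ^ d) := by
      intro d
      have hq : (σ ^ 2 / θ) ^ d ≤ σ ^ d := by
        refine pow_le_pow_left₀ (by positivity) ?_ d
        rw [div_le_iff₀ h0]; nlinarith
      unfold resolventProfile
      rw [abs_of_nonneg (by positivity)]
      have hd : (0 : ℝ) ≤ d := by positivity
      have a0 : 0 ≤ rho θ σ * σ ^ 2 / (θ * (θ ^ 2 - σ ^ 2)) := by positivity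
      have b0 : 0 ≤ rho θ σ * θ / (θ ^ 2 - σ ^ 2) := by positivity
      calc _ ≤ σ ^ d * (rho θ σ * σ ^ 2 / (θ * (θ ^ 2 - σ ^ 2))
            + rho θ σ * θ / (θ ^ 2 - σ ^ 2) * d) := by gcongr
        _ ≤ σ ^ d * ((rho θ σ * σ ^ 2 / (θ * (θ ^ 2 - σ ^ 2))
            + rho θ σ * θ / (θ ^ 2 - σ ^ 2)) * (d + 1)) := by
            gcongr
            nlinarith
        _ = _ := by ring
    have hz : Tendsto (fun L : ℕ => (rho θ σ)⁻¹ ^ L *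
        (killedChain σ ^ L) (resolventProfile θ σ) 0) atTop (𝓝 0) := by
      set c := rho θ σ * σ ^ 2 / (θ * (θ ^ 2 - σ ^ 2)) + rho θ σ * θ / (θ ^ 2 - σ ^ 2)
      refine squeeze_zero_norm (a := fun L : ℕ => c * lam ^ L) (fun L => ?_) ?_
      · have := abs_killedChain_pow_le hbd L 0
        rw [Real.norm_eq_abs, abs_mul, abs_of_nonneg (by positivity)]
        refine (mul_le_mul_of_nonneg_left this (by positivity)).trans (le_of_eq ?_)
        rw [hlam, div_pow, inv_pow]
        simp
        field_simp
      · simpa using (tendsto_pow_atTop_nhds_zero_of_lt_one hlam0 hlam1).const_mul c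
    simpa using (tendsto_const_nhds (x := resolventProfile θ σ 0)).sub hz
  have hmain' := hmain.const_mul (θ / rho θ σ * (1 - σ ^ 2 / θ ^ 2))
  -- The factors are one jump at rate θ/ρ_θ, the stationary mass of 0, and the resolvent of the
  -- initial random stretch.
  have hlim : θ / rho θ σ * (1 - σ ^ 2 / θ ^ 2) * resolventProfile θ σ 0 = σ ^ 2 / θ ^ 2 := by
    have : θ ^ 2 - σ ^ 2 ≠ 0 := hD.ne'
    unfold resolventProfile
    field_simp
    simp
  rw [hlim] at hmain'
  -- the error
  have herr : Tendsto (fun L : ℕ => θ * C / (2 * σ) * ((L : ℝ) * lam ^ L)) atTop (𝓝 0) := by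
    have := tendsto_self_mul_const_pow_of_lt_one hlam0 hlam1
    simpa using this.const_mul (θ * C / (2 * σ))
  refine tendsto_of_tendsto_of_dist hmain' (squeeze_zero_norm (fun L => ?_) herr)
  rw [Real.norm_of_nonneg dist_nonneg, Real.dist_eq, abs_sub_comm]
  have key : θ * (∑ r ∈ Finset.range L, chainWeight θ σ r (L - 1 - r)) / rho θ σ ^ L
      - θ / rho θ σ * (1 - σ ^ 2 / θ ^ 2) * ∑ r ∈ Finset.range L, (rho θ σ)⁻¹ ^ r *
        (killedChain σ ^ r) (posProfile θ σ) 0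
      = θ / rho θ σ ^ L * ∑ r ∈ Finset.range L, (chainWeight θ σ r (L - 1 - r)
        - (1 - σ ^ 2 / θ ^ 2) * rho θ σ ^ (L - 1 - r) *
          (killedChain σ ^ r) (posProfile θ σ) 0) := by
    have e0 : θ / rho θ σ * (1 - σ ^ 2 / θ ^ 2) * ∑ r ∈ Finset.range L, (rho θ σ)⁻¹ ^ r *
          (killedChain σ ^ r) (posProfile θ σ) 0
        = θ / rho θ σ ^ L * ∑ r ∈ Finset.range L, (1 - σ ^ 2 / θ ^ 2) *
          rho θ σ ^ (L - 1 - r) * (killedChain σ ^ r) (posProfile θ σ) 0 := by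
      rw [Finset.mul_sum, Finset.mul_sum]
      refine Finset.sum_congr rfl fun r hr => ?_
      have hr' := Finset.mem_range.1 hr
      have e : rho θ σ ^ L = rho θ σ ^ (L - 1 - r) * rho θ σ ^ r * rho θ σ := by
        rw [← pow_add, ← pow_succ]; congr 1; omega
      rw [e, inv_pow]
      generalize (killedChain σ ^ r) (posProfile θ σ) 0 = y
      field_simp
    rw [e0, Finset.sum_sub_distrib]
    ring
  -- Each of the L terms has error of order (2σ)^(L-1), negligible against ρ_θ^L.
  rw [key, abs_mul, abs_of_nonneg (by positivity)]
  have hs : |∑ r ∈ Finset.range L, (chainWeight θ σ r (L - 1 - r)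
        - (1 - σ ^ 2 / θ ^ 2) * rho θ σ ^ (L - 1 - r) *
          (killedChain σ ^ r) (posProfile θ σ) 0)| ≤ L * (C * (2 * σ) ^ L / (2 * σ)) := by
    refine (Finset.abs_sum_le_sum_abs _ _).trans ?_
    have : ∀ r ∈ Finset.range L, |chainWeight θ σ r (L - 1 - r)
        - (1 - σ ^ 2 / θ ^ 2) * rho θ σ ^ (L - 1 - r) *
          (killedChain σ ^ r) (posProfile θ σ) 0| ≤ C * (2 * σ) ^ L / (2 * σ) := by
      intro r hr
      have hr' := Finset.mem_range.1 hr
      refine (hCb r (L - 1 - r)).trans (le_of_eq ?_)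
      have e : (2 * σ) ^ L = (2 * σ) ^ (r + (L - 1 - r)) * (2 * σ) := by
        rw [← pow_succ]; congr 1; omega
      rw [e]
      field_simp
    refine (Finset.sum_le_sum this).trans (le_of_eq ?_)
    rw [Finset.sum_const, Finset.card_range, nsmul_eq_mul]
  refine (mul_le_mul_of_nonneg_left hs (by positivity)).trans (le_of_eq ?_)
  rw [hlam, div_pow]
  field_simp

end ChainAsymptotics

end WalkState

/-! ### Trails -/

section Trails

variable {V : Type*}

/-- The last vertex of a walk from `x`. -/
def endpoint (x : V) (l : List V) : V := l.foldl (fun _ y => y) x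

/-- The directed steps of a walk from `x`. -/
def trail : V → List V → List (V × V)
  | _, [] => []
  | x, y :: l => (x, y) :: trail y l

/-- The directed steps of a decorated walk from `x` that carry the decoration `b`. -/
def arcs (b : Bool) : V → List (Bool × V) → List (V × V)
  | _, [] => []
  | x, s :: l => if s.1 = b then (x, s.2) :: arcs b s.2 l else arcs b s.2 l

@[simp] lemma endpoint_nil (x : V) : endpoint x [] = x := rfl

@[simp] lemma endpoint_cons (x y : V) (l : List V) : endpoint x (y :: l) = endpoint y l := rfl

@[simp] lemma endpoint_append (x : V) (l l' : List V) :
    endpoint x (l ++ l') = endpoint (endpoint x l) l' := List.foldl_append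

lemma trail_append (x : V) (l l' : List V) :
    trail x (l ++ l') = trail x l ++ trail (endpoint x l) l' := by
  induction l generalizing x with
  | nil => rfl
  | cons y l ih => simp [trail, ih]

lemma arcs_append (b : Bool) (x : V) (l l' : List (Bool × V)) :
    arcs b x (l ++ l') = arcs b x l ++ arcs b (endpoint x (l.map Prod.snd)) l' := by
  induction l generalizing x with
  | nil => rfl
  | cons s l ih => by_cases h : s.1 = b <;> simp [arcs, ih, h]

lemma arcs_false_map (x : V) (l : List V) : arcs false x (l.map (Prod.mk false)) = trail x l := by
  induction l generalizing x with
  | nil => rfl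
  | cons y l ih => simp [arcs, trail, ih]

variable [DecidableEq V]

/-- The number of passages of an edge. -/
def passages (m : List (V × V)) (e : Sym2 V) : ℕ := (m.map fun a => s(a.1, a.2)).count e

/-- The closed walks from `x` whose origin is unmarked and that pass some edge an odd number of
times. -/
def Unmarked (x : V) (l : List V) : Prop :=
  (∀ k k', l = k ++ x :: k' → Even (passages (trail x (k ++ [x])) s(endpoint x k, x))) ∧
    ∃ e, Odd (passages (trail x l) e)

@[simp] lemma passages_nil (e : Sym2 V) : passages ([] : List (V × V)) e = 0 := rfl

lemma passages_cons (a : V × V) (m : List (V × V)) (e : Sym2 V) :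
    passages (a :: m) e = passages m e + if s(a.1, a.2) = e then 1 else 0 := by
  simp [passages, List.count_cons]

lemma passages_append (m m' : List (V × V)) (e : Sym2 V) :
    passages (m ++ m') e = passages m e + passages m' e := by
  simp [passages]

lemma passages_trail (x : V) (l : List (Bool × V)) (e : Sym2 V) :
    passages (trail x (l.map Prod.snd)) e
      = passages (arcs true x l) e + passages (arcs false x l) e := by
  induction l generalizing x with
  | nil => rfl
  | cons s l ih =>
    rcases s with ⟨_ | _, y⟩ <;> simp [trail, arcs, passages_cons, ih] <;> omega

lemma passages_eq_zero {m : List (V × V)} {e : Sym2 V} (h : ∀ a ∈ m, s(a.1, a.2) ≠ e) :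
    passages m e = 0 := by
  rw [passages, List.count_eq_zero]
  simpa using h

lemma exists_mem_of_passages_pos {m : List (V × V)} {e : Sym2 V} (h : passages m e ≠ 0) :
    ∃ a ∈ m, s(a.1, a.2) = e := by
  by_contra hc
  push Not at hc
  exact h (passages_eq_zero hc)

end Trails

/-- The directed edges of a stack, each from the lower to the upper end. -/
def stackArcs {V : Type*} : List V → List (V × V)
  | x :: y :: st => (y, x) :: stackArcs (y :: st)
  | _ => []

/-! ### ### Marked origins of runs without defects -/

namespace WalkState

variable {V : Type*} [Fintype V] [DecidableEq V]

lemma run_pos (h : WalkState V) (l : List (Bool × V)) :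
    (h.run l).pos = endpoint h.pos (l.map Prod.snd) := by
  induction l generalizing h with
  | nil => rfl
  | cons s l ih => rcases s with ⟨_ | _, y⟩ <;> simp [ih, next, stepW, stepA]

lemma run_cnt (h : WalkState V) (l : List (Bool × V)) (e : Sym2 V) :
    (h.run l).cnt e = h.cnt e + passages (arcs false h.pos l) e := by
  induction l generalizing h with
  | nil => rfl
  | cons s l ih =>
    rcases s with ⟨_ | _, y⟩
    · have h1 : h.next (false, y) = h.stepW y := rfl
      rw [run_cons, h1, ih]
      simp only [arcs, if_true, passages_cons, stepW]
      by_cases he : e = s(h.pos, y)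
      · subst he
        simp only [Function.update_self, if_true]
        omega
      · rw [Function.update_of_ne he, if_neg (Ne.symm he), add_zero]
    · have h1 : h.next (true, y) = h.stepA y := rfl
      rw [run_cons, h1, ih]
      simp [arcs, stepA]

lemma init_pos (z : V) : (init z).pos = z := rfl

lemma vis_subset_run (h : WalkState V) (l : List (Bool × V)) : h.vis ⊆ (h.run l).vis := by
  induction l generalizing h with
  | nil => exact subset_rfl
  | cons s l ih =>
    refine subset_trans ?_ (ih _)
    rcases s with ⟨_ | _, y⟩ <;> exact Finset.subset_insert _ _

lemma mem_vis_run (z : V) (l : List (Bool × V)) : ((init z).run l).pos ∈ ((init z).run l).vis :=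
  (inv_run z l).pos_mem

/-- A stack persists until its top is removed for good. -/
lemma Good.suffix_or {z : V} {l l' : List (Bool × V)} (hg : (init z).Good (l ++ l')) :
    stack z l <:+ stack z (l ++ l') ∨ ((init z).run l).pos ∉ stack z (l ++ l') := by
  induction l' using List.reverseRecOn with
  | nil => exact Or.inl (by simp)
  | append_singleton l' s ih =>
    rw [← List.append_assoc] at hg ⊢
    have ih := ih hg.snoc.1
    have S := hg.snoc.1.stackInv
    obtain ⟨st₀, hst₀⟩ := (good_append.1 hg.snoc.1).1.stackInv.head
    have hvis : ((init z).run l).pos ∈ ((init z).run (l ++ l')).vis := by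
      rw [run_append]
      exact vis_subset_run _ _ (mem_vis_run z l)
    rw [stack_snoc]
    rcases S.cases hg.snoc.2 with ⟨-, hy, hst⟩ | ⟨st', -, hst', hst⟩ | ⟨-, hy, hst', hst⟩ <;> rw [hst]
    · rcases ih with ih | ih
      · exact Or.inl (ih.trans (List.suffix_cons _ _))
      · refine Or.inr fun h => ?_
        rcases List.mem_cons.1 h with h | h
        · exact hy (h ▸ hvis)
        · exact ih h
    · have hnd := S.nodup
      rw [hst'] at ih hnd
      rcases ih with ih | ih
      · rcases List.suffix_cons_iff.1 ih with h | h
        · right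
          rw [hst₀] at h
          rw [(List.cons.inj h).1]
          exact (List.nodup_cons.1 hnd).1
        · exact Or.inl h
      · exact Or.inr fun h => ih (List.mem_cons_of_mem _ h)
    · right
      intro h
      rw [List.mem_singleton] at h
      exact hy (h ▸ hvis)

/-- A run without defects has the same stack at two visits of the same vertex if the first
stack is not discarded in between. -/
lemma Good.stack_eq {z : V} {l l' : List (Bool × V)} (hg : (init z).Good (l ++ l'))
    (hp : ((init z).run (l ++ l')).pos = ((init z).run l).pos) :
    stack z (l ++ l') = stack z l := by
  obtain ⟨st₁, h1⟩ := hg.stackInv.head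
  obtain ⟨st₀, h0⟩ := (good_append.1 hg).1.stackInv.head
  have hnd := hg.stackInv.nodup
  rcases hg.suffix_or with h | h
  · rw [h1] at h hnd
    rcases List.suffix_cons_iff.1 h with h2 | h2
    · rw [h1, h2]
    -- If the old stack were a proper suffix, the present vertex would occur twice in the new one.
    · refine absurd (h2.subset ?_) (List.nodup_cons.1 hnd).1
      rw [h0, hp]
      simp
  · refine absurd ?_ h
    rw [h1, hp]
    simp

/-- No later jump reaches a visited vertex. A jump leaving it would need a one-vertex stack there,
but every return to it finds the same stack as before. -/
lemma Good.not_mem_arcs_true {z : V} {l l' : List (Bool × V)} (hg : (init z).Good (l ++ l'))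
    (hd : ((init z).run l).opn ≠ 0) :
    ∀ a ∈ arcs true ((init z).run l).pos l', a.1 ≠ ((init z).run l).pos ∧
      a.2 ≠ ((init z).run l).pos := by
  induction l' using List.reverseRecOn with
  | nil => simp [arcs]
  | append_singleton l' s ih =>
    rw [← List.append_assoc] at hg
    have ih := ih hg.snoc.1
    intro a ha
    rw [arcs_append, List.mem_append] at ha
    rcases ha with ha | ha
    · exact ih a ha
    · have S := hg.snoc.1.stackInv
      have hvis : ((init z).run l).pos ∈ ((init z).run (l ++ l')).vis := by
        rw [run_append]
        exact vis_subset_run _ _ (mem_vis_run z l)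
      have hpos : endpoint ((init z).run l).pos (l'.map Prod.snd)
          = ((init z).run (l ++ l')).pos := by rw [run_append, run_pos _ l']
      rw [hpos] at ha
      have S0 := (good_append.1 hg.snoc.1).1.stackInv
      rcases S.cases hg.snoc.2 with ⟨h1, -⟩ | ⟨-, h1, -⟩ | ⟨h1, hy, hst', -⟩
      · simp [arcs, h1] at ha
      · simp [arcs, h1] at ha
      · simp only [arcs, h1, if_true, List.mem_singleton] at ha
        subst ha
        refine ⟨fun h => ?_, fun h => hy (h ▸ hvis)⟩
        have h2 := hg.snoc.1.stack_eq h
        rw [hst'] at h2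
        exact hd (S0.opn_eq_zero_iff.2 (by rw [← h2]; rfl))

lemma Good.trail_subset {z : V} {l : List (Bool × V)} (hg : (init z).Good l) :
    ∀ a ∈ trail z (l.map Prod.snd), a.1 ∈ ((init z).run l).vis ∧ a.2 ∈ ((init z).run l).vis ∧
      a.1 ≠ a.2 := by
  induction l using List.reverseRecOn with
  | nil => simp [trail]
  | append_singleton l s ih =>
    have hsub : ((init z).run l).vis ⊆ ((init z).run (l ++ [s])).vis := by
      rw [run_append]
      exact vis_subset_run _ _
    intro a ha
    rw [List.map_append, trail_append, List.mem_append] at ha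
    rcases ha with ha | ha
    · have := ih hg.snoc.1 a ha
      exact ⟨hsub this.1, hsub this.2.1, this.2.2⟩
    · have hpos : endpoint z (l.map Prod.snd) = ((init z).run l).pos := by rw [run_pos, init_pos]
      simp only [List.map_cons, List.map_nil, trail, List.mem_singleton, hpos] at ha
      subst ha
      have h3 : ((init z).run (l ++ [s])).pos = s.2 := by simp [run_pos]
      refine ⟨hsub (mem_vis_run z l), ?_, ?_⟩
      · have := mem_vis_run z (l ++ [s])
        rwa [h3] at this
      · have S := hg.snoc.1.stackInv
        rcases S.cases hg.snoc.2 with ⟨-, hy, -⟩ | ⟨st', -, hst', -⟩ | ⟨-, hy, -, -⟩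
        · exact fun h => hy (h ▸ mem_vis_run z l)
        · intro h
          have hnd := S.nodup
          rw [hst'] at hnd
          simp only at h
          exact (List.nodup_cons.1 hnd).1 (by rw [h]; simp)
        · exact fun h => hy (h ▸ mem_vis_run z l)

/-- The base of the stack, and the edge from the base to the first base. -/
lemma Good.base {z : V} {l : List (Bool × V)} (hg : (init z).Good l) :
    ∃ b, (stack z l).getLast? = some b ∧ (l.countP (fun s => s.1) = 0 → b = z) ∧
      (l.countP (fun s => s.1) ≠ 0 → b ≠ z) ∧
      (2 ≤ l.countP (fun s => s.1) → ∀ a ∈ trail z (l.map Prod.snd), s(a.1, a.2) ≠ s(b, z)) := by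
  induction l using List.reverseRecOn with
  | nil => exact ⟨z, rfl, fun _ => rfl, fun h => absurd rfl h, fun h => absurd h (by simp)⟩
  | append_singleton l s ih =>
    obtain ⟨b, hb, h0, h1, h2⟩ := ih hg.snoc.1
    have S := hg.snoc.1.stackInv
    have hpos : endpoint z (l.map Prod.snd) = ((init z).run l).pos := by rw [run_pos, init_pos]
    have hz : z ∈ ((init z).run l).vis := vis_subset_run (init z) l (by simp [init])
    have hbv : b ∈ ((init z).run l).vis := S.sub b (List.mem_of_getLast? hb)
    have htr : trail z ((l ++ [s]).map Prod.snd)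
        = trail z (l.map Prod.snd) ++ [(((init z).run l).pos, s.2)] := by
      rw [List.map_append, trail_append, hpos]; rfl
    rw [stack_snoc, List.countP_append, htr]
    rcases S.cases hg.snoc.2 with ⟨hs, hy, hst⟩ | ⟨st', hs, hst', hst⟩ | ⟨hs, hy, hst', hst⟩ <;>
      rw [hst]
    · have hc : [s].countP (fun s => s.1) = 0 := by simp [hs]
      rw [hc, add_zero]
      refine ⟨b, ?_, h0, h1, fun h a ha => ?_⟩
      · rw [List.getLast?_cons, hb]; rfl
      · rcases List.mem_append.1 ha with ha | ha
        · exact h2 h a ha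
        · rw [List.mem_singleton] at ha
          subst ha
          intro h
          have : s.2 ∈ s(b, z) := by rw [← h]; simp
          rcases Sym2.mem_iff.1 this with h | h
          · exact hy (h ▸ hbv)
          · exact hy (h ▸ hz)
    · have hc : [s].countP (fun s => s.1) = 0 := by simp [hs]
      rw [hc, add_zero]
      refine ⟨b, ?_, h0, h1, fun h a ha => ?_⟩
      · rw [hst', List.getLast?_cons_cons] at hb; exact hb
      · rcases List.mem_append.1 ha with ha | ha
        · exact h2 h a ha
        · rw [List.mem_singleton] at ha
          subst ha
          -- The popped edge has been passed before, so the induction hypothesis already excludes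
          -- it.
          have ho : Odd (((init z).run l).cnt s(((init z).run l).pos, s.2)) := by
            rw [S.odd_iff, hst']
            have hnd := S.nodup
            rw [hst'] at hnd
            exact (mem_stackEdges_head (List.nodup_cons.1 hnd).1).2 rfl
          rw [run_cnt] at ho
          have h3 : passages (arcs false z l) s(((init z).run l).pos, s.2) ≠ 0 := by
            intro h4
            have h5 : (init z).cnt s(((init z).run l).pos, s.2) = 0 := rfl
            rw [init_pos, h4, h5] at ho
            exact absurd ho (by decide)
          obtain ⟨a, ha, hae⟩ := exists_mem_of_passages_pos (m := trail z (l.map Prod.snd))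
            (e := s(((init z).run l).pos, s.2)) (by rw [passages_trail]; omega)
          rw [← hae]
          exact h2 h a ha
    · have hc : [s].countP (fun s => s.1) = 1 := by simp [hs]
      rw [hc]
      -- Earlier steps cannot touch the new base. The jump itself could only use the excluded edge
      -- if it left `z`, but from the second jump on the base left differs from `z`.
      refine ⟨s.2, rfl, fun h => absurd h (by omega), fun _ h => hy (h ▸ hz), fun h a ha => ?_⟩
      have hbp : b = ((init z).run l).pos := by
        rw [hst'] at hb
        simpa using hb.symm
      rcases List.mem_append.1 ha with ha | ha
      · have h3 := hg.snoc.1.trail_subset a ha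
        intro h
        have : s.2 ∈ s(a.1, a.2) := by rw [h]; simp
        rcases Sym2.mem_iff.1 this with h | h
        · exact hy (h ▸ h3.1)
        · exact hy (h ▸ h3.2.1)
      · rw [List.mem_singleton] at ha
        subst ha
        intro h
        have : z ∈ s(((init z).run l).pos, s.2) := by rw [h]; simp
        rcases Sym2.mem_iff.1 this with h4 | h4
        · exact h1 (by omega) (hbp.trans h4.symm)
        · exact hy (h4 ▸ hz)

/-- A closed run without defects and with a number of deterministic steps different from `1`
avoids the edge from its end to its start. -/
lemma Good.closing_edge {z : V} {l : List (Bool × V)} (hg : (init z).Good l)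
    (hc : ((init z).run l).opn = 0) (hA : l.countP (fun s => s.1) ≠ 1) :
    ∀ a ∈ trail z (l.map Prod.snd), s(a.1, a.2) ≠ s(((init z).run l).pos, z) := by
  obtain ⟨b, hb, h0, -, h2⟩ := hg.base
  have S := hg.stackInv
  obtain ⟨st', hst'⟩ := S.head
  have h1 := S.opn_eq_zero_iff.1 hc
  rw [hst'] at h1 hb
  have h3 : st' = [] := by simpa using h1
  subst h3
  have hbp : b = ((init z).run l).pos := by simpa using hb.symm
  rw [← hbp]
  by_cases h : l.countP (fun s => s.1) = 0
  · intro a ha hae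
    rw [h0 h] at hae
    have := (hg.trail_subset a ha).2.2
    have h4 : Sym2.IsDiag s(a.1, a.2) := by rw [hae]; simp
    exact this (by simpa using h4)
  · exact h2 (by omega)

/-- Up to the arcs of the stack, both directions are passed equally often by random steps. -/
lemma Good.balanced {z : V} {l : List (Bool × V)} (hg : (init z).Good l) (u v : V) :
    (arcs false z l).count (u, v) + (stackArcs (stack z l)).count (v, u)
      = (arcs false z l).count (v, u) + (stackArcs (stack z l)).count (u, v) := by
  induction l using List.reverseRecOn with
  | nil => simp [arcs, stack, stackArcs]
  | append_singleton l s ih =>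
    have ih := ih hg.snoc.1
    have S := hg.snoc.1.stackInv
    obtain ⟨st₀, hst₀⟩ := S.head
    have hpos : endpoint z (l.map Prod.snd) = ((init z).run l).pos := by rw [run_pos, init_pos]
    rw [stack_snoc, arcs_append, hpos]
    rcases S.cases hg.snoc.2 with ⟨hs, hy, hst⟩ | ⟨st', hs, hst', hst⟩ | ⟨hs, hy, hst', hst⟩ <;>
      rw [hst]
    · rw [hst₀] at ih ⊢
      simp only [arcs, hs, if_true, stackArcs, List.count_append, List.count_cons, List.count_nil]
      omega
    · rw [hst'] at ih
      simp only [arcs, hs, if_true, stackArcs, List.count_append, List.count_cons,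
        List.count_nil] at ih ⊢
      simp only [beq_iff_eq, Prod.mk.injEq] at ih ⊢
      simp only [and_comm (a := s.2 = v), and_comm (a := s.2 = u)] at ih
      omega
    · rw [hst'] at ih
      simp only [arcs, hs, stackArcs, List.count_append, List.count_nil] at ih ⊢
      simpa using ih

/-- Edges thus contribute E|W|² and never E W², so the main term is the same in the real and in the
complex case. -/
lemma Good.balanced_of_closed {z : V} {l : List (Bool × V)} (hg : (init z).Good l)
    (hc : ((init z).run l).opn = 0) (u v : V) :
    (arcs false z l).count (u, v) = (arcs false z l).count (v, u) := by
  have := hg.balanced u v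
  obtain ⟨x, hx⟩ := List.length_eq_one_iff.1 (hg.stackInv.opn_eq_zero_iff.1 hc)
  simpa [hx, stackArcs] using this

lemma even_cnt_of_opn {h : WalkState V} (hc : h.opn = 0) (e : Sym2 V) : Even (h.cnt e) := by
  have := (Finset.sum_eq_zero_iff.1 hc) e (Finset.mem_univ e)
  exact Nat.even_iff.2 this

/-- The closed paths, rotated to start after their last deterministic step, that are counted. -/
theorem Good.unmarked_iff {z : V} {l₂ : List V} {l₁ : List (Bool × V)}
    (hg : (init z).Good (l₂.map (Prod.mk false) ++ l₁))
    (hc : ((init z).run (l₂.map (Prod.mk false) ++ l₁)).opn = 0)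
    (hA : l₁.countP (fun s => s.1) ≠ 1) :
    Unmarked (endpoint z l₂) (l₁.map Prod.snd ++ z :: l₂) ↔
      ((init z).run (l₂.map (Prod.mk false))).opn ≠ 0 := by
  set m := l₂.map (Prod.mk false) with hm
  have hm2 : m.map Prod.snd = l₂ := by simp [hm, Function.comp_def]
  have hmA : m.countP (fun s => s.1) = 0 := by simp [hm, List.countP_eq_zero]
  have hg2 := (good_append.1 hg).1
  have S2 := hg2.stackInv
  have S := hg.stackInv
  obtain ⟨st₂, hst₂⟩ := S2.head
  set x := endpoint z l₂ with hx
  have hx2 : ((init z).run m).pos = x := by rw [run_pos, hm2, init_pos]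
  have hxe : ((init z).run (m ++ l₁)).pos = endpoint x (l₁.map Prod.snd) := by
    rw [run_pos, List.map_append, hm2, init_pos, endpoint_append]
  have hedge := hg.closing_edge hc (by rw [List.countP_append, hmA, zero_add]; exact hA)
  rw [hxe, List.map_append, hm2, trail_append] at hedge
  obtain ⟨b, hb, hb0, -⟩ := hg2.base
  have hbz := hb0 hmA
  subst hbz
  rw [hx2] at hst₂
  set xe := endpoint x (l₁.map Prod.snd) with hxe'
  constructor
  -- At depth 0 the random stretch is back at its base, so x is `b`. The last deterministic step
  -- then lands on the origin along an edge not passed before, and the origin is marked.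
  · rintro ⟨hU, -⟩ h0
    have h1 := S2.opn_eq_zero_iff.1 h0
    rw [hst₂] at h1 hb
    have h3 : st₂ = [] := by simpa using h1
    subst h3
    have hbx : b = x := by simpa using hb.symm
    have h4 := hU (l₁.map Prod.snd) l₂ (by rw [hbx])
    rw [trail_append, passages_append, passages_eq_zero, ← hxe'] at h4
    · simp [trail, passages_cons] at h4
    · intro a ha
      have h5 := hedge a (List.mem_append_right _ ha)
      rwa [hbx] at h5
  · intro hd
    have hbx : b ≠ x := by
      intro h
      have hnd := S2.nodup
      have hl := mt S2.opn_eq_zero_iff.2 hd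
      rw [hst₂] at hb hnd hl
      cases st₂ with
      | nil => simp at hl
      | cons c st =>
        rw [List.getLast?_cons_cons] at hb
        exact (List.nodup_cons.1 hnd).1 (h ▸ List.mem_of_getLast? hb)
    have hxex : xe ≠ x := by
      intro h
      have := hg.stack_eq (by rw [hxe, hx2, h])
      have h1 := S.opn_eq_zero_iff.1 hc
      rw [this] at h1
      exact hd (S2.opn_eq_zero_iff.2 h1)
    have hA1 := hg.not_mem_arcs_true hd
    rw [hx2] at hA1
    -- Edges at the origin are passed only by random steps, so their passages are read off the
    -- counts of the run.
    have hnoA : ∀ l l', l₁ = l ++ l' → ∀ e : Sym2 V, x ∈ e →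
        passages (trail x (l.map Prod.snd)) e = passages (arcs false x l) e := by
      intro l l' hl e he
      rw [passages_trail, passages_eq_zero, zero_add]
      intro a ha hae
      have := hA1 a (by rw [hl, arcs_append]; exact List.mem_append_left _ ha)
      rw [← hae] at he
      rcases Sym2.mem_iff.1 he with h | h
      · exact this.1 h.symm
      · exact this.2 h.symm
    have hcnt : ∀ l (e : Sym2 V), ((init b).run (m ++ l)).cnt e
        = ((init b).run m).cnt e + passages (arcs false x l) e := by
      intro l e
      rw [run_append, run_cnt _ l, hx2]
    -- The odd edge is that of the last deterministic step, passed exactly once. For the origin, a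
    -- return falls either after or before that step.
    refine ⟨fun k k' hk => ?_, s(xe, b), ?_⟩
    · have he : x ∈ s(endpoint x k, x) := by simp
      generalize s(endpoint x k, x) = e at he
      rcases List.append_eq_append_iff.1 hk with ⟨c, hc1, hc2⟩ | ⟨c, hc1, hc2⟩
      · cases c with
        | nil => exact absurd (List.cons.inj hc2).1 hbx
        | cons c0 c =>
          simp only [List.cons_append, List.cons.injEq] at hc2
          obtain ⟨rfl, hc2⟩ := hc2
          have h1 := hnoA l₁ [] (by simp) e he
          have h2 : m = (c ++ [x]).map (Prod.mk false) ++ k'.map (Prod.mk false) := by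
            rw [hm, hc2]; simp
          have hg' := hg2
          rw [h2] at hg'
          -- The stack at this return is already that at the end of the random stretch, so the
          -- parities agree with those after the whole stretch. The passages up to the return then
          -- have the parity of the total count, which is even since the run is closed.
          have h3 := hg'.stack_eq (by
            rw [← h2, hx2, run_pos]
            simp [Function.comp_def])
          rw [← h2] at h3
          have h4 := (good_append.1 hg').1.stackInv.odd_iff e
          rw [← h3, ← S2.odd_iff e] at h4
          have h5 := hcnt l₁ e
          have h6 := even_cnt_of_opn hc e
          have h7 : ((init b).run ((c ++ [x]).map (Prod.mk false))).cnt e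
              = passages (trail b (c ++ [x])) e := by
            rw [run_cnt, arcs_false_map]
            simp [init]
          rw [h7] at h4
          have hke : k ++ [x] = l₁.map Prod.snd ++ b :: (c ++ [x]) := by rw [hc1]; simp
          rw [hke, trail_append, passages_append, h1, ← hxe', trail, passages_cons, if_neg]
          · rw [h5] at h6
            simp only [Nat.even_iff, Nat.odd_iff] at h4 h6 ⊢
            omega
          · rintro rfl
            rcases Sym2.mem_iff.1 he with h | h
            · exact hxex h.symm
            · exact hbx h.symm
      · have key : ∀ l (y : Bool) l', l₁ = l ++ (y, x) :: l' → k = l.map Prod.snd →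
            Even (passages (trail x (k ++ [x])) e) := by
          intro l y l' hl hkl
          have h2 : l₁ = (l ++ [(y, x)]) ++ l' := by rw [hl]; simp
          have h1 := hnoA _ _ h2 e he
          have hg' := hg
          rw [h2, ← List.append_assoc] at hg'
          -- At a return before the last deterministic step the stack is that of the start of the
          -- path, so the edge has been passed an even number of times since then.
          have hg'' := (good_append.1 hg').1
          have h3 := hg''.stack_eq (by
            rw [hx2, run_pos]
            simp)
          have h4 := hg''.stackInv.odd_iff e
          rw [h3, ← S2.odd_iff e, hcnt] at h4
          have h5 : (l ++ [(y, x)]).map Prod.snd = k ++ [x] := by rw [hkl]; simp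
          rw [← h5, h1]
          simp only [Nat.even_iff, Nat.odd_iff] at h4 ⊢
          omega
        cases c with
        | nil => exact absurd (List.cons.inj hc2).1.symm hbx
        | cons c0 c =>
          simp only [List.cons_append, List.cons.injEq] at hc2
          obtain ⟨rfl, hc2⟩ := hc2
          obtain ⟨l, l', hl, hkl, hl'⟩ := List.map_eq_append_iff.1 hc1
          obtain ⟨⟨y, w⟩, l'', hl'', hw, -⟩ := List.map_eq_cons_iff.1 hl'
          simp only at hw
          subst hw
          exact key l y l'' (by rw [hl, hl'']) hkl.symm
    · rw [trail_append, passages_append, ← hxe', trail, passages_cons, passages_eq_zero,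
        passages_eq_zero, if_pos rfl]
      · decide
      · exact fun a ha => hedge a (List.mem_append_left _ ha)
      · exact fun a ha => hedge a (List.mem_append_right _ ha)

end WalkState

/-- The splitting of a sum over lists of steps at the last deterministic step. -/
lemma listSum_split {V R : Type*} [Fintype V] [AddCommMonoid R] (L : ℕ)
    (F : List (Bool × V) → R) :
    listSum L F = listSum L (fun k : List V => F (k.map (Prod.mk false)))
      + ∑ r ∈ Finset.range L, listSum (L - 1 - r) fun l => ∑ z, listSum r fun k : List V =>
          F (l ++ (true, z) :: k.map (Prod.mk false)) := by
  induction L generalizing F with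
  | zero => simp [listSum]
  | succ L ih =>
    have h1 : ∀ r ∈ Finset.range L, (listSum (L + 1 - 1 - r) fun l => ∑ z, listSum r fun k : List V =>
          F (l ++ (true, z) :: k.map (Prod.mk false)))
        = ∑ s, listSum (L - 1 - r) fun l => ∑ z, listSum r fun k : List V =>
          F (s :: l ++ (true, z) :: k.map (Prod.mk false)) := by
      intro r hr
      have : L + 1 - 1 - r = (L - 1 - r) + 1 := by have := Finset.mem_range.1 hr; omega
      rw [this]
      rfl
    have h2 : L + 1 - 1 - L = 0 := by omega
    rw [Finset.sum_range_succ, Finset.sum_congr rfl h1, h2, Finset.sum_comm]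
    simp only [listSum]
    rw [Finset.sum_congr rfl fun s _ => ih fun l => F (s :: l), Finset.sum_add_distrib,
      Fintype.sum_prod_type, Fintype.sum_bool]
    simp only [List.nil_append, List.map_cons, List.cons_append]
    abel

/-- The values `E m` behave like the expectations of products over the directed edges of `m` of
the entries of a normalized Wigner matrix. -/
structure ArcWeights {V 𝕜 : Type*} [Fintype V] [DecidableEq V] [RCLike 𝕜] (σ K : ℝ)
    (E : List (V × V) → 𝕜) : Prop where
  perm : ∀ m m', m.Perm m' → E m = E m'
  odd : ∀ m e, Odd (passages m e) → E m = 0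
  norm_le : ∀ m, (∀ e, Even (passages m e)) →
    ‖E m‖ ≤ ∏ e, WalkState.edgeWeight σ K e (passages m e)
  eq_of_balanced : ∀ m, (∀ u v, m.count (u, v) = m.count (v, u)) → (∀ e, passages m e ≤ 2) →
    (∀ a ∈ m, a.1 ≠ a.2) →
    E m = ((∏ e, WalkState.edgeWeight σ K e (passages m e) : ℝ) : 𝕜)

/-! ### ### Weights of decorated walks -/

namespace WalkState

variable {V 𝕜 : Type*} [Fintype V] [DecidableEq V] [RCLike 𝕜]

/-- The weight of a decorated walk. -/
noncomputable def walkWeight (θ : ℝ) (E : List (V × V) → 𝕜) (x : V) (l : List (Bool × V)) : 𝕜 :=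
  ((θ / Fintype.card V : ℝ) : 𝕜) ^ (l.countP fun s => s.1) * E (arcs false x l)

lemma wprod_init (θ σ K : ℝ) (z : V) (l : List (Bool × V)) :
    wprod θ σ K 1 (init z) l = (θ / Fintype.card V) ^ (l.countP fun s => s.1) *
        ∏ e, edgeWeight σ K e (passages (arcs false z l) e) := by
  have h := wprod_mul_edgeWeight θ σ K (init z) l
  have h1 : ∀ e, (init z).cnt e = 0 := fun _ => rfl
  simp only [run_cnt, h1, zero_add, edgeWeight, Finset.prod_const_one, mul_one, init_pos] at h
  exact h

lemma cnt_run_init (z : V) (l : List (Bool × V)) (e : Sym2 V) :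
    ((init z).run l).cnt e = passages (arcs false z l) e := by
  rw [run_cnt, init_pos]
  simp [init]

lemma norm_walkWeight_le {θ σ K : ℝ} (hθ : 0 ≤ θ) {E : List (V × V) → 𝕜}
    (hE : ArcWeights σ K E) (z : V) (l : List (Bool × V)) :
    ‖walkWeight θ E z l‖ ≤ wprod θ σ K 1 (init z) l * closed ((init z).run l) := by
  by_cases hc : ((init z).run l).opn = 0
  · have h1 : ∀ e, Even (passages (arcs false z l) e) := fun e => by
      rw [← cnt_run_init]
      exact even_cnt_of_opn hc e
    rw [closed, if_pos hc, mul_one, wprod_init, walkWeight, norm_mul, norm_pow,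
      RCLike.norm_ofReal, abs_of_nonneg (by positivity)]
    exact mul_le_mul_of_nonneg_left (hE.norm_le _ h1) (by positivity)
  · obtain ⟨e, -, he⟩ : ∃ e ∈ Finset.univ, ((init z).run l).cnt e % 2 ≠ 0 := by
      by_contra h
      push Not at h
      exact hc (Finset.sum_eq_zero h)
    rw [cnt_run_init] at he
    rw [closed, if_neg hc, mul_zero, walkWeight, hE.odd _ e (Nat.odd_iff.2 (by omega)), mul_zero,
      norm_zero]

lemma Good.walkWeight_eq {θ σ K : ℝ} {E : List (V × V) → 𝕜}
    (hE : ArcWeights σ K E) {z : V} {l : List (Bool × V)} (hg : (init z).Good l)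
    (hc : ((init z).run l).opn = 0) :
    walkWeight θ E z l = ((wprod θ σ K 0 (init z) l : ℝ) : 𝕜) := by
  rw [hg.wprod_eq (Γ' := 1), wprod_init, walkWeight, hE.eq_of_balanced _
    (hg.balanced_of_closed hc) (fun e => by rw [← cnt_run_init]; exact hg.stackInv.cnt_le e)]
  · push_cast
    rfl
  · intro a ha
    refine (hg.trail_subset a ?_).2.2
    have : ∀ (x : V) (l : List (Bool × V)), a ∈ arcs false x l → a ∈ trail x (l.map Prod.snd) := by
      intro x l h
      induction l generalizing x with
      | nil => exact h
      | cons s l ih =>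
        rw [List.map_cons, trail]
        by_cases hs : s.1 = false
        · simp only [arcs, hs, if_true, List.mem_cons] at h
          rcases h with h | h
          · rw [h]; simp
          · exact List.mem_cons_of_mem _ (ih _ h)
        · simp only [arcs, hs] at h
          exact List.mem_cons_of_mem _ (ih _ h)
    exact this z l ha

/-- The weight sees only the unordered collection of random arcs and the number of deterministic
steps, so it is invariant under rotation. -/
lemma walkWeight_rotate {θ σ K : ℝ} {E : List (V × V) → 𝕜} (hE : ArcWeights σ K E) (z : V)
    (k : List V) (l : List (Bool × V)) :
    walkWeight θ E (endpoint z k) (l ++ (true, z) :: k.map (Prod.mk false))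
      = ((θ / Fintype.card V : ℝ) : 𝕜) * walkWeight θ E z (k.map (Prod.mk false) ++ l) := by
  have h0 : (k.map (Prod.mk false)).countP (fun s => s.1) = 0 := by simp [List.countP_eq_zero]
  have h1 : (k.map (Prod.mk false)).map Prod.snd = k := by simp [Function.comp_def]
  rw [walkWeight, walkWeight, List.countP_append, List.countP_append, h0,
    List.countP_cons_of_pos (by simp), h0, arcs_append, arcs_append, h1]
  simp only [arcs, Bool.true_eq_false, if_false]
  rw [hE.perm _ _ List.perm_append_comm, zero_add, zero_add, pow_succ]
  ring

/-- This serves runs with a single deterministic step: lowering θ to σ costs one factor θ/σ but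
brings the growth rate down to 2σ. -/
lemma wprod_eq_mul_wprod {θ σ σ' K Γ : ℝ} (hσ : σ' ≠ 0) (h : WalkState V)
    (l : List (Bool × V)) :
    wprod θ σ K Γ h l = (θ / σ') ^ (l.countP fun s => s.1) * wprod σ' σ K Γ h l := by
  induction l generalizing h with
  | nil => simp [wprod]
  | cons s l ih =>
    rcases s with ⟨_ | _, z⟩
    · rw [wprod, wprod, ih, List.countP_cons_of_neg (by simp)]
      simp only [wt, Bool.false_eq_true, if_false]
      ring
    · have h1 : wA θ Γ h z = θ / σ' * wA σ' Γ h z := by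
        unfold wA
        field_simp
      rw [wprod, wprod, ih, List.countP_cons_of_pos (by simp), pow_succ]
      simp only [wt, if_true, h1]
      ring

lemma chainWeight_nonneg {θ σ : ℝ} (hθ : 0 ≤ θ) (r n : ℕ) : 0 ≤ chainWeight θ σ r n := by
  refine iterate_chain_nonneg le_rfl (fun d => ?_) r 0
  split_ifs
  · exact le_rfl
  · exact iterate_chain_nonneg hθ (fun d => by split_ifs <;> simp) n d

open Classical in
/-- The comparison of one closed walk with the main term. -/
lemma norm_indicator_mul_walkWeight_sub_le {θ σ K Γ : ℝ} (hσ : 0 < σ) (hθ : 0 ≤ θ) (hK : 0 ≤ K)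
    (hΓ : 1 ≤ Γ) {E : List (V × V) → 𝕜} (hE : ArcWeights σ K E) (z : V)
    (k : List V) (l : List (Bool × V)) :
    ‖(if Unmarked (endpoint z k) (l.map Prod.snd ++ z :: k) then
        walkWeight θ E z (k.map (Prod.mk false) ++ l) else 0)
      - ((wprod θ σ K 0 (init z) (k.map (Prod.mk false) ++ l)
          * closed ((init z).run (k.map (Prod.mk false) ++ l))
          * (if ((init z).run (k.map (Prod.mk false))).opn = 0 then 0 else 1) : ℝ) : 𝕜)‖
      ≤ 1 / Γ * (wprod θ σ K Γ (init z) (k.map (Prod.mk false) ++ l)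
          * closed ((init z).run (k.map (Prod.mk false) ++ l)))
        + θ / σ * (wprod σ σ K Γ (init z) (k.map (Prod.mk false) ++ l)
          * closed ((init z).run (k.map (Prod.mk false) ++ l))) := by
  set m := k.map (Prod.mk false) ++ l with hm
  have hG := norm_walkWeight_le hθ hE z m
  have hcl : 0 ≤ closed ((init z).run m) := by unfold closed; split_ifs <;> simp
  have hΓ0 : 0 < Γ := by linarith
  have p1 := wprod_nonneg (σ := σ) hθ hK hΓ0.le (init z) m
  have p2 := wprod_nonneg (σ := σ) hσ.le hK hΓ0.le (init z) m
  have p3 : 0 ≤ θ / σ * (wprod σ σ K Γ (init z) m * closed ((init z).run m)) := by positivity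
  have p4 : 0 ≤ 1 / Γ * (wprod θ σ K Γ (init z) m * closed ((init z).run m)) := by positivity
  by_cases hg : (init z).Good m
  · by_cases hc : ((init z).run m).opn = 0
    · have hw := hg.walkWeight_eq (θ := θ) hE hc
      have hcl1 : closed ((init z).run m) = 1 := by rw [closed, if_pos hc]
      rw [hw, hcl1]
      simp only [mul_one]
      by_cases hA : l.countP (fun s => s.1) = 1
      · have hm1 : m.countP (fun s => s.1) = 1 := by
          rw [hm, List.countP_append, hA, List.countP_eq_zero.2 (by simp)]
        have h0 := wprod_nonneg (σ := σ) hθ hK le_rfl (init z) m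
        have h1 : wprod θ σ K 0 (init z) m = θ / σ * wprod σ σ K Γ (init z) m := by
          rw [wprod_eq_mul_wprod hσ.ne', hm1, pow_one, hg.wprod_eq (Γ' := Γ)]
        rw [hcl1, mul_one, ← h1] at p3
        rw [hcl1] at p4
        rw [mul_one] at p4
        rw [← h1]
        refine le_trans ?_ (le_add_of_nonneg_left p4)
        split_ifs <;> simp [abs_of_nonneg h0, h0]
      -- Here the two indicators agree and the difference vanishes.
      · have h1 := hg.unmarked_iff hc hA
        simp only [h1]
        have h2 : ∀ w : ℝ, ‖(if ((init z).run (k.map (Prod.mk false))).opn ≠ 0 then (w : 𝕜) else 0)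
            - ((w * (if ((init z).run (k.map (Prod.mk false))).opn = 0 then 0 else 1) : ℝ) : 𝕜)‖
            = 0 := by
          intro w
          split_ifs <;> simp_all
        rw [h2]
        rw [hcl1, mul_one] at p3 p4
        exact add_nonneg p4 p3
    · have hcl0 : closed ((init z).run m) = 0 := by rw [closed, if_neg hc]
      rw [hcl0, mul_zero] at hG
      have h0 : walkWeight θ E z m = 0 := norm_le_zero_iff.1 hG
      rw [h0, hcl0]
      simp
  · rw [wprod_zero_of_not_good hg]
    have h1 := mul_wprod_one_le_of_not_good (σ := σ) hθ hK hΓ hg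
    have h2 : wprod θ σ K 1 (init z) m ≤ 1 / Γ * wprod θ σ K Γ (init z) m := by
      rw [div_mul_eq_mul_div, one_mul, le_div_iff₀ hΓ0]
      linarith
    have h3 : ‖walkWeight θ E z m‖ ≤ 1 / Γ * (wprod θ σ K Γ (init z) m
        * closed ((init z).run m)) := by
      refine hG.trans ?_
      rw [← mul_assoc]
      exact mul_le_mul_of_nonneg_right h2 hcl
    have h4 : ‖(if Unmarked (endpoint z k) (l.map Prod.snd ++ z :: k) then
        walkWeight θ E z m else 0)‖ ≤ ‖walkWeight θ E z m‖ := by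
      split_ifs <;> simp
    simp only [zero_mul, RCLike.ofReal_zero, sub_zero]
    linarith

open Classical in
/-- The total weight of the decorated closed walks with an unmarked origin and an odd edge. -/
noncomputable def unmarkedSum (θ : ℝ) (E : List (V × V) → 𝕜) (L : ℕ) : 𝕜 :=
  ∑ x, listSum L fun l : List (Bool × V) =>
    if endpoint x (l.map Prod.snd) = x ∧ Unmarked x (l.map Prod.snd) then walkWeight θ E x l else 0

open Classical in
-- Purely random walks drop out because an odd edge kills their weight. The others are split at the
-- last deterministic step and rotated, and the sum over the origin disappears since the origin is
-- the end of the random stretch `k`.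
lemma unmarkedSum_eq {θ σ K : ℝ} {E : List (V × V) → 𝕜} (hE : ArcWeights σ K E) (L : ℕ) :
    unmarkedSum θ E L = ((θ / Fintype.card V : ℝ) : 𝕜) * ∑ r ∈ Finset.range L, ∑ z,
      listSum r fun k : List V => listSum (L - 1 - r) fun l : List (Bool × V) =>
        if Unmarked (endpoint z k) (l.map Prod.snd ++ z :: k) then
          walkWeight θ E z (k.map (Prod.mk false) ++ l) else 0 := by
  have h1 : ∀ x, listSum L (fun k : List V => if endpoint x ((k.map (Prod.mk false)).map Prod.snd) = x
      ∧ Unmarked x ((k.map (Prod.mk false)).map Prod.snd) then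
        walkWeight θ E x (k.map (Prod.mk false)) else 0) = 0 := by
    intro x
    refine (listSum_congr (G := fun _ => 0) fun k _ => ?_).trans (listSum_zero L)
    split_ifs with h
    · obtain ⟨-, -, e, he⟩ := h
      rw [List.map_map] at he
      have h2 : k.map (Prod.snd ∘ Prod.mk false) = k := by simp [Function.comp_def]
      rw [h2] at he
      rw [walkWeight, arcs_false_map, hE.odd _ e he, mul_zero]
    · rfl
  have h2 : ∀ (k : List V), (k.map (Prod.mk false)).map Prod.snd = k := fun k => by
    simp [Function.comp_def]
  unfold unmarkedSum
  simp only [listSum_split L]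
  rw [Finset.sum_add_distrib, Finset.sum_eq_zero fun x _ => h1 x, zero_add, Finset.sum_comm,
    Finset.mul_sum]
  refine Finset.sum_congr rfl fun r _ => ?_
  have hR : ∀ G : V → List V → List (Bool × V) → 𝕜, (∑ z, listSum r fun k =>
      listSum (L - 1 - r) fun l => G z k l)
      = listSum (L - 1 - r) fun l => ∑ z, listSum r fun k => G z k l := by
    intro G
    rw [listSum_sum]
    exact Finset.sum_congr rfl fun z _ => listSum_comm r _ _
  rw [hR, ← listSum_mul_left, ← listSum_sum]
  refine listSum_congr fun l _ => ?_
  rw [Finset.sum_comm, Finset.mul_sum]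
  refine Finset.sum_congr rfl fun z _ => ?_
  rw [← listSum_mul_left, ← listSum_sum]
  refine listSum_congr fun k _ => ?_
  simp only [List.map_append, List.map_cons, h2, endpoint_append, endpoint_cons]
  have h3 : ∀ x, (if endpoint z k = x ∧ Unmarked x (l.map Prod.snd ++ z :: k) then
      walkWeight θ E x (l ++ (true, z) :: k.map (Prod.mk false)) else 0)
      = if endpoint z k = x then (if Unmarked x (l.map Prod.snd ++ z :: k) then
      walkWeight θ E x (l ++ (true, z) :: k.map (Prod.mk false)) else 0) else 0 := by
    intro x
    split_ifs <;> simp_all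
  simp only [h3]
  rw [Finset.sum_ite_eq, if_pos (Finset.mem_univ _), walkWeight_rotate hE]
  split_ifs <;> simp

/-- The comparison of the total weight with the chain of depths. -/
theorem norm_unmarkedSum_sub_le {θ σ K Γ : ℝ} {L : ℕ} (hσ : 0 < σ) (hθ : σ < θ) (hK : 1 ≤ K)
    (hΓ : 1 ≤ Γ) (hV : 0 < Fintype.card V) (hLN : L ≤ Fintype.card V)
    (hηL : 34 * Γ ^ 2 * K * L / Fintype.card V * L ≤ 1)
    {E : List (V × V) → 𝕜} (hE : ArcWeights σ K E) :
    ‖unmarkedSum θ E L -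
        ((θ * ∑ r ∈ Finset.range L, chainWeight θ σ r (L - 1 - r) : ℝ) : 𝕜)‖
      ≤ θ * ∑ r ∈ Finset.range L, (9 / Γ * ((2 * σ) ^ r * rho θ σ ^ (L - 1 - r))
          + 9 * θ / σ * (2 * σ) ^ (L - 1)
          + L ^ 2 / Fintype.card V * chainWeight θ σ r (L - 1 - r)) := by
  classical
  have h0 : 0 < θ := hσ.trans hθ
  have hN : (0 : ℝ) < Fintype.card V := by exact_mod_cast hV
  set N : ℝ := (Fintype.card V : ℝ) with hNdef
  have hc : ∑ r ∈ Finset.range L, chainWeight θ σ r (L - 1 - r)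
      = 1 / N * ∑ r ∈ Finset.range L, ∑ _z : V, chainWeight θ σ r (L - 1 - r) := by
    simp only [Finset.sum_const, Finset.card_univ, nsmul_eq_mul, ← Finset.mul_sum]
    rw [← hNdef]
    field_simp
  have e1 : unmarkedSum θ E L -
        ((θ * ∑ r ∈ Finset.range L, chainWeight θ σ r (L - 1 - r) : ℝ) : 𝕜)
      = ((θ / N : ℝ) : 𝕜) * ∑ r ∈ Finset.range L, ∑ z : V, ((listSum r fun k : List V =>
          listSum (L - 1 - r) fun l : List (Bool × V) =>
          if Unmarked (endpoint z k) (l.map Prod.snd ++ z :: k) then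
          walkWeight θ E z (k.map (Prod.mk false) ++ l) else 0)
          - ((chainWeight θ σ r (L - 1 - r) : ℝ) : 𝕜)) := by
    rw [unmarkedSum_eq hE, hc, ← hNdef]
    simp only [Finset.sum_sub_distrib, mul_sub, RCLike.ofReal_mul, RCLike.ofReal_sum,
      RCLike.ofReal_div, RCLike.ofReal_one]
    ring
  rw [e1, norm_mul, RCLike.norm_ofReal, abs_of_nonneg (by positivity), Finset.mul_sum]
  refine (mul_le_mul_of_nonneg_left (norm_sum_le _ _) (by positivity)).trans ?_
  rw [Finset.mul_sum]
  refine Finset.sum_le_sum fun r hr => ?_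
  have hr' := Finset.mem_range.1 hr
  set n := L - 1 - r with hn
  have key : ∀ z : V, ‖(listSum r fun k : List V => listSum n fun l : List (Bool × V) =>
          if Unmarked (endpoint z k) (l.map Prod.snd ++ z :: k) then
          walkWeight θ E z (k.map (Prod.mk false) ++ l) else 0)
          - ((chainWeight θ σ r n : ℝ) : 𝕜)‖
      ≤ 9 / Γ * ((2 * σ) ^ r * rho θ σ ^ n) + 9 * θ / σ * (2 * σ) ^ (L - 1)
          + L ^ 2 / N * chainWeight θ σ r n := by
    intro z
    set D := (opW σ K 0)^[r] (fun h => if h.opn = 0 then 0 else (opM θ σ K 0)^[n] closed h)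
      (init z) with hD
    have hb := chainWeight_bounds (σ := σ) (K := K) h0.le hLN (by omega : r + n ≤ L) z
    rw [← hD] at hb
    have hD' : D = listSum r fun k : List V => listSum n fun l : List (Bool × V) =>
        wprod θ σ K 0 (init z) (k.map (Prod.mk false) ++ l)
          * closed ((init z).run (k.map (Prod.mk false) ++ l))
          * (if ((init z).run (k.map (Prod.mk false))).opn = 0 then 0 else 1) := by
      rw [hD, ← listSum_wprod_random θ]
      refine listSum_congr fun k _ => ?_
      rw [← listSum_wprod]
      split_ifs
      · simp [listSum_zero]
      · rw [← listSum_mul_left]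
        refine listSum_congr fun l _ => ?_
        rw [wprod_append, run_append]
        ring
    -- With q = σ²/θ both q + σ²/q and q + θ equal ρ_θ.
    have b1 := iterate_opW_iterate_opM_le (r := r) (n := n) (q := σ ^ 2 / θ) (lam := rho θ σ) hLN
      (by omega) hσ h0.le (by positivity) (by rw [div_le_iff₀ h0]; nlinarith) hK hΓ
      (by unfold rho; rw [div_div_eq_mul_div, mul_div_cancel_left₀ θ (by positivity)]; linarith)
      (by unfold rho; linarith) hηL z
    have b2 := iterate_opW_iterate_opM_le (r := r) (n := n) (θ := σ) (q := σ) (lam := 2 * σ) hLN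
      (by omega) hσ hσ.le hσ le_rfl hK hΓ
      (by rw [pow_two, mul_div_assoc, div_self hσ.ne']; linarith) (by linarith) hηL z
    have ecast : ((D : ℝ) : 𝕜) = listSum r fun k : List V => listSum n fun l : List (Bool × V) =>
        ((wprod θ σ K 0 (init z) (k.map (Prod.mk false) ++ l)
          * closed ((init z).run (k.map (Prod.mk false) ++ l))
          * (if ((init z).run (k.map (Prod.mk false))).opn = 0 then 0 else 1) : ℝ) : 𝕜) := by
      rw [hD']
      simp only [listSum_ofFn, RCLike.ofReal_sum]
    have b3 : ‖(listSum r fun k : List V => listSum n fun l : List (Bool × V) =>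
          if Unmarked (endpoint z k) (l.map Prod.snd ++ z :: k) then
          walkWeight θ E z (k.map (Prod.mk false) ++ l) else 0) - ((D : ℝ) : 𝕜)‖
        ≤ 1 / Γ * (9 * ((2 * σ) ^ r * rho θ σ ^ n)) + θ / σ * (9 * ((2 * σ) ^ r * (2 * σ) ^ n)) := by
      have hΓ0 : 0 < Γ := by linarith
      have := mul_le_mul_of_nonneg_left b1 (by positivity : 0 ≤ 1 / Γ)
      have h' := mul_le_mul_of_nonneg_left b2 (by positivity : 0 ≤ θ / σ)
      refine le_trans ?_ (add_le_add this h')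
      rw [← listSum_listSum_wprod, ← listSum_listSum_wprod, ecast]
      simp only [← listSum_mul_left, ← listSum_add]
      simp only [listSum_ofFn, ← Finset.sum_sub_distrib]
      refine (norm_sum_le _ _).trans (Finset.sum_le_sum fun f _ => (norm_sum_le _ _).trans
        (Finset.sum_le_sum fun g _ => ?_))
      exact norm_indicator_mul_walkWeight_sub_le hσ h0.le (by linarith) hΓ hE z _ _
    have hcw := chainWeight_nonneg h0.le r n (σ := σ)
    -- Bernoulli's inequality turns the at most L losses of 1 - L/N into 1 - L²/N.
    have b4 : |D - chainWeight θ σ r n| ≤ L ^ 2 / N * chainWeight θ σ r n := by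
      have hx : (L : ℝ) / N ≤ 1 := by
        rw [div_le_one hN, hNdef]; exact_mod_cast hLN
      have hx0 : (0 : ℝ) ≤ L / N := by positivity
      have hbern := one_add_mul_le_pow (a := -(L / N : ℝ)) (by linarith) (r + n)
      have hrn : ((r + n : ℕ) : ℝ) ≤ L := by exact_mod_cast (by omega : r + n ≤ L)
      have h5 : 1 - (L : ℝ) ^ 2 / N ≤ (1 - L / N) ^ (r + n) := by
        have h6 : ((r + n : ℕ) : ℝ) * (L / N) ≤ L * (L / N) := by gcongr
        have h7 : (L : ℝ) * (L / N) = L ^ 2 / N := by ring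
        have h8 : (1 + -(L / N : ℝ)) = 1 - L / N := by ring
        rw [h8] at hbern
        linarith
      have h9 := mul_le_mul_of_nonneg_right h5 hcw
      have h10 : (0 : ℝ) ≤ L ^ 2 / N * chainWeight θ σ r n := by positivity
      rw [abs_le]
      constructor
      · linarith [hb.1]
      · linarith [hb.2]
    have e3 : (2 * σ) ^ r * (2 * σ) ^ n = (2 * σ) ^ (L - 1) := by
      rw [← pow_add]; congr 1; omega
    rw [e3] at b3
    have b5 := norm_sub_le_norm_sub_add_norm_sub (listSum r fun k : List V =>
        listSum n fun l : List (Bool × V) =>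
          if Unmarked (endpoint z k) (l.map Prod.snd ++ z :: k) then
          walkWeight θ E z (k.map (Prod.mk false) ++ l) else 0) ((D : ℝ) : 𝕜)
        ((chainWeight θ σ r n : ℝ) : 𝕜)
    rw [← RCLike.ofReal_sub, RCLike.norm_ofReal] at b5
    refine b5.trans ((add_le_add b3 b4).trans (le_of_eq ?_))
    ring
  refine (mul_le_mul_of_nonneg_left ((norm_sum_le _ _).trans (Finset.sum_le_sum fun z _ => key z))
    (by positivity)).trans (le_of_eq ?_)
  rw [Finset.sum_const, Finset.card_univ, nsmul_eq_mul, ← hNdef]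
  field_simp

end WalkState

/-! ### Edge weights and moments -/

namespace WalkState

variable {V : Type*} [Fintype V] [DecidableEq V]

lemma edgeWeight_two_mul_succ (σ K : ℝ) (e : Sym2 V) (j : ℕ) :
    edgeWeight σ K e (2 * (j + 1))
      = σ ^ 2 * (edgeFactor K e (2 * j) / Fintype.card V * edgeWeight σ K e (2 * j)) := by
  have h1 : 2 * (j + 1) = 2 * j + 1 + 1 := by ring
  have h2 : Odd (2 * j + 1) := ⟨j, rfl⟩
  have h3 : ¬ Odd (2 * j) := by simp
  rw [h1, edgeWeight, edgeWeight, if_pos h2, if_neg h3]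

/-- There is one factor 2K fewer than openings because the first opening is exact: the variance off
the diagonal is σ². For loops only an upper bound is known, and every opening costs 2K. -/
lemma edgeWeight_of_not_isDiag (σ K : ℝ) {e : Sym2 V} (he : ¬ e.IsDiag) (j : ℕ) :
    edgeWeight σ K e (2 * (j + 1))
      = (σ ^ 2 / Fintype.card V) ^ (j + 1) * (2 * K) ^ j * (j + 1).factorial := by
  induction j with
  | zero => simp [edgeFactor, he, edgeWeight]; ring
  | succ j ih =>
    rw [edgeWeight_two_mul_succ, ih, edgeFactor, if_pos (Or.inr (by omega)),
      Nat.factorial_succ (j + 1)]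
    push_cast
    ring

lemma edgeWeight_of_isDiag (σ K : ℝ) {e : Sym2 V} (he : e.IsDiag) (j : ℕ) :
    edgeWeight σ K e (2 * j)
      = (σ ^ 2 / Fintype.card V) ^ j * (2 * K) ^ j * j.factorial := by
  induction j with
  | zero => simp [edgeWeight]
  | succ j ih =>
    rw [edgeWeight_two_mul_succ, ih, edgeFactor, if_pos (Or.inl he), Nat.factorial_succ j]
    push_cast
    ring

end WalkState

lemma pow_self_le_factorial (k : ℕ) : (k : ℝ) ^ k ≤ 3 ^ k * k.factorial := by
  have h1 := Real.pow_div_factorial_le_exp (k : ℝ) (Nat.cast_nonneg k) k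
  have h2 : Real.exp k ≤ 3 ^ k := by
    rw [← mul_one (k : ℝ), Real.exp_nat_mul]
    exact pow_le_pow_left₀ (Real.exp_pos 1).le Real.exp_one_lt_three.le k
  rw [div_le_iff₀ (by positivity)] at h1
  refine h1.trans ?_
  gcongr

/-! ### An abstract model of Wigner matrices -/

/-- The properties of real and complex Wigner matrices that determine the limit. -/
structure WignerModel {Ω 𝕜 : Type*} [MeasurableSpace Ω] [RCLike 𝕜] (P : Measure Ω)
    (σ β C : ℝ) (N : ℕ) (W : Ω → Matrix (Fin N) (Fin N) 𝕜) : Prop where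
  measurable : ∀ i j, Measurable fun ω => W ω i j
  hermitian : ∀ ω, (W ω).IsHermitian
  integral_prod : ∀ a b : Sym2 (Fin N) → ℕ,
    ∫ ω, ∏ e : Sym2 (Fin N), W ω e.inf e.sup ^ a e * starRingEnd 𝕜 (W ω e.inf e.sup) ^ b e ∂P
      = ∏ e : Sym2 (Fin N),
        ∫ ω, W ω e.inf e.sup ^ a e * starRingEnd 𝕜 (W ω e.inf e.sup) ^ b e ∂P
  odd : ∀ i j a b, i ≤ j → Odd (a + b) → ∫ ω, W ω i j ^ a * starRingEnd 𝕜 (W ω i j) ^ b ∂P = 0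
  variance : ∀ i j, i < j → ∫ ω, ‖W ω i j‖ ^ 2 ∂P = σ ^ 2
  variance_diag : ∀ i, ∫ ω, ‖W ω i i‖ ^ 2 ∂P ≤ C
  moments : ∀ i j (k : ℕ), i ≤ j → 2 ≤ k → Integrable (fun ω => ‖W ω i j‖ ^ (2 * k)) P ∧
    ∫ ω, ‖W ω i j‖ ^ (2 * k) ∂P ≤ (β * k) ^ k

/-- The growth constant of the edge weights that dominate the moments. -/
noncomputable def growthConst (σ β C : ℝ) : ℝ := (1 + 3 * |β| / σ ^ 2) ^ 2 + |C| / σ ^ 2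

lemma one_le_growthConst (σ β C : ℝ) : 1 ≤ growthConst σ β C := by
  unfold growthConst
  have h1 : 0 ≤ 3 * |β| / σ ^ 2 := by positivity
  have h2 : 0 ≤ |C| / σ ^ 2 := by positivity
  nlinarith

/-- Only j - 1 factors 2K are available to absorb a j-th power. Since j ≤ 2(j - 1), the square in
`growthConst` suffices. -/
lemma moment_bound_le {σ β C : ℝ} (hσ : 0 < σ) (j : ℕ) (hj : 2 ≤ j) :
    (β * j) ^ j ≤ (σ ^ 2) ^ j * (2 * growthConst σ β C) ^ (j - 1) * j.factorial := by
  set B := 1 + 3 * |β| / σ ^ 2 with hB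
  have h1 : 0 ≤ 3 * |β| / σ ^ 2 := by positivity
  have hB1 : 1 ≤ B := by linarith
  have hBK : B ^ 2 ≤ 2 * growthConst σ β C := by
    have h2 : 0 ≤ |C| / σ ^ 2 := by positivity
    unfold growthConst
    rw [← hB]
    nlinarith
  have h2 : (β * j) ^ j ≤ (|β|) ^ j * (j : ℝ) ^ j := by
    rw [← mul_pow]
    refine (le_abs_self _).trans ?_
    rw [abs_pow, abs_mul, Nat.abs_cast]
  have h3 : (3 * |β|) ^ j ≤ (σ ^ 2) ^ j * B ^ j := by
    rw [← mul_pow]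
    refine pow_le_pow_left₀ (by positivity) ?_ j
    have : σ ^ 2 * (3 * |β| / σ ^ 2) = 3 * |β| := by field_simp
    nlinarith [sq_nonneg σ]
  have h4 : B ^ j ≤ (2 * growthConst σ β C) ^ (j - 1) := by
    refine le_trans ?_ (pow_le_pow_left₀ (by positivity) hBK (j - 1))
    rw [← pow_mul]
    exact pow_le_pow_right₀ hB1 (by omega)
  calc (β * j) ^ j ≤ (|β|) ^ j * (3 ^ j * j.factorial) :=
        h2.trans (mul_le_mul_of_nonneg_left (pow_self_le_factorial j) (by positivity))
    _ = (3 * |β|) ^ j * j.factorial := by rw [mul_pow]; ring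
    _ ≤ (σ ^ 2) ^ j * B ^ j * j.factorial := by gcongr
    _ ≤ _ := by gcongr

/-! ### #### Means of products of entries -/

namespace WignerModel

variable {Ω 𝕜 : Type*} [MeasurableSpace Ω] [RCLike 𝕜] {P : Measure Ω} [IsProbabilityMeasure P]
  {σ β C : ℝ} {N : ℕ} {W : Ω → Matrix (Fin N) (Fin N) 𝕜}

lemma apply_eq (hW : WignerModel P σ β C N W) (ω : Ω) (i j : Fin N) :
    W ω i j = if i ≤ j then W ω (s(i, j)).inf (s(i, j)).sup
      else starRingEnd 𝕜 (W ω (s(i, j)).inf (s(i, j)).sup) := by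
  split_ifs with h
  · simp [h]
  · have h' : j ≤ i := (not_le.1 h).le
    simp only [Sym2.inf_mk, Sym2.sup_mk, inf_eq_right.2 h', sup_eq_left.2 h']
    exact ((hW.hermitian ω).apply i j).symm

lemma norm_symm (hW : WignerModel P σ β C N W) (ω : Ω) (i j : Fin N) :
    ‖W ω i j‖ = ‖W ω j i‖ := by
  rw [← (hW.hermitian ω).apply i j, norm_star]

lemma integrable_norm_pow (hW : WignerModel P σ β C N W) (i j : Fin N) (n : ℕ) :
    Integrable (fun ω => ‖W ω i j‖ ^ n) P := by
  -- The shift by 2 keeps the order in the range k ≥ 2 where moments are assumed.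
  have h2 : Integrable (fun ω => ‖W ω i j‖ ^ (2 * (n + 2))) P := by
    rcases le_total i j with h | h
    · exact (hW.moments i j (n + 2) h (by omega)).1
    · simpa only [hW.norm_symm _ i j] using (hW.moments j i (n + 2) h (by omega)).1
  refine ((integrable_const (1 : ℝ)).add h2).mono'
    ((hW.measurable i j).norm.pow_const n).aestronglyMeasurable (ae_of_all _ fun ω => ?_)
  rw [Real.norm_of_nonneg (by positivity)]
  simp only [Pi.add_apply]
  rcases le_total ‖W ω i j‖ 1 with h | h
  · have := pow_le_one₀ (n := n) (norm_nonneg _) h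
    have h3 : 0 ≤ ‖W ω i j‖ ^ (2 * (n + 2)) := by positivity
    linarith
  · have := pow_le_pow_right₀ h (by omega : n ≤ 2 * (n + 2))
    linarith

/-- All powers are carried through the induction because (xy)^n is bounded by x^(2n) + y^(2n). No
independence is needed. -/
lemma integrable_prod (hW : WignerModel P σ β C N W) (c : 𝕜) (m : List (Fin N × Fin N)) :
    (∀ n : ℕ, Integrable (fun ω => ‖(m.map fun a => W ω a.1 a.2 / c).prod‖ ^ n) P) ∧
      Measurable fun ω => (m.map fun a => W ω a.1 a.2 / c).prod := by
  induction m with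
  | nil => exact ⟨fun n => by simp, by simp⟩
  | cons a m ih =>
    have hm : Measurable fun ω => ((a :: m).map fun a => W ω a.1 a.2 / c).prod := by
      simp only [List.map_cons, List.prod_cons]
      exact ((hW.measurable a.1 a.2).div_const c).mul ih.2
    refine ⟨fun n => ?_, hm⟩
    have h1 := ((hW.integrable_norm_pow a.1 a.2 (2 * n)).const_mul ((‖c‖ ^ (2 * n))⁻¹)).add
      (ih.1 (2 * n))
    refine h1.mono' (hm.norm.pow_const n).aestronglyMeasurable (ae_of_all _ fun ω => ?_)
    rw [Real.norm_of_nonneg (by positivity)]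
    simp only [List.map_cons, List.prod_cons, norm_mul, mul_pow, Pi.add_apply]
    set x := ‖W ω a.1 a.2 / c‖ ^ n
    set y := ‖(m.map fun a => W ω a.1 a.2 / c).prod‖ ^ n with hy
    have hx : (‖c‖ ^ (2 * n))⁻¹ * ‖W ω a.1 a.2‖ ^ (2 * n) = x ^ 2 := by
      simp only [x, norm_div]
      rw [div_pow, div_pow, ← pow_mul, ← pow_mul, mul_comm n 2]
      ring
    have hy2 : ‖(m.map fun a => W ω a.1 a.2 / c).prod‖ ^ (2 * n) = y ^ 2 := by
      rw [hy, ← pow_mul, mul_comm]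
    rw [hx, hy2]
    nlinarith [sq_nonneg (x - y), sq_nonneg (x + y), sq_nonneg x, sq_nonneg y]

/-- The number of passages of an edge in increasing direction. -/
def up (m : List (Fin N × Fin N)) (e : Sym2 (Fin N)) : ℕ :=
  m.countP fun a => s(a.1, a.2) = e ∧ a.1 ≤ a.2

/-- The number of passages of an edge in decreasing direction. -/
def down (m : List (Fin N × Fin N)) (e : Sym2 (Fin N)) : ℕ :=
  m.countP fun a => s(a.1, a.2) = e ∧ ¬ a.1 ≤ a.2

lemma up_add_down (m : List (Fin N × Fin N)) (e : Sym2 (Fin N)) :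
    up m e + down m e = passages m e := by
  induction m with
  | nil => rfl
  | cons a m ih =>
    rw [passages_cons, ← ih, up, down, List.countP_cons, List.countP_cons]
    simp only [up, down, decide_eq_true_eq]
    by_cases h1 : s(a.1, a.2) = e <;> by_cases h2 : a.1 ≤ a.2 <;> simp [h1, h2] <;> omega

lemma prod_map_eq (hW : WignerModel P σ β C N W) (ω : Ω) (m : List (Fin N × Fin N)) :
    (m.map fun a => W ω a.1 a.2).prod = ∏ e : Sym2 (Fin N),
      W ω e.inf e.sup ^ up m e * starRingEnd 𝕜 (W ω e.inf e.sup) ^ down m e := by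
  induction m with
  | nil => simp [up, down]
  | cons a m ih =>
    rw [List.map_cons, List.prod_cons, ih, ← Finset.mul_prod_erase _ _ (Finset.mem_univ s(a.1, a.2)),
      ← Finset.mul_prod_erase Finset.univ (fun e : Sym2 (Fin N) => W ω e.inf e.sup ^ up (a :: m) e
        * starRingEnd 𝕜 (W ω e.inf e.sup) ^ down (a :: m) e) (Finset.mem_univ s(a.1, a.2)),
      ← mul_assoc]
    congr 1
    · rw [hW.apply_eq ω a.1 a.2, up, down, up, down, List.countP_cons, List.countP_cons]
      by_cases h : a.1 ≤ a.2
      · simp only [h, if_true, true_and, not_true_eq_false, and_false, decide_false, decide_true,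
          Bool.false_eq_true, if_false, add_zero, pow_succ]
        ring
      · simp only [h, if_false, true_and, not_false_eq_true, and_false, decide_false, decide_true,
          Bool.false_eq_true, add_zero, if_true, pow_succ]
        ring
    · refine Finset.prod_congr rfl fun e he => ?_
      have he' : s(a.1, a.2) ≠ e := (Finset.ne_of_mem_erase he).symm
      simp [up, down, he']

/-- The expectation of a product of normalized entries. -/
noncomputable def arcMean (P : Measure Ω) (W : Ω → Matrix (Fin N) (Fin N) 𝕜)
    (m : List (Fin N × Fin N)) : 𝕜 :=
  ∫ ω, (m.map fun a => W ω a.1 a.2 / ((√(N : ℝ) : ℝ) : 𝕜)).prod ∂P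

lemma sum_passages (m : List (Fin N × Fin N)) : ∑ e, passages m e = m.length := by
  induction m with
  | nil => simp
  | cons a m ih => simp [passages_cons, Finset.sum_add_distrib, ih]

lemma arcMean_eq (hW : WignerModel P σ β C N W) (m : List (Fin N × Fin N)) :
    arcMean P W m = ∏ e : Sym2 (Fin N), (((√(N : ℝ) : ℝ) : 𝕜)⁻¹ ^ passages m e *
      ∫ ω, W ω e.inf e.sup ^ up m e * starRingEnd 𝕜 (W ω e.inf e.sup) ^ down m e ∂P) := by
  have h1 : ∀ ω, (m.map fun a => W ω a.1 a.2 / ((√(N : ℝ) : ℝ) : 𝕜)).prod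
      = ((√(N : ℝ) : ℝ) : 𝕜)⁻¹ ^ m.length * (m.map fun a => W ω a.1 a.2).prod := by
    intro ω
    induction m with
    | nil => simp
    | cons a m ih => rw [List.map_cons, List.prod_cons, ih]; simp; ring
  rw [arcMean]
  simp only [h1, hW.prod_map_eq]
  rw [integral_const_mul, hW.integral_prod, Finset.prod_mul_distrib, Finset.prod_pow_eq_pow_sum,
    sum_passages]

lemma inf_lt_sup {e : Sym2 (Fin N)} (he : ¬ e.IsDiag) : e.inf < e.sup := by
  induction e with
  | _ a b =>
    have : a ≠ b := by simpa using he
    simpa using this.symm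

lemma inf_eq_sup {e : Sym2 (Fin N)} (he : e.IsDiag) : e.inf = e.sup := by
  induction e with
  | _ a b =>
    have : a = b := by simpa using he
    simp [this]

lemma mk_inf_sup (e : Sym2 (Fin N)) : s(e.inf, e.sup) = e := by
  induction e with
  | _ a b => rcases le_total a b with h | h <;> simp [h, Sym2.eq_swap]

lemma moment_le_edgeWeight (hW : WignerModel P σ β C N W) (hσ : 0 < σ) (e : Sym2 (Fin N))
    (j : ℕ) : (1 / (N : ℝ)) ^ j * ∫ ω, ‖W ω e.inf e.sup‖ ^ (2 * j) ∂P
      ≤ WalkState.edgeWeight σ (growthConst σ β C) e (2 * j) := by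
  have hK := one_le_growthConst σ β C
  have hmom : 2 ≤ j → ∫ ω, ‖W ω e.inf e.sup‖ ^ (2 * j) ∂P
      ≤ (σ ^ 2) ^ j * (2 * growthConst σ β C) ^ (j - 1) * j.factorial := fun hj =>
    (hW.moments _ _ j e.inf_le_sup hj).2.trans (moment_bound_le hσ j hj)
  by_cases he : e.IsDiag
  · rw [WalkState.edgeWeight_of_isDiag _ _ he, Fintype.card_fin]
    have key : ∫ ω, ‖W ω e.inf e.sup‖ ^ (2 * j) ∂P
        ≤ (σ ^ 2) ^ j * (2 * growthConst σ β C) ^ j * j.factorial := by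
      rcases Nat.lt_or_ge j 2 with hj | hj
      · interval_cases j
        · simp
        · rw [← inf_eq_sup he]
          refine (hW.variance_diag e.inf).trans ?_
          have h2 : |C| / σ ^ 2 ≤ growthConst σ β C := by
            unfold growthConst
            have : 0 ≤ (1 + 3 * |β| / σ ^ 2) ^ 2 := by positivity
            linarith
          rw [div_le_iff₀ (by positivity)] at h2
          have h3 := le_abs_self C
          have h4 := abs_nonneg C
          simp only [pow_one, Nat.factorial_one, Nat.cast_one, mul_one]
          nlinarith
      · refine (hmom hj).trans ?_
        gcongr
        · linarith
        · omega
    calc _ ≤ (1 / (N : ℝ)) ^ j * ((σ ^ 2) ^ j * (2 * growthConst σ β C) ^ j * j.factorial) := by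
          gcongr
      _ = _ := by rw [div_pow, div_pow]; ring
  · cases j with
    | zero => simp [WalkState.edgeWeight]
    | succ j =>
      rw [WalkState.edgeWeight_of_not_isDiag _ _ he, Fintype.card_fin]
      have key : ∫ ω, ‖W ω e.inf e.sup‖ ^ (2 * (j + 1)) ∂P
          ≤ (σ ^ 2) ^ (j + 1) * (2 * growthConst σ β C) ^ j * (j + 1).factorial := by
        rcases Nat.eq_zero_or_pos j with hj | hj
        · subst hj
          simp [hW.variance _ _ (inf_lt_sup he)]
        · simpa using hmom (by omega)
      calc _ ≤ (1 / (N : ℝ)) ^ (j + 1) * ((σ ^ 2) ^ (j + 1) * (2 * growthConst σ β C) ^ j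
            * (j + 1).factorial) := by gcongr
        _ = _ := by rw [div_pow, div_pow]; ring

lemma up_eq_count {u v : Fin N} (h : u < v) (m : List (Fin N × Fin N)) :
    up m s(u, v) = m.count (u, v) := by
  rw [up, List.count]
  refine List.countP_congr fun a _ => ?_
  simp only [decide_eq_true_eq, beq_iff_eq, Sym2.eq_iff]
  constructor
  · rintro ⟨h1 | h1, h2⟩
    · exact Prod.ext h1.1 h1.2
    · rw [h1.1, h1.2] at h2; exact absurd h2 (not_le.2 h)
  · rintro rfl; exact ⟨Or.inl ⟨rfl, rfl⟩, h.le⟩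

lemma down_eq_count {u v : Fin N} (h : u < v) (m : List (Fin N × Fin N)) :
    down m s(u, v) = m.count (v, u) := by
  rw [down, List.count]
  refine List.countP_congr fun a _ => ?_
  simp only [decide_eq_true_eq, beq_iff_eq, Sym2.eq_iff]
  constructor
  · rintro ⟨h1 | h1, h2⟩
    · rw [h1.1, h1.2] at h2; exact absurd h.le h2
    · exact Prod.ext h1.1 h1.2
  · rintro rfl; exact ⟨Or.inr ⟨rfl, rfl⟩, not_le.2 h⟩

lemma inv_sqrt_pow (j : ℕ) : (√(N : ℝ))⁻¹ ^ (2 * j) = (1 / (N : ℝ)) ^ j := by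
  rw [pow_mul, inv_pow, Real.sq_sqrt (Nat.cast_nonneg N), one_div]

theorem arcWeights (hW : WignerModel P σ β C N W) (hσ : 0 < σ) :
    ArcWeights σ (growthConst σ β C) (arcMean P W) where
  perm m m' h := by
    rw [arcMean, arcMean]
    congr 1
    ext ω
    exact (h.map _).prod_eq
  odd m e he := by
    rw [hW.arcMean_eq]
    refine Finset.prod_eq_zero (Finset.mem_univ e) ?_
    rw [hW.odd _ _ _ _ e.inf_le_sup (by rwa [up_add_down]), mul_zero]
  norm_le m hm := by
    rw [hW.arcMean_eq, norm_prod]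
    refine Finset.prod_le_prod (fun e _ => norm_nonneg _) fun e _ => ?_
    obtain ⟨j, hj⟩ := hm e
    rw [← two_mul] at hj
    refine le_trans ?_ ((hW.moment_le_edgeWeight hσ e j).trans_eq (by rw [hj]))
    rw [norm_mul, norm_pow, norm_inv, RCLike.norm_ofReal, abs_of_nonneg (Real.sqrt_nonneg _), hj,
      inv_sqrt_pow]
    gcongr
    refine (norm_integral_le_integral_norm _).trans (le_of_eq ?_)
    congr 1
    ext ω
    rw [norm_mul, norm_pow, norm_pow, RCLike.norm_conj, ← pow_add, up_add_down, hj]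
  eq_of_balanced m h1 h2 h3 := by
    rw [hW.arcMean_eq, RCLike.ofReal_prod]
    refine Finset.prod_congr rfl fun e _ => ?_
    by_cases he : e.IsDiag
    · have h0 : passages m e = 0 := passages_eq_zero fun a ha hae => by
        rw [← hae] at he
        exact h3 a ha (by simpa using he)
      have h4 := up_add_down m e
      have h5 : up m e = 0 := by omega
      have h6 : down m e = 0 := by omega
      rw [h0, h5, h6]
      simp [WalkState.edgeWeight]
    · have hlt := inf_lt_sup he
      have h4 := up_add_down m e
      have h5 : up m e = down m e := by
        have e1 := up_eq_count hlt m
        have e2 := down_eq_count hlt m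
        rw [mk_inf_sup] at e1 e2
        rw [e1, e2]
        exact h1 _ _
      have h6 := h2 e
      rcases Nat.eq_zero_or_pos (up m e) with h7 | h7
      · have h0 : passages m e = 0 := by omega
        rw [h0, ← h5, h7]
        simp [WalkState.edgeWeight]
      · have h7' : up m e = 1 := by omega
        have h0 : passages m e = 2 * (0 + 1) := by omega
        -- One passage in each direction gives |W|², whose mean is the variance.
        have h8 : ∀ ω, W ω e.inf e.sup ^ 1 * starRingEnd 𝕜 (W ω e.inf e.sup) ^ 1
            = ((‖W ω e.inf e.sup‖ ^ 2 : ℝ) : 𝕜) := by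
          intro ω
          rw [pow_one, pow_one, RCLike.mul_conj]
          push_cast
          rfl
        rw [h0, ← h5, h7']
        simp only [h8]
        rw [integral_ofReal, hW.variance _ _ hlt, WalkState.edgeWeight_of_not_isDiag _ _ he,
          ← RCLike.ofReal_inv, ← RCLike.ofReal_pow, inv_sqrt_pow, Fintype.card_fin]
        push_cast
        simp
        ring

end WignerModel

/-! ### Real and complex Wigner matrices -/

lemma neg_pow_mul_conj_neg_pow {𝕜 : Type*} [RCLike 𝕜] (x : 𝕜) {a b : ℕ} (h : Odd (a + b)) :
    (-x) ^ a * starRingEnd 𝕜 (-x) ^ b = -(x ^ a * starRingEnd 𝕜 x ^ b) := by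
  rw [map_neg, neg_pow x, neg_pow (starRingEnd 𝕜 x)]
  have : (-1 : 𝕜) ^ a * (-1) ^ b = -1 := by rw [← pow_add, h.neg_one_pow]
  linear_combination (x ^ a * starRingEnd 𝕜 x ^ b) * this

section Group

variable {Ω : Type*} [mΩ : MeasurableSpace Ω] {P : Measure Ω}

/-- Functions of disjoint groups of independent variables have a multiplicative mean. -/
lemma integral_prod_of_disjoint {ι κ : Type*} {X : ι → Ω → ℝ}
    (hX : iIndepFun X P) (mX : ∀ i, Measurable (X i)) (S : κ → Set ι)
    (hS : ∀ e e', e ≠ e' → Disjoint (S e) (S e')) (g : κ → Ω → ℂ)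
    (hg : ∀ e, Measurable[⨆ i ∈ S e, MeasurableSpace.comap (X i) inferInstance] (g e))
    (s : Finset κ) : ∫ ω, ∏ e ∈ s, g e ω ∂P = ∏ e ∈ s, ∫ ω, g e ω ∂P := by
  classical
  have := hX.isProbabilityMeasure
  have hle : ∀ i, MeasurableSpace.comap (X i) inferInstance ≤ mΩ := fun i => (mX i).comap_le
  have hsup : ∀ T : Set ι, ⨆ i ∈ T, MeasurableSpace.comap (X i) inferInstance ≤ mΩ :=
    fun T => iSup₂_le fun i _ => hle i
  induction s using Finset.induction_on with
  | empty => simp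
  | insert e s he ih =>
    simp only [Finset.prod_insert he]
    rw [← ih]
    have h1 : Disjoint (S e) (⋃ e' ∈ s, S e') := by
      rw [Set.disjoint_iUnion₂_right]
      exact fun e' he' => hS e e' fun h => he (h ▸ he')
    have h2 := indep_iSup_of_disjoint hle hX.iIndep h1
    have h3 : Measurable[⨆ i ∈ ⋃ e' ∈ s, S e', MeasurableSpace.comap (X i) inferInstance]
        (fun ω => ∏ e' ∈ s, g e' ω) := by
      refine Finset.measurable_prod s fun e' he' => ?_
      refine (hg e').mono (iSup₂_le fun i hi => ?_) le_rfl
      exact le_iSup₂ (f := fun i (_ : i ∈ ⋃ e' ∈ s, S e') =>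
        MeasurableSpace.comap (X i) inferInstance) i (Set.mem_biUnion he' hi)
    have h4 : IndepFun (g e) (fun ω => ∏ e' ∈ s, g e' ω) P := by
      rw [IndepFun_iff_Indep]
      exact indep_of_indep_of_le_left (indep_of_indep_of_le_right h2 h3.comap_le) (hg e).comap_le
    exact h4.integral_fun_mul_eq_mul_integral
      ((hg e).mono (hsup _) le_rfl).aestronglyMeasurable
      (h3.mono (hsup _) le_rfl).aestronglyMeasurable

end Group

/-- The imaginary parts on and above the diagonal. -/
lemma Matrix.IsHermitian.im_eq {N : ℕ} {A : Matrix (Fin N) (Fin N) ℂ} (hA : A.IsHermitian)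
    {i j : Fin N} (hij : i ≤ j) :
    (A i j).im = if i = j then 0 else hermCoord A (j, i) := by
  split_ifs with h
  · subst h
    have := congrArg Complex.im (hA.apply i i)
    simp only [Complex.star_def, Complex.conj_im] at this
    linarith
  · have h' : ¬ j ≤ i := fun h' => h (le_antisymm hij h')
    simp [hermCoord, h']

section Models

variable {Ω : Type*} [MeasurableSpace Ω] {P : Measure Ω} [IsProbabilityMeasure P]
  {σ β C : ℝ} {N : ℕ}

theorem IsRealWigner.wignerModel {W : Ω → Matrix (Fin N) (Fin N) ℝ}
    (hW : IsRealWigner P σ β C N W) : WignerModel P σ β C N W where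
  measurable := hW.measurable
  hermitian ω := by
    rw [Matrix.IsHermitian, Matrix.conjTranspose_eq_transpose_of_trivial]
    exact hW.symmetric ω
  integral_prod a b := by
    have h := hW.indep.precomp (g := fun e : Sym2 (Fin N) => Sym2.sortEquiv e)
      Sym2.sortEquiv.injective
    exact h.integral_fun_prod_comp (f := fun e x => x ^ a e * starRingEnd ℝ x ^ b e)
      (fun e => (hW.measurable _ _).aemeasurable)
      (fun e => Measurable.aestronglyMeasurable (by
        simp only [conj_trivial]
        fun_prop))
  odd i j a b _ hab := by
    have h := ((hW.symmetric_law i j).comp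
      (u := fun x : ℝ => x ^ a * starRingEnd ℝ x ^ b) (by
        simp only [conj_trivial]
        fun_prop)).integral_eq
    simp only [Function.comp_def, neg_pow_mul_conj_neg_pow _ hab, integral_neg] at h
    linarith
  variance i j hij := by simpa using hW.variance i j hij
  variance_diag i := by simpa using hW.variance_diag i
  moments i j k _ hk := by
    have h : ∀ ω, ‖W ω i j‖ ^ (2 * k) = W ω i j ^ (2 * k) := fun ω => by
      rw [Real.norm_eq_abs, pow_mul, sq_abs, ← pow_mul]
    simp only [h]
    exact hW.moments i j k hk

namespace IsComplexWigner

variable {W : Ω → Matrix (Fin N) (Fin N) ℂ}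

lemma measurable_hermCoord (hW : IsComplexWigner P σ β C N W) (p : Fin N × Fin N) :
    Measurable fun ω => hermCoord (W ω) p := by
  unfold hermCoord
  split_ifs
  · exact Complex.measurable_re.comp (hW.measurable _ _)
  · exact Complex.measurable_im.comp (hW.measurable _ _)

lemma re_eq {i j : Fin N} (hij : i ≤ j) (ω : Ω) :
    (W ω i j).re = hermCoord (W ω) (i, j) := by simp [hermCoord, hij]

lemma moment_re (hW : IsComplexWigner P σ β C N W) {i j : Fin N} (hij : i ≤ j) {k : ℕ}
    (hk : 2 ≤ k) : Integrable (fun ω => (W ω i j).re ^ (2 * k)) P ∧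
      ∫ ω, (W ω i j).re ^ (2 * k) ∂P ≤ (β * k) ^ k := by
  simp only [re_eq hij]
  exact hW.moments (i, j) k hk

lemma moment_im (hW : IsComplexWigner P σ β C N W) {i j : Fin N} (hij : i ≤ j) {k : ℕ}
    (hk : 2 ≤ k) : Integrable (fun ω => (W ω i j).im ^ (2 * k)) P ∧
      ∫ ω, (W ω i j).im ^ (2 * k) ∂P ≤ (β * k) ^ k := by
  simp only [(hW.hermitian _).im_eq hij]
  split_ifs with h
  -- The diagonal is real. That (βk)^k is nonnegative is read off the bound on the diagonal moment,
  -- as the sign of β is not assumed.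
  · have h1 := (hW.moments (i, j) k hk).2
    have h2 : 0 ≤ ∫ ω, hermCoord (W ω) (i, j) ^ (2 * k) ∂P :=
      integral_nonneg fun ω => by
        rw [pow_mul]
        positivity
    have h3 : 2 * k ≠ 0 := by omega
    simp only [zero_pow h3, integral_zero]
    exact ⟨integrable_zero _ _ _, h2.trans h1⟩
  · exact hW.moments (j, i) k hk

lemma integrable_sq_of_pow_four {f : Ω → ℝ} (hf : Measurable f)
    (h : Integrable (fun ω => f ω ^ (2 * 2)) P) : Integrable (fun ω => f ω ^ 2) P := by
  refine ((integrable_const (1 : ℝ)).add h).mono' (hf.pow_const 2).aestronglyMeasurable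
    (ae_of_all _ fun ω => ?_)
  rw [Real.norm_of_nonneg (sq_nonneg _)]
  simp only [Pi.add_apply]
  rw [pow_mul]
  nlinarith [sq_nonneg (f ω ^ 2 - 1), sq_nonneg (f ω)]

lemma norm_sq_eq (z : ℂ) : ‖z‖ ^ 2 = z.re ^ 2 + z.im ^ 2 := by
  rw [Complex.sq_norm, Complex.normSq_apply]
  ring

/-- The entry of an edge depends on the coordinates (i, j) and (j, i), and these groups are disjoint
for different edges. The constant doubles because |z|^(2k) is at most 2^(k-1) times the sum of the
2k-th powers of the real and imaginary parts. -/
theorem wignerModel (hW : IsComplexWigner P σ β C N W) :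
    WignerModel P σ (2 * β) C N W where
  measurable := hW.measurable
  hermitian := hW.hermitian
  integral_prod a b := by
    refine integral_prod_of_disjoint hW.indep hW.measurable_hermCoord
      (fun e => {p | s(p.1, p.2) = e}) (fun e e' hee => ?_)
      (fun e ω => W ω e.inf e.sup ^ a e * starRingEnd ℂ (W ω e.inf e.sup) ^ b e)
      (fun e => ?_) Finset.univ
    · rw [Set.disjoint_left]
      intro p hp hp'
      exact hee (hp.symm.trans hp')
    · have hH := hW.hermitian
      set m := ⨆ i ∈ {p : Fin N × Fin N | s(p.1, p.2) = e},
        MeasurableSpace.comap (fun ω => hermCoord (W ω) i) inferInstance with hm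
      have h1 : ∀ p : Fin N × Fin N, s(p.1, p.2) = e → Measurable[m] fun ω => hermCoord (W ω) p := by
        intro p hp
        refine (comap_measurable _).mono ?_ le_rfl
        exact le_iSup₂ (f := fun i (_ : i ∈ {p : Fin N × Fin N | s(p.1, p.2) = e}) =>
          MeasurableSpace.comap (fun ω => hermCoord (W ω) i) inferInstance) p hp
      have hre : Measurable[m] fun ω => (W ω e.inf e.sup).re := by
        simp only [re_eq e.inf_le_sup]
        exact h1 _ (WignerModel.mk_inf_sup e)
      have him : Measurable[m] fun ω => (W ω e.inf e.sup).im := by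
        simp only [(hH _).im_eq e.inf_le_sup]
        split_ifs
        · exact measurable_const
        · exact h1 _ (by rw [Sym2.eq_swap]; exact WignerModel.mk_inf_sup e)
      have hz : Measurable[m] fun ω => W ω e.inf e.sup := by
        have : (fun ω => W ω e.inf e.sup) = fun ω => ((W ω e.inf e.sup).re : ℂ)
            + ((W ω e.inf e.sup).im : ℂ) * Complex.I := by
          ext ω
          exact (Complex.re_add_im _).symm
        rw [this]
        exact (Complex.measurable_ofReal.comp hre).add
          ((Complex.measurable_ofReal.comp him).mul measurable_const)
      have hc : Measurable[m] fun ω => starRingEnd ℂ (W ω e.inf e.sup) :=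
        Complex.continuous_conj.measurable.comp hz
      exact (hz.pow_const _).mul (hc.pow_const _)
  odd i j a b hij hab := by
    set G : ℂ → ℂ := fun z => z ^ a * starRingEnd ℂ z ^ b with hG
    have hGm : Measurable G :=
      (measurable_id.pow_const _).mul (Complex.continuous_conj.measurable.pow_const _)
    have hneg : ∀ z, G (-z) = -G z := fun z => neg_pow_mul_conj_neg_pow z hab
    have key : ∫ ω, G (W ω i j) ∂P = ∫ ω, G (-W ω i j) ∂P := by
      rcases hij.eq_or_lt with h | h
      · subst h
        have h1 := ((hW.symmetric_law (i, i)).comp (u := fun x : ℝ => G x)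
          (hGm.comp Complex.measurable_ofReal)).integral_eq
        have h2 : ∀ ω, W ω i i = (hermCoord (W ω) (i, i) : ℂ) := fun ω => by
          apply Complex.ext
          · rw [re_eq le_rfl, Complex.ofReal_re]
          · rw [(hW.hermitian ω).im_eq le_rfl, if_pos rfl, Complex.ofReal_im]
        simp only [Function.comp_def, Complex.ofReal_neg] at h1
        simpa only [h2] using h1
      · have hne : ((i, j) : Fin N × Fin N) ≠ (j, i) := fun h' => h.ne (Prod.ext_iff.1 h').1
        have h0 := hW.indep.indepFun hne
        -- Symmetry of each coordinate gives symmetry of the pair only through independence.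
        have h1 := (hW.symmetric_law (i, j)).prodMk (hW.symmetric_law (j, i)) h0
          (h0.comp measurable_neg measurable_neg)
        have hu : Measurable fun x : ℝ × ℝ => G ((x.1 : ℂ) + (x.2 : ℂ) * Complex.I) :=
          hGm.comp ((Complex.measurable_ofReal.comp measurable_fst).add
            ((Complex.measurable_ofReal.comp measurable_snd).mul measurable_const))
        have h2 := (h1.comp hu).integral_eq
        have h3 : ∀ ω, W ω i j = (hermCoord (W ω) (i, j) : ℂ)
            + (hermCoord (W ω) (j, i) : ℂ) * Complex.I := fun ω => by
          rw [← re_eq h.le]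
          have := (hW.hermitian ω).im_eq h.le
          rw [if_neg h.ne] at this
          rw [← this]
          exact (Complex.re_add_im _).symm
        have h4 : ∀ ω, -W ω i j = ((-hermCoord (W ω) (i, j) : ℝ) : ℂ)
            + ((-hermCoord (W ω) (j, i) : ℝ) : ℂ) * Complex.I := fun ω => by
          rw [h3]
          push_cast
          ring
        simp only [h4]
        simp only [h3]
        exact h2
    simp only [hneg, integral_neg] at key
    exact self_eq_neg.1 key
  variance i j hij := by
    simp only [norm_sq_eq]
    rw [integral_add, hW.variance_re i j hij, hW.variance_im i j hij]
    · ring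
    · exact integrable_sq_of_pow_four (Complex.measurable_re.comp (hW.measurable _ _))
        (hW.moment_re hij.le le_rfl).1
    · exact integrable_sq_of_pow_four (Complex.measurable_im.comp (hW.measurable _ _))
        (hW.moment_im hij.le le_rfl).1
  variance_diag i := by
    simp only [norm_sq_eq, (hW.hermitian _).im_eq le_rfl, if_true]
    simpa using hW.variance_diag i
  moments i j k hij hk := by
    have h1 := hW.moment_re hij hk
    have h2 := hW.moment_im hij hk
    have h3 : ∀ ω, ‖W ω i j‖ ^ (2 * k)
        ≤ 2 ^ (k - 1) * ((W ω i j).re ^ (2 * k) + (W ω i j).im ^ (2 * k)) := by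
      intro ω
      rw [pow_mul, norm_sq_eq, pow_mul, pow_mul]
      exact add_pow_le (sq_nonneg _) (sq_nonneg _) k
    have h4 : Integrable (fun ω => 2 ^ (k - 1) *
        ((W ω i j).re ^ (2 * k) + (W ω i j).im ^ (2 * k))) P := (h1.1.add h2.1).const_mul _
    have h5 : Integrable (fun ω => ‖W ω i j‖ ^ (2 * k)) P :=
      h4.mono' ((hW.measurable i j).norm.pow_const _).aestronglyMeasurable
        (ae_of_all _ fun ω => by
          rw [Real.norm_of_nonneg (by positivity)]
          exact h3 ω)
    refine ⟨h5, (integral_mono h5 h4 h3).trans ?_⟩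
    rw [integral_const_mul, integral_add h1.1 h2.1]
    calc (2 : ℝ) ^ (k - 1) * (∫ ω, (W ω i j).re ^ (2 * k) ∂P + ∫ ω, (W ω i j).im ^ (2 * k) ∂P)
        ≤ 2 ^ (k - 1) * ((β * k) ^ k + (β * k) ^ k) := by
          gcongr
          · exact h1.2
          · exact h2.2
      _ = 2 ^ (k - 1 + 1) * (β * k) ^ k := by rw [pow_succ]; ring
      _ = (2 * β * k) ^ k := by
          rw [Nat.sub_add_cancel (by omega), ← mul_pow, mul_assoc]

end IsComplexWigner

end Models

/-! ### Closed paths as lists -/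

section Lists

variable {V : Type*}

lemma trail_take (x : V) (l : List V) (n : ℕ) : trail x (l.take n) = (trail x l).take n := by
  induction l generalizing x n with
  | nil => simp [trail]
  | cons y l ih => cases n <;> simp [trail, ih]

lemma length_trail (x : V) (l : List V) : (trail x l).length = l.length := by
  induction l generalizing x with
  | nil => rfl
  | cons y l ih => simp [trail, ih]

lemma trail_ofFn {L : ℕ} (p : Fin (L + 1) → V) :
    trail (p 0) (List.ofFn fun j : Fin L => p j.succ)
      = List.ofFn fun j : Fin L => (p j.castSucc, p j.succ) := by
  induction L with
  | zero => simp [trail]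
  | succ L ih =>
    have := ih fun j => p j.succ
    rw [List.ofFn_succ, List.ofFn_succ, trail]
    congr 1

lemma endpoint_ofFn {L : ℕ} (p : Fin (L + 1) → V) :
    endpoint (p 0) (List.ofFn fun j : Fin L => p j.succ) = p (Fin.last L) := by
  induction L with
  | zero => simp
  | succ L ih =>
    have := ih fun j => p j.succ
    rw [List.ofFn_succ, endpoint_cons]
    exact this

lemma passages_take_ofFn [DecidableEq V] {L : ℕ} (g : Fin L → V × V) (n : ℕ) (e : Sym2 V) :
    passages ((List.ofFn g).take n) e
      = (Finset.univ.filter fun k : Fin L => k.val < n ∧ s((g k).1, (g k).2) = e).card := by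
  induction L generalizing n with
  | zero => simp
  | succ L ih =>
    cases n with
    | zero => simp
    | succ n =>
      rw [List.ofFn_succ, List.take_succ_cons, passages_cons, ih, Fin.card_filter_univ_succ]
      simp only [Fin.val_succ, Nat.add_lt_add_iff_right, Fin.val_zero, Nat.zero_lt_succ, true_and]
      split_ifs <;> simp

/-- The expansion of a product of sums along the decorations of a walk. -/
lemma listSum_prod_add {R : Type*} [Fintype V] [CommSemiring R] (w : V × V → R) (c : R) (n : ℕ)
    (x : V) (f : List V → R) :
    listSum n (fun l => f l * ((trail x l).map fun a => w a + c).prod)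
      = listSum n fun l : List (Bool × V) => f (l.map Prod.snd) *
        (c ^ (l.countP fun s => s.1) * ((arcs false x l).map w).prod) := by
  induction n generalizing x f with
  | zero => simp [listSum, trail, arcs]
  | succ n ih =>
    simp only [listSum]
    rw [Fintype.sum_prod_type, Fintype.sum_bool, ← Finset.sum_add_distrib]
    refine Finset.sum_congr rfl fun y _ => ?_
    have h1 : ∀ l, f (y :: l) * ((trail x (y :: l)).map fun a => w a + c).prod
        = (f (y :: l) * (w (x, y) + c)) * ((trail y l).map fun a => w a + c).prod := by
      intro l
      simp [trail, mul_assoc]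
    simp only [h1]
    rw [ih y fun l => f (y :: l) * (w (x, y) + c), ← listSum_add]
    refine listSum_congr fun l _ => ?_
    simp [arcs, pow_succ]
    ring

lemma integral_listSum {S Ω 𝕜 : Type*} [Fintype S] [MeasurableSpace Ω] [RCLike 𝕜]
    {P : Measure Ω} (n : ℕ) {F : List S → Ω → 𝕜} (hF : ∀ l, Integrable (F l) P) :
    ∫ ω, listSum n (fun l => F l ω) ∂P = listSum n fun l => ∫ ω, F l ω ∂P := by
  simp only [listSum_ofFn]
  exact integral_finsetSum _ fun f _ => hF _

end Lists

namespace ClosedPath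

variable {N L : ℕ}

lemma even_passages_iff (p : ClosedPath N L) {k k' : List (Fin N)} {x : Fin N} {j : Fin L}
    (h : (List.ofFn fun i : Fin L => p.1 i.succ) = k ++ x :: k') (hj : k.length = j) :
    p.1 j.succ = x ∧
      (Even (passages (trail (p.1 0) (k ++ [x])) s(endpoint (p.1 0) k, x)) ↔ ¬ p.IsMarked j) := by
  have h1 : (p.1 j.castSucc, p.1 j.succ) = (endpoint (p.1 0) k, x) := by
    have h2 := trail_ofFn p.1
    have h3 := congrArg (fun l => l[k.length]?) h2
    simp only [h, trail_append, trail] at h3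
    rw [List.getElem?_append_right (by rw [length_trail]), length_trail, Nat.sub_self, hj] at h3
    simp at h3
    exact (Prod.ext h3.1 h3.2).symm
  have h4 : k ++ [x] = (List.ofFn fun i : Fin L => p.1 i.succ).take (j + 1) := by
    rw [h, ← hj, List.take_append]
    simp
  obtain ⟨h1a, h1b⟩ := Prod.mk.inj h1
  refine ⟨h1b, ?_⟩
  have h5 : s(endpoint (p.1 0) k, x) = p.edge j := by
    rw [edge, h1a, h1b]
  rw [h4, trail_take, trail_ofFn, passages_take_ofFn, IsMarked, Nat.not_odd_iff_even, h5]
  have h6 : (Finset.univ.filter fun i : Fin L => i.val < (j : ℕ) + 1 ∧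
      s(p.1 i.castSucc, p.1 i.succ) = p.edge j)
      = Finset.univ.filter fun i : Fin L => i ≤ j ∧ p.edge i = p.edge j := by
    refine Finset.filter_congr fun i _ => ?_
    rw [Nat.lt_succ_iff, Fin.le_def]
    rfl
  rw [h6]

/-- Splittings of the list at an occurrence of the origin correspond to the instants at which the
path reaches it. -/
lemma unmarked_iff (p : ClosedPath N L) :
    (¬ p.OriginMarked ∧ p.HasOddEdge)
      ↔ Unmarked (p.1 0) (List.ofFn fun j : Fin L => p.1 j.succ) := by
  refine and_congr ⟨fun h k k' hk => ?_, fun h => ?_⟩ ?_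
  · have hlen : k.length < L := by
      have := congrArg List.length hk
      simp at this
      omega
    have h1 := p.even_passages_iff (j := ⟨k.length, hlen⟩) hk rfl
    exact h1.2.2 fun h2 => h ⟨_, h2, h1.1⟩
  · rintro ⟨j, hj, hj0⟩
    set l := List.ofFn fun j : Fin L => p.1 j.succ with hl
    have hlen : (j : ℕ) < l.length := by simp [hl]
    have hsplit : l = l.take j ++ p.1 0 :: l.drop (j + 1) := by
      have h1 : l[(j : ℕ)] = p.1 0 := by simp [hl, hj0]
      rw [← h1, List.getElem_cons_drop, List.take_append_drop]
    have h1 := p.even_passages_iff (j := j) hsplit (by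
      rw [List.length_take]
      omega)
    exact h1.2.1 (h _ _ hsplit) hj
  · have key : ∀ e, passages (trail (p.1 0) (List.ofFn fun j : Fin L => p.1 j.succ)) e
        = (Finset.univ.filter fun k : Fin L => p.edge k = e).card := by
      intro e
      have h1 := passages_take_ofFn (fun j : Fin L => (p.1 j.castSucc, p.1 j.succ)) L e
      rw [List.take_of_length_le (by simp)] at h1
      rw [trail_ofFn, h1]
      congr 1
      refine Finset.filter_congr fun i _ => ?_
      simp only [i.isLt, true_and]
      rfl
    simp only [key]
    constructor
    · rintro ⟨j, hj⟩
      exact ⟨_, hj⟩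
    · rintro ⟨e, he⟩
      obtain ⟨j, hj⟩ := Finset.card_pos.1 he.pos
      rw [Finset.mem_filter] at hj
      refine ⟨j, ?_⟩
      rw [hj.2]
      exact he

lemma weight_eq {𝕜 : Type*} [RCLike 𝕜] (M : Matrix (Fin N) (Fin N) 𝕜) (p : ClosedPath N L) :
    p.weight M = ((trail (p.1 0) (List.ofFn fun j : Fin L => p.1 j.succ)).map
      fun a => M a.1 a.2).prod := by
  rw [trail_ofFn, List.map_ofFn, List.prod_ofFn]
  rfl

end ClosedPath

open Classical in
lemma unmarkedOriginContribution_eq {𝕜 Ω : Type*} [RCLike 𝕜] [MeasurableSpace Ω]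
    (P : Measure Ω) {N : ℕ} (M : Ω → Matrix (Fin N) (Fin N) 𝕜) (L : ℕ) :
    unmarkedOriginContribution P M L = ∑ x, listSum L fun l : List (Fin N) =>
      if endpoint x l = x ∧ Unmarked x l then
        ∫ ω, ((trail x l).map fun a => M ω a.1 a.2).prod ∂P else 0 := by
  set G : (Fin (L + 1) → Fin N) → 𝕜 := fun p =>
    if Unmarked (p 0) (List.ofFn fun j : Fin L => p j.succ) then
      ∫ ω, ((trail (p 0) (List.ofFn fun j : Fin L => p j.succ)).map fun a => M ω a.1 a.2).prod ∂P
    else 0 with hG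
  have h1 : unmarkedOriginContribution P M L = ∑ p : ClosedPath N L, G p.1 := by
    unfold unmarkedOriginContribution
    rw [Finset.sum_filter]
    refine Finset.sum_congr rfl fun p _ => ?_
    simp only [hG, p.unmarked_iff, p.weight_eq]
  have h2 : ∑ p : ClosedPath N L, G p.1
      = ∑ p : Fin (L + 1) → Fin N, if p 0 = p (Fin.last L) then G p else 0 := by
    refine Eq.trans ?_ (Finset.sum_filter (fun p : Fin (L + 1) → Fin N => p 0 = p (Fin.last L)) G)
    exact (Finset.sum_subtype _ (by simp) G).symm
  rw [h1, h2, ← (Fin.consEquiv fun _ : Fin (L + 1) => Fin N).sum_comp, Fintype.sum_prod_type]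
  refine Finset.sum_congr rfl fun x _ => ?_
  rw [listSum_ofFn]
  refine Finset.sum_congr rfl fun f _ => ?_
  have h3 := endpoint_ofFn (Fin.cons x f : Fin (L + 1) → Fin N)
  simp only [Fin.cons_zero, Fin.cons_succ] at h3
  simp only [hG, Fin.consEquiv, Equiv.coe_fn_mk, Fin.cons_zero, Fin.cons_succ, h3, ite_and]
  by_cases h : Fin.cons (α := fun _ => Fin N) x f (Fin.last L) = x
  · rw [if_pos h, if_pos h.symm]
  · rw [if_neg h, if_neg (Ne.symm h)]

namespace WignerModel

variable {Ω 𝕜 : Type*} [MeasurableSpace Ω] [RCLike 𝕜] {P : Measure Ω} [IsProbabilityMeasure P]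
  {σ β C : ℝ} {N : ℕ} {W : Ω → Matrix (Fin N) (Fin N) 𝕜}

lemma integrable_prod_one (hW : WignerModel P σ β C N W) (c : 𝕜) (m : List (Fin N × Fin N)) :
    Integrable (fun ω => (m.map fun a => W ω a.1 a.2 / c).prod) P := by
  have h := hW.integrable_prod c m
  have h1 := h.1 1
  simp only [pow_one] at h1
  exact (integrable_norm_iff h.2.aestronglyMeasurable).1 h1

/-- The accumulator `m'` collects the random factors chosen so far in the expansion. -/
lemma integrable_prod_add (hW : WignerModel P σ β C N W) (c d : 𝕜)
    (m m' : List (Fin N × Fin N)) :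
    Integrable (fun ω => (m'.map fun a => W ω a.1 a.2 / c).prod *
      (m.map fun a => W ω a.1 a.2 / c + d).prod) P := by
  induction m generalizing m' with
  | nil => simpa using hW.integrable_prod_one c m'
  | cons a m ih =>
    refine ((ih (a :: m')).add ((ih m').const_mul d)).congr (ae_of_all _ fun ω => ?_)
    simp only [List.map_cons, List.prod_cons, Pi.add_apply]
    ring

/-- The contribution of the paths with an unmarked origin as a sum over decorated walks. -/
lemma unmarkedOriginContribution_eq (hW : WignerModel P σ β C N W) (θ : ℝ) (L : ℕ) :
    unmarkedOriginContribution P (fun ω => deformed θ (W ω)) L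
      = WalkState.unmarkedSum θ (arcMean P W) L := by
  classical
  rw [_root_.unmarkedOriginContribution_eq, WalkState.unmarkedSum]
  refine Finset.sum_congr rfl fun x _ => ?_
  set c : 𝕜 := ((√(N : ℝ) : ℝ) : 𝕜) with hc
  set d : 𝕜 := ((θ / N : ℝ) : 𝕜) with hd
  set f : List (Fin N) → 𝕜 := fun l => if endpoint x l = x ∧ Unmarked x l then 1 else 0 with hf
  have e1 : (listSum L fun l : List (Fin N) => if endpoint x l = x ∧ Unmarked x l then
        ∫ ω, ((trail x l).map fun a => deformed θ (W ω) a.1 a.2).prod ∂P else 0)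
      = ∫ ω, listSum L (fun l => f l * ((trail x l).map fun a => W ω a.1 a.2 / c + d).prod) ∂P := by
    rw [integral_listSum]
    · refine listSum_congr fun l _ => ?_
      rw [integral_const_mul]
      simp only [hf, ite_mul, one_mul, zero_mul]
      rfl
    · intro l
      refine Integrable.const_mul ?_ _
      simpa using hW.integrable_prod_add c d (trail x l) []
  rw [e1]
  simp only [listSum_prod_add (fun a : Fin N × Fin N => W _ a.1 a.2 / c) d L x f]
  rw [integral_listSum]
  · refine listSum_congr fun l _ => ?_
    rw [integral_const_mul, integral_const_mul]
    simp only [hf, ite_mul, one_mul, zero_mul, WalkState.walkWeight, Fintype.card_fin]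
    rfl
  · exact fun l => ((hW.integrable_prod_one c _).const_mul _).const_mul _

end WignerModel

/-! ### The limit -/

section Limit

variable {θ σ : ℝ}

/-- The errors are kept apart because the first one, a geometric sum that converges since 2σ < ρ_θ,
is small only through Γ, while the others vanish as N grows. -/
lemma sum_error_le (hσ : 0 < σ) (hθ : σ < θ) {Γ : ℝ} (hΓ : 0 < Γ) (L : ℕ) (y : ℝ) :
    (θ * ∑ r ∈ Finset.range L, (9 / Γ * ((2 * σ) ^ r * rho θ σ ^ (L - 1 - r))
        + 9 * θ / σ * (2 * σ) ^ (L - 1)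
        + y * WalkState.chainWeight θ σ r (L - 1 - r))) / rho θ σ ^ L
      ≤ 9 * θ / (rho θ σ - 2 * σ) / Γ
        + (9 * θ ^ 2 / (2 * σ ^ 2) * (L * (2 * σ / rho θ σ) ^ L)
          + y * (θ * (∑ r ∈ Finset.range L, WalkState.chainWeight θ σ r (L - 1 - r))
            / rho θ σ ^ L)) := by
  have h0 : 0 < θ := hσ.trans hθ
  have hρ := WalkState.rho_pos hσ hθ
  have hgap : 0 < rho θ σ - 2 * σ := sub_pos.2 (WalkState.two_mul_lt_rho hσ hθ)
  have h1 : ∑ r ∈ Finset.range L, (2 * σ) ^ r * rho θ σ ^ (L - 1 - r)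
      ≤ rho θ σ ^ L / (rho θ σ - 2 * σ) := by
    rw [le_div_iff₀ hgap]
    have h2 := geom_sum₂_mul (2 * σ) (rho θ σ) L
    have h3 : 0 ≤ (2 * σ) ^ L := by positivity
    linarith
  have h2 : (L : ℝ) * (2 * σ) ^ (L - 1) = L * (2 * σ) ^ L / (2 * σ) := by
    cases L with
    | zero => simp
    | succ L =>
      rw [Nat.add_sub_cancel, pow_succ]
      field_simp
  rw [Finset.sum_add_distrib, Finset.sum_add_distrib]
  simp only [← Finset.mul_sum, Finset.sum_const, Finset.card_range, nsmul_eq_mul]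
  rw [h2]
  set S := ∑ r ∈ Finset.range L, WalkState.chainWeight θ σ r (L - 1 - r)
  set G := ∑ r ∈ Finset.range L, (2 * σ) ^ r * rho θ σ ^ (L - 1 - r)
  have h4 : θ * (9 / Γ * G) / rho θ σ ^ L ≤ 9 * θ / (rho θ σ - 2 * σ) / Γ := by
    calc θ * (9 / Γ * G) / rho θ σ ^ L
        ≤ θ * (9 / Γ * (rho θ σ ^ L / (rho θ σ - 2 * σ))) / rho θ σ ^ L := by gcongr
      _ = _ := by field_simp
  have h5 : (θ * (9 / Γ * G + 9 * θ / σ * (L * (2 * σ) ^ L / (2 * σ)) + y * S)) / rho θ σ ^ L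
      = θ * (9 / Γ * G) / rho θ σ ^ L + (9 * θ ^ 2 / (2 * σ ^ 2) * (L * (2 * σ / rho θ σ) ^ L)
          + y * (θ * S / rho θ σ ^ L)) := by
    rw [div_pow]
    field_simp
    ring
  rw [h5]
  linarith

/-- The limit for any weights of Wigner type. -/
theorem tendsto_unmarkedSum {𝕜 : Type*} [RCLike 𝕜] (hσ : 0 < σ) (hθ : σ < θ) {K : ℝ}
    (hK : 1 ≤ K) {L : ℕ → ℕ} (hL : Tendsto L atTop atTop)
    (hLN : Tendsto (fun N : ℕ => (L N : ℝ) ^ 2 / N) atTop (𝓝 0))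
    {E : ∀ N, List (Fin N × Fin N) → 𝕜} (hE : ∀ N, ArcWeights σ K (E N)) :
    Tendsto (fun N => WalkState.unmarkedSum θ (E N) (L N) /
      ((rho θ σ ^ L N * (σ ^ 2 / θ ^ 2) : ℝ) : 𝕜)) atTop (𝓝 1) := by
  have h0 : 0 < θ := hσ.trans hθ
  have hρ := WalkState.rho_pos hσ hθ
  have hgap : 0 < rho θ σ - 2 * σ := sub_pos.2 (WalkState.two_mul_lt_rho hσ hθ)
  have hlam1 : 2 * σ / rho θ σ < 1 := by
    rw [div_lt_one hρ]; exact WalkState.two_mul_lt_rho hσ hθ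
  set S : ℕ → ℝ := fun N => θ * (∑ r ∈ Finset.range (L N),
    WalkState.chainWeight θ σ r (L N - 1 - r)) / rho θ σ ^ L N with hS
  have hSlim : Tendsto S atTop (𝓝 (σ ^ 2 / θ ^ 2)) :=
    (WalkState.tendsto_sum_chainWeight hσ hθ).comp hL
  have herr : Tendsto (fun N => 9 * θ ^ 2 / (2 * σ ^ 2) * (L N * (2 * σ / rho θ σ) ^ L N)
      + (L N : ℝ) ^ 2 / N * S N) atTop (𝓝 0) := by
    have e1 := ((tendsto_self_mul_const_pow_of_lt_one (by positivity) hlam1).comp hL).const_mul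
      (9 * θ ^ 2 / (2 * σ ^ 2))
    have e2 := hLN.mul hSlim
    simpa using e1.add e2
  have hdiff : Tendsto (fun N => WalkState.unmarkedSum θ (E N) (L N) / ((rho θ σ ^ L N : ℝ) : 𝕜)
      - (S N : 𝕜)) atTop (𝓝 0) := by
    rw [tendsto_zero_iff_norm_tendsto_zero, Metric.tendsto_nhds]
    intro ε hε
    set c := 9 * θ / (rho θ σ - 2 * σ) with hc
    have hc0 : 0 < c := by positivity
    -- The penalty is fixed before N, so that the walks with defects contribute less than ε/2. The
    -- smallness of L²/N required by this Γ then holds eventually.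
    set Γ := 1 + 2 * c / ε with hΓ
    have hΓ1 : 1 ≤ Γ := by
      have : 0 ≤ 2 * c / ε := by positivity
      linarith
    have hcΓ : c / Γ < ε / 2 := by
      rw [div_lt_iff₀ (by linarith), hΓ]
      have : ε / 2 * (1 + 2 * c / ε) = ε / 2 + c := by field_simp
      linarith
    have ev1 : ∀ᶠ N : ℕ in atTop, (L N : ℝ) ^ 2 / N < 1 / (34 * Γ ^ 2 * K) :=
      hLN.eventually_lt_const (by positivity)
    have ev2 := herr.eventually_lt_const (half_pos hε)
    filter_upwards [ev1, ev2, eventually_gt_atTop 0] with N h1 h2 hN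
    have hN' : (0 : ℝ) < N := by exact_mod_cast hN
    have hD : 1 ≤ 34 * Γ ^ 2 * K := by
      have : 1 ≤ Γ ^ 2 := one_le_pow₀ hΓ1
      nlinarith
    have hLN' : L N ≤ N := by
      have h3 : (L N : ℝ) ^ 2 / N ≤ 1 :=
        h1.le.trans (by rw [div_le_one (by linarith)]; exact hD)
      rw [div_le_one hN'] at h3
      have h4 : L N ^ 2 ≤ N := by exact_mod_cast h3
      nlinarith
    have hη : 34 * Γ ^ 2 * K * L N / Fintype.card (Fin N) * L N ≤ 1 := by
      rw [lt_div_iff₀ (by linarith)] at h1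
      rw [Fintype.card_fin]
      calc 34 * Γ ^ 2 * K * L N / N * L N = (L N : ℝ) ^ 2 / N * (34 * Γ ^ 2 * K) := by ring
        _ ≤ 1 := h1.le
    have key := WalkState.norm_unmarkedSum_sub_le hσ hθ hK hΓ1 (by simpa using hN)
      (by simpa using hLN') hη (hE N)
    rw [Fintype.card_fin] at key
    have hpow : 0 < rho θ σ ^ L N := by positivity
    have e1 : WalkState.unmarkedSum θ (E N) (L N) / ((rho θ σ ^ L N : ℝ) : 𝕜) - (S N : 𝕜)
        = (WalkState.unmarkedSum θ (E N) (L N) - ((θ * ∑ r ∈ Finset.range (L N),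
          WalkState.chainWeight θ σ r (L N - 1 - r) : ℝ) : 𝕜)) / ((rho θ σ ^ L N : ℝ) : 𝕜) := by
      rw [sub_div, hS, RCLike.ofReal_div]
    have hdist : ‖WalkState.unmarkedSum θ (E N) (L N) / ((rho θ σ ^ L N : ℝ) : 𝕜) - (S N : 𝕜)‖
        < ε := by
      rw [e1, norm_div, RCLike.norm_ofReal, abs_of_pos hpow]
      have h3 := div_le_div_of_nonneg_right key hpow.le
      have h4 := sum_error_le hσ hθ (by linarith : 0 < Γ) (L N) ((L N : ℝ) ^ 2 / N)
      simp only [hS] at h2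
      linarith
    rwa [dist_zero_right, norm_norm]
  have hA : Tendsto (fun N => WalkState.unmarkedSum θ (E N) (L N) / ((rho θ σ ^ L N : ℝ) : 𝕜))
      atTop (𝓝 ((σ ^ 2 / θ ^ 2 : ℝ) : 𝕜)) := by
    have h1 : Tendsto (fun N => (S N : 𝕜)) atTop (𝓝 ((σ ^ 2 / θ ^ 2 : ℝ) : 𝕜)) :=
      (RCLike.continuous_ofReal.tendsto _).comp hSlim
    simpa using hdiff.add h1
  have hx : ((σ ^ 2 / θ ^ 2 : ℝ) : 𝕜) ≠ 0 := by
    rw [Ne, RCLike.ofReal_eq_zero]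
    positivity
  have hB := hA.div_const ((σ ^ 2 / θ ^ 2 : ℝ) : 𝕜)
  rw [div_self hx] at hB
  refine hB.congr fun N => ?_
  rw [RCLike.ofReal_mul, div_div]

end Limit

theorem theorem4p9 (θ σ : ℝ) (hσ : 0 < σ) (hθ : σ < θ) (s L : ℕ → ℕ)
    (hs : Tendsto s atTop atTop)
    (hs' : (fun N : ℕ => (s N : ℝ)) =o[atTop] fun N : ℕ => √(N : ℝ))
    (hL : ∀ N, L N = 2 * s N ∨ L N = 2 * s N + 1) (β C : ℝ)
    (Ω : ℕ → Type*) [∀ N, MeasurableSpace (Ω N)]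
    (P : ∀ N, Measure (Ω N)) [∀ N, IsProbabilityMeasure (P N)] :
    (∀ W : ∀ N, Ω N → Matrix (Fin N) (Fin N) ℂ,
      (∀ N, IsComplexWigner (P N) σ β C N (W N)) →
      Tendsto (fun N =>
        unmarkedOriginContribution (P N) (fun ω => deformed θ (W N ω)) (L N) /
          ((rho θ σ ^ L N * (σ ^ 2 / θ ^ 2) : ℝ) : ℂ)) atTop (𝓝 1)) ∧
    (∀ W : ∀ N, Ω N → Matrix (Fin N) (Fin N) ℝ,
      (∀ N, IsRealWigner (P N) σ β C N (W N)) →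
      Tendsto (fun N =>
        unmarkedOriginContribution (P N) (fun ω => deformed θ (W N ω)) (L N) /
          (rho θ σ ^ L N * (σ ^ 2 / θ ^ 2))) atTop (𝓝 1)) := by
  have hLtop : Tendsto L atTop atTop :=
    tendsto_atTop_mono (fun N => by rcases hL N with h | h <;> omega) hs
  have hs2 : Tendsto (fun N : ℕ => (s N : ℝ) ^ 2 / N) atTop (𝓝 0) := by
    have h := hs'.tendsto_div_nhds_zero.pow 2
    rw [zero_pow two_ne_zero] at h
    refine h.congr fun N => ?_
    rw [div_pow, Real.sq_sqrt (Nat.cast_nonneg N)]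
  have hLN : Tendsto (fun N : ℕ => (L N : ℝ) ^ 2 / N) atTop (𝓝 0) := by
    have h9 := hs2.const_mul 9
    rw [mul_zero] at h9
    refine squeeze_zero' (Eventually.of_forall fun N => by positivity) ?_ h9
    -- The bound 2s + 1 ≤ 3s needs s ≥ 1.
    filter_upwards [hs.eventually_ge_atTop 1] with N hN
    have h1 : (L N : ℝ) ≤ 3 * s N := by
      have : L N ≤ 3 * s N := by rcases hL N with h | h <;> omega
      exact_mod_cast this
    calc (L N : ℝ) ^ 2 / N ≤ (3 * s N) ^ 2 / N := by gcongr
      _ = 9 * ((s N : ℝ) ^ 2 / N) := by ring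
  refine ⟨fun W hW => ?_, fun W hW => ?_⟩
  · have hM := fun N => (hW N).wignerModel
    simp only [fun N => (hM N).unmarkedOriginContribution_eq θ (L N)]
    exact tendsto_unmarkedSum hσ hθ (one_le_growthConst σ (2 * β) C) hLtop hLN
      fun N => (hM N).arcWeights hσ
  · have hM := fun N => (hW N).wignerModel
    simp only [fun N => (hM N).unmarkedOriginContribution_eq θ (L N)]
    exact tendsto_unmarkedSum hσ hθ (one_le_growthConst σ β C) hLtop hLN
      fun N => (hM N).arcWeights hσ
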